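/- Let $r\ge 1$. For a simplex $T$ of dimension $n\ge 0$ in a Euclidean space, let $\mathcal P_r\Lambda^k(T)$ be the space of differential $k$-forms on $T$ whose coefficients are polynomials of degree at most $r$, and let $$\mathcal P_r^-\Lambda^k(T)=\{u\in\mathcal P_r\Lambda^k(T):\ \kappa u\in \mathcal P_r\Lambda^{k-1}(T)\},$$ where $\kappa$ is contraction with the vector field $x\mapsto x-o$, $o$ being an origin in the affine span of $T$ (the choice of $o$ does not matter; $\kappa u=0$ if $k=0$). A subscript $0$ denotes the subspace of forms whose pullback to $\partial T$ vanishes. For a family of spaces $A^\bullet(T)$, $\mathrm H^{k}(A^\bullet_0(T))$ denotes the $k$-th cohomology group of the sequence $$0\to A^0_0(T)\xrightarrow{d}A^1_0(T)\xrightarrow{d}\cdots\xrightarrow{d}A^{n}_0(T)\xrightarrow{\int_T}\mathbb R\to 0,$$ with $\mathbb R$ in degree $n+1$ (all groups in degrees larger than $n+1$ are zero). (a) For every simplex $T$ and every $k\ge 0$, $$\dim \mathcal P_r^-\Lambda^k_0(T)=\dim\mathcal P_{r-1}\Lambda^k_0(T)+\dim \mathrm H^{k+1}(\mathcal P_{r-1}\Lambda^\bullet_0(T)).$$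 (b) On every simplicial complex $\mathcal T$, the spaces $\mathcal P_r^-\Lambda^k(T)$ form a minimal compatible finite element system containing the spaces $\mathcal P_{r-1}\Lambda^k(T)$. Here a finite element system (FES) $E$ on $\mathcal T$ consists of finite dimensional spaces $E^k(T)$ ($T\in\mathcal T$, $k\ge 0$) of $k$-forms on $T$ whose pullbacks to all faces of $T$ (including $T$) are square integrable with square integrable exterior derivative, such that $d E^k(T)\subseteq E^{k+1}(T)$ and pullback to a face $T'\subseteq T$ maps $E^k(T)$ into $E^k(T')$. Exterior derivatives and pullbacks to faces are understood in the weak sense given by Green's formula. The FES is compatible if, for all $T$ and $k$, every family of forms in $E^k(T')$, $T'\subsetneq T$, that is compatible with pullbacks is the restriction of an element of $E^k(T)$, and if for all $T$ the sequence $0\to\mathbb R\to E^0(T)\to E^1(T)\to\cdots\to E^{\dim T}(T)\to 0$ is exact. Minimal means: if $B$ is any compatible FES on $\mathcal T$ with $\mathcal P_{r-1}\Lambda^k(T)\subseteq B^k(T)$ for all $T$ and $k$, then for all $T$ and $k$ $$\dim\mathcal P_r^-\Lambda^k_0(T)\le\dim B^k_0(T),\qquad \dim\mathcal P_r^-\Lambda^k(T)\le\dim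 B^k(T),$$ and, if $\mathcal T$ is finite, $\dim\mathcal P_r^-\Lambda^k(\mathcal T)\le\dim B^k(\mathcal T)$ for all $k$, where $E^k(\mathcal T)$ is the space of families $(u_T)_{T\in\mathcal T}$, $u_T\in E^k(T)$, that are compatible with pullbacks. -/

import Mathlib

open MeasureTheory ProbabilityTheory
open scoped ContDiff

set_option linter.unusedSectionVars false

noncomputable section

namespace FES

variable {E : Type*} [NormedAddCommGroup E] [InnerProductSpace ℝ E] [FiniteDimensional ℝ E]
  [MeasurableSpace E] [BorelSpace E]

/-! ### Simplices

The ambient space `E` is a Euclidean space. A simplex is given by its vertex set, a nonempty affinely independent `T : Finset E`. The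
point set of the simplex is `convexHull ℝ T` and its dimension is `T.card - 1`. -/

/-- The tangent space of the simplex `T`. -/
abbrev tangent (T : Finset E) : Submodule ℝ E := vectorSpan ℝ (T : Set E)

/-- The faces of the simplex `T`, including `T` itself. -/
abbrev Face (T : Finset E) := {F : Finset E // F.Nonempty ∧ F ⊆ T}

/-- The uniform probability measure on the simplex `T`: normalized `dim T`-dimensional
Hausdorff measure. -/
def unif (T : Finset E) : Measure E :=
  ProbabilityTheory.cond (Measure.hausdorffMeasure ((T.card - 1 : ℕ) : ℝ))
    (convexHull ℝ (T : Set E))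

instance (T : Finset E) : IsFiniteMeasure (unif T) := by
  unfold unif; infer_instance

/-! ### Square integrable forms -/

/-- Alternating `k`-forms on the vector space `V`. -/
abbrev Alt (V : Type*) [NormedAddCommGroup V] [InnerProductSpace ℝ V] (k : ℕ) :=
  V [⋀^Fin k]→L[ℝ] ℝ

/-- Square integrable differential `k`-forms on the simplex `T`. -/
abbrev L2Form (T : Finset E) (k : ℕ) :=
  Lp (Alt (tangent T) k) 2 (unif T)

/-- A form on `T` together with its pullbacks to all the faces of `T` (including `T` itself). For
the elements of `sobolev` below the pullbacks are determined by the form on `T`. -/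
abbrev Form (T : Finset E) (k : ℕ) := (F : Face T) → L2Form F.1 k

/-- Pullback of a form from `T` to the face `F`. -/
def pull {T F : Finset E} (h : F ⊆ T) (k : ℕ) : Form T k →ₗ[ℝ] Form F k where
  toFun u := fun G => u ⟨G.1, G.2.1, G.2.2.trans h⟩
  map_add' _ _ := rfl
  map_smul' _ _ := rfl

/-- The average over `F` of `g` times the component of `u` along the tangent vectors `w`. -/
def avg (F : Finset E) {k : ℕ} (g : E → ℝ) (w : Fin k → tangent F)
    (u : L2Form F k) : ℝ :=
  ∫ x, g x * u x w ∂(unif F)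

lemma integrable_avg (F : Finset E) {k : ℕ} {g : E → ℝ} (hg : Continuous g)
    (w : Fin k → tangent F) (u : L2Form F k) :
    Integrable (fun x => g x * u x w) (unif F) := by
  have hcomp : IsCompact (convexHull ℝ (F : Set E)) :=
    F.finite_toSet.isCompact_convexHull ℝ
  have h1 : Integrable (fun x => u x w) (unif F) :=
    ContinuousLinearMap.integrable_comp
      (ContinuousAlternatingMap.apply ℝ (tangent F) ℝ w : Alt (tangent F) k →L[ℝ] ℝ)
      ((Lp.memLp u).integrable (by norm_num))
  obtain ⟨c, hc⟩ := hcomp.exists_bound_of_continuousOn hg.continuousOn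
  refine h1.bdd_mul (c := c) hg.aestronglyMeasurable ?_
  have : ∀ᵐ x ∂(unif F), x ∈ convexHull ℝ (F : Set E) :=
    ae_cond_mem hcomp.measurableSet
  filter_upwards [this] with x hx using hc x hx

lemma avg_add (F : Finset E) {k : ℕ} {g : E → ℝ} (hg : Continuous g)
    (w : Fin k → tangent F) (u v : L2Form F k) :
    avg F g w (u + v) = avg F g w u + avg F g w v := by
  unfold avg
  rw [← integral_add (integrable_avg F hg w u) (integrable_avg F hg w v)]
  refine integral_congr_ae ?_
  filter_upwards [Lp.coeFn_add u v] with x hx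
  rw [hx]
  simp [mul_add]

lemma avg_smul (F : Finset E) {k : ℕ} (g : E → ℝ)
    (w : Fin k → tangent F) (a : ℝ) (u : L2Form F k) :
    avg F g w (a • u) = a * avg F g w u := by
  unfold avg
  rw [← integral_const_mul]
  refine integral_congr_ae ?_
  filter_upwards [Lp.coeFn_smul a u] with x hx
  rw [hx]
  simp [mul_left_comm]

lemma avg_zero (F : Finset E) {k : ℕ} (g : E → ℝ) (w : Fin k → tangent F) :
    avg F g w (0 : L2Form F k) = 0 := by
  simpa using avg_smul F g w 0 (0 : L2Form F k)

/-! ### Weak exterior derivative and traces -/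

open scoped Classical in
/-- The contribution to Green's formula on the face `F` of the facet opposite to the vertex `x`,
for a test function `φ` and test vectors `w j` whose barycentric components are `c j`. -/
def facetTerm {T : Finset E} {k : ℕ} (u : Form T k) (F : Face T) (φ : E → ℝ)
    (w : Fin (k + 1) → tangent F.1) (c : Fin (k + 1) → E → ℝ) (x : E) : ℝ :=
  if h : (F.1.erase x).Nonempty then
    ∑ j : Fin (k + 1), (-1 : ℝ) ^ (j : ℕ) * c j x *
      avg (F.1.erase x) φ
        (fun i => (tangent (F.1.erase x)).orthogonalProjectionOnto (w (j.succAbove i)))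
        (u ⟨F.1.erase x, h, (F.1.erase_subset x).trans F.2.2⟩)
  else 0

/-- `IsExtDeriv u v`: on every face `F` of `T`, the form `v` is the weak exterior derivative of `u`
on `F`, and the traces of `u` on the facets of `F` are the ones recorded in `u`.

This is Green's formula `∫_F φ du + ∫_F dφ ∧ u = ∫_∂F φ ν ∧ u`, required for all smooth test
functions `φ` and evaluated on all constant tangent vectors `w 0, …, w k` of `F`. It is written with
averages over `F` and over its facets. Indeed, if `λ_x` is the barycentric coordinate of `F` at the
vertex `x` and `F_x` is the facet opposite to `x`, the divergence theorem on `F` reads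
`⨍_F ∂_w f = - dim F * ∑_x dλ_x(w) ⨍_{F_x} f`. A tangent vector `w j` is `∑_y c j y • y`
with `∑_y c j y = 0`, and then `dλ_x(w j) = c j x`. The form `dλ_x ∧ u` on `F_x` depends only on
the pullback of `u` to `F_x`, so vectors may be projected to the tangent space of `F_x`. -/
def IsExtDeriv {T : Finset E} {k : ℕ} (u : Form T k) (v : Form T (k + 1)) : Prop :=
  ∀ (F : Face T) (φ : E → ℝ), ContDiff ℝ ∞ φ →
    ∀ (w : Fin (k + 1) → tangent F.1) (c : Fin (k + 1) → E → ℝ),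
      (∀ j, ∑ y ∈ F.1, c j y = 0) → (∀ j, ∑ y ∈ F.1, c j y • y = (w j : E)) →
      avg F.1 φ w (v F) +
          ∑ j : Fin (k + 1), (-1 : ℝ) ^ (j : ℕ) *
            avg F.1 (fun x => fderiv ℝ φ x (w j : E)) (fun i => w (j.succAbove i)) (u F)
        = - ((F.1.card - 1 : ℕ) : ℝ) * ∑ x ∈ F.1, facetTerm u F φ w c x

lemma facetTerm_add {T : Finset E} {k : ℕ} (u u' : Form T k) (F : Face T) {φ : E → ℝ}
    (hφ : Continuous φ) (w : Fin (k + 1) → tangent F.1) (c : Fin (k + 1) → E → ℝ) (x : E) :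
    facetTerm (u + u') F φ w c x = facetTerm u F φ w c x + facetTerm u' F φ w c x := by
  unfold facetTerm
  split_ifs with h
  · simp only [Pi.add_apply, avg_add _ hφ, mul_add, Finset.sum_add_distrib]
  · simp

lemma facetTerm_smul {T : Finset E} {k : ℕ} (a : ℝ) (u : Form T k) (F : Face T)
    (φ : E → ℝ) (w : Fin (k + 1) → tangent F.1) (c : Fin (k + 1) → E → ℝ) (x : E) :
    facetTerm (a • u) F φ w c x = a * facetTerm u F φ w c x := by
  unfold facetTerm
  split_ifs with h
  · simp only [Pi.smul_apply, avg_smul, Finset.mul_sum]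
    exact Finset.sum_congr rfl fun j _ => by ring
  · simp

lemma IsExtDeriv.add {T : Finset E} {k : ℕ} {u u' : Form T k} {v v' : Form T (k + 1)}
    (h : IsExtDeriv u v) (h' : IsExtDeriv u' v') : IsExtDeriv (u + u') (v + v') := by
  intro F φ hφ w c hc hw
  have e := h F φ hφ w c hc hw
  have e' := h' F φ hφ w c hc hw
  have hd : ∀ j, Continuous (fun x => fderiv ℝ φ x (w j : E)) := fun j =>
    (hφ.continuous_fderiv (by simp)).clm_apply continuous_const
  simp only [Pi.add_apply, avg_add _ hφ.continuous, avg_add _ (hd _), mul_add,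
    Finset.sum_add_distrib, facetTerm_add _ _ _ hφ.continuous] at *
  linarith

lemma IsExtDeriv.smul {T : Finset E} {k : ℕ} {u : Form T k} {v : Form T (k + 1)}
    (a : ℝ) (h : IsExtDeriv u v) : IsExtDeriv (a • u) (a • v) := by
  intro F φ hφ w c hc hw
  have e := h F φ hφ w c hc hw
  simp only [Pi.smul_apply, avg_smul, facetTerm_smul, ← Finset.mul_sum, mul_left_comm _ a,
    ← mul_add]
  rw [e]

lemma IsExtDeriv.zero {T : Finset E} {k : ℕ} :
    IsExtDeriv (0 : Form T k) (0 : Form T (k + 1)) := by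
  intro F φ hφ w c hc hw
  simp [avg_zero, facetTerm]

/-- The `k`-forms on `T` all of whose pullbacks to faces of `T` are square integrable with
square integrable exterior derivative. -/
def sobolev (T : Finset E) (k : ℕ) : Submodule ℝ (Form T k) where
  carrier := {u | ∃ v : Form T (k + 1), IsExtDeriv u v}
  add_mem' := by
    rintro u u' ⟨v, h⟩ ⟨v', h'⟩
    exact ⟨v + v', h.add h'⟩
  zero_mem' := ⟨0, IsExtDeriv.zero⟩
  smul_mem' := by
    rintro a u ⟨v, h⟩
    exact ⟨a • v, h.smul a⟩

/-- The constant `0`-form with value `a`. -/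
def IsConst {T : Finset E} (u : Form T 0) (a : ℝ) : Prop :=
  ∀ F : Face T, ∀ᵐ x ∂(unif F.1), ∀ w : Fin 0 → tangent F.1, u F x w = a

/-- The integral over `T` of a form of degree `dim T` (and zero for forms of any other degree). The
orientation of `T` is given by an arbitrary enumeration of its vertices. -/
def integralForm (T : Finset E) {k : ℕ} (u : Form T k) : ℝ :=
  if h : T.card = k + 1 then
    (k.factorial : ℝ)⁻¹ * avg T (fun _ => 1)
      (fun i => ⟨((T.equivFinOfCardEq h).symm i.succ : E) -
          ((T.equivFinOfCardEq h).symm 0 : E),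
        vsub_mem_vectorSpan ℝ (Subtype.prop _) (Subtype.prop _)⟩)
      (u ⟨T, Finset.card_pos.mp (by omega), subset_rfl⟩)
  else 0

lemma integralForm_add (T : Finset E) {k : ℕ} (u v : Form T k) :
    integralForm T (u + v) = integralForm T u + integralForm T v := by
  unfold integralForm
  split_ifs with h
  · rw [Pi.add_apply, avg_add _ continuous_const, mul_add]
  · simp

lemma integralForm_smul (T : Finset E) {k : ℕ} (a : ℝ) (u : Form T k) :
    integralForm T (a • u) = a * integralForm T u := by
  unfold integralForm
  split_ifs with h
  · rw [Pi.smul_apply, avg_smul]; ring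
  · simp

/-- The integral as a linear form. -/
def integralLin (T : Finset E) (k : ℕ) : Form T k →ₗ[ℝ] ℝ where
  toFun := integralForm T
  map_add' := integralForm_add T
  map_smul' := integralForm_smul T

/-! ### Finite element systems -/

/-- A family of spaces of `k`-forms on simplices `T`. -/
abbrev FormSystem (E : Type*) [NormedAddCommGroup E] [InnerProductSpace ℝ E]
    [MeasurableSpace E] [BorelSpace E] := (T : Finset E) → (k : ℕ) → Submodule ℝ (Form T k)

/-- `A` is a finite element system on the simplicial complex `K`. -/
structure IsFES (K : Geometry.SimplicialComplex ℝ E) (A : FormSystem E) : Prop where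
  finite : ∀ T ∈ K.faces, ∀ k, FiniteDimensional ℝ (A T k)
  le_sobolev : ∀ T ∈ K.faces, ∀ k, A T k ≤ sobolev T k
  extDeriv_mem : ∀ T ∈ K.faces, ∀ k, ∀ u ∈ A T k, ∃ v ∈ A T (k + 1), IsExtDeriv u v
  pull_mem : ∀ T ∈ K.faces, ∀ F ∈ K.faces, ∀ (h : F ⊆ T) (k : ℕ), ∀ u ∈ A T k, pull h k u ∈ A F k

/-- The forms in `A^k(T)` whose pullback to the boundary of `T` is zero. -/
def bdryZero (A : FormSystem E) (T : Finset E) (k : ℕ) : Submodule ℝ (Form T k) where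
  carrier := {u | u ∈ A T k ∧ ∀ F : Face T, F.1 ≠ T → u F = 0}
  add_mem' := by
    rintro u v ⟨hu, hu'⟩ ⟨hv, hv'⟩
    exact ⟨add_mem hu hv, fun F hF => by simp [hu' F hF, hv' F hF]⟩
  zero_mem' := ⟨zero_mem _, fun _ _ => rfl⟩
  smul_mem' := by
    rintro a u ⟨hu, hu'⟩
    exact ⟨Submodule.smul_mem _ a hu, fun F hF => by simp [hu' F hF]⟩

/-- Every element of `A^k(∂T)`, that is, every family of forms on the proper faces of `T` that
is compatible with pullbacks, extends to an element of `A^k(T)`. -/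
def AdmitsExtensions (A : FormSystem E) (T : Finset E) (k : ℕ) : Prop :=
  ∀ b : (F : {F : Finset E // F.Nonempty ∧ F ⊂ T}) → Form F.1 k,
    (∀ F, b F ∈ A F.1 k) → (∀ F G, ∀ h : G.1 ⊆ F.1, pull h k (b F) = b G) →
    ∃ u ∈ A T k, ∀ F, pull F.2.2.subset k u = b F

/-- Exactness of `0 → ℝ → A^0(T) → A^1(T) → ⋯ → A^{dim T}(T) → 0`. The spaces of forms of degree
larger than `dim T` are zero, so the conditions in those degrees only express
surjectivity onto `A^{dim T}(T)`. -/
structure LocallyExact (A : FormSystem E) (T : Finset E) : Prop where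
  exact_zero : ∀ u : Form T 0, (u ∈ A T 0 ∧ IsExtDeriv u 0) ↔ ∃ a, IsConst u a
  exact_succ : ∀ (k : ℕ) (v : Form T (k + 1)), v ∈ A T (k + 1) →
    (IsExtDeriv v 0 ↔ ∃ u ∈ A T k, IsExtDeriv u v)

/-- `A` is a compatible finite element system on `K`. -/
structure IsCompatibleFES (K : Geometry.SimplicialComplex ℝ E) (A : FormSystem E) : Prop
    extends IsFES K A where
  extensions : ∀ T ∈ K.faces, ∀ k, AdmitsExtensions A T k
  locallyExact : ∀ T ∈ K.faces, LocallyExact A T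

/-- The global space `A^k(K)` of families of forms on the cells of `K` compatible with pullbacks. -/
def globalSpace (K : Geometry.SimplicialComplex ℝ E) (A : FormSystem E) (k : ℕ) :
    Submodule ℝ ((T : K.faces) → Form T.1 k) where
  carrier := {u | (∀ T, u T ∈ A T.1 k) ∧ ∀ T F, ∀ h : F.1 ⊆ T.1, pull h k (u T) = u F}
  add_mem' := by
    rintro u v ⟨hu, hu'⟩ ⟨hv, hv'⟩
    exact ⟨fun T => add_mem (hu T) (hv T), fun T F h => by simp [hu' T F h, hv' T F h]⟩
  zero_mem' := ⟨fun _ => zero_mem _, fun _ _ _ => by simp⟩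
  smul_mem' := by
    rintro a u ⟨hu, hu'⟩
    exact ⟨fun T => Submodule.smul_mem _ a (hu T), fun T F h => by simp [hu' T F h]⟩

/-- `A ⊆ B` on the cells of `K`. -/
def ContainedIn (K : Geometry.SimplicialComplex ℝ E) (A B : FormSystem E) : Prop :=
  ∀ T ∈ K.faces, ∀ k, A T k ≤ B T k

/-- `M` is minimal among the compatible finite element systems on `K` containing `A`: its
spaces have the smallest dimensions, on each cell (with and without boundary conditions) and, if
`K` is finite, globally. -/
structure IsMinimalCompatibleFES (K : Geometry.SimplicialComplex ℝ E)
    (A M : FormSystem E) : Prop where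
  compatible : IsCompatibleFES K M
  contains : ContainedIn K A M
  minimal_bdryZero : ∀ B, IsCompatibleFES K B → ContainedIn K A B → ∀ T ∈ K.faces, ∀ k,
    Module.finrank ℝ (bdryZero M T k) ≤ Module.finrank ℝ (bdryZero B T k)
  minimal_cell : ∀ B, IsCompatibleFES K B → ContainedIn K A B → ∀ T ∈ K.faces, ∀ k,
    Module.finrank ℝ (M T k) ≤ Module.finrank ℝ (B T k)
  minimal_global : K.faces.Finite → ∀ B, IsCompatibleFES K B → ContainedIn K A B → ∀ k,
    Module.finrank ℝ (globalSpace K M k) ≤ Module.finrank ℝ (globalSpace K B k)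

/-! ### Cohomology with boundary condition

The complex is `0 → A^0_0(T) → A^1_0(T) → ⋯ → A^n_0(T) → ℝ → 0` with `n = dim T`, where the map to
`ℝ` is integration and `ℝ` sits in degree `n + 1 = T.card`. -/

/-- The cocycles of degree `k` for `k ≤ dim T`. -/
def cocycles (A : FormSystem E) (T : Finset E) (k : ℕ) : Submodule ℝ (Form T k) where
  carrier := {u | u ∈ bdryZero A T k ∧ IsExtDeriv u 0 ∧ integralForm T u = 0}
  add_mem' := by
    rintro u v ⟨hu, hu', hu''⟩ ⟨hv, hv', hv''⟩
    exact ⟨add_mem hu hv, by simpa using hu'.add hv', by simp [integralForm_add, hu'', hv'']⟩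
  zero_mem' := ⟨zero_mem _, IsExtDeriv.zero, (integralLin T k).map_zero⟩
  smul_mem' := by
    rintro a u ⟨hu, hu', hu''⟩
    exact ⟨Submodule.smul_mem _ a hu, by simpa using hu'.smul a,
      by simp [integralForm_smul, hu'']⟩

/-- The coboundaries of degree `k` for `k ≤ dim T`. -/
def coboundaries (A : FormSystem E) (T : Finset E) : (k : ℕ) → Submodule ℝ (Form T k)
  | 0 => ⊥
  | k + 1 =>
    { carrier := {v | ∃ u ∈ bdryZero A T k, IsExtDeriv u v}
      add_mem' := by
        rintro v v' ⟨u, hu, h⟩ ⟨u', hu', h'⟩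
        exact ⟨u + u', add_mem hu hu', h.add h'⟩
      zero_mem' := ⟨0, zero_mem _, IsExtDeriv.zero⟩
      smul_mem' := by
        rintro a v ⟨u, hu, h⟩
        exact ⟨a • u, Submodule.smul_mem _ a hu, h.smul a⟩ }

/-- The dimension of the cohomology group `H^k(A_0(T))`: cocycles modulo coboundaries for
`k ≤ dim T`, and the cokernel of integration for `k = dim T + 1`. -/
def dimCohomology (A : FormSystem E) (T : Finset E) (k : ℕ) : ℕ :=
  if k = T.card then
    Module.finrank ℝ (ℝ ⧸ (bdryZero A T (T.card - 1)).map (integralLin T (T.card - 1)))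
  else
    Module.finrank ℝ (cocycles A T k ⧸ (coboundaries A T k).comap (cocycles A T k).subtype)

/-! ### Polynomial forms -/

/-- `f` is a polynomial function of degree at most `r` on `E`, that is, a polynomial expression in linear forms. -/
def IsPoly (r : ℕ) (f : E → ℝ) : Prop :=
  ∃ p : MvPolynomial (Module.Dual ℝ E) ℝ,
    p.totalDegree ≤ r ∧ ∀ x, f x = MvPolynomial.eval (fun l => l x) p

lemma IsPoly.add {r : ℕ} {f g : E → ℝ} (hf : IsPoly r f) (hg : IsPoly r g) :
    IsPoly r (fun x => f x + g x) := by
  obtain ⟨p, hp, h⟩ := hf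
  obtain ⟨q, hq, h'⟩ := hg
  exact ⟨p + q, (MvPolynomial.totalDegree_add p q).trans (max_le hp hq), fun x => by
    simp [h x, h' x]⟩

lemma IsPoly.smul {r : ℕ} {f : E → ℝ} (a : ℝ) (hf : IsPoly r f) :
    IsPoly r (fun x => a * f x) := by
  obtain ⟨p, hp, h⟩ := hf
  exact ⟨a • p, (MvPolynomial.totalDegree_smul_le a p).trans hp, fun x => by
    simp [h x, MvPolynomial.smul_eval]⟩

/-- `P_r Λ^k(T)`: the `k`-forms on `T` that are pullbacks to `T` (and to its faces) of a
`k`-form on the ambient space whose coefficients are polynomials of degree at most `r`. -/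
def polyForms (r : ℕ) : FormSystem E := fun T k =>
  { carrier := {u | ∃ α : E → Alt E k,
      (∀ w : Fin k → E, IsPoly r (fun x => α x w)) ∧
      ∀ F : Face T, ∀ᵐ x ∂(unif F.1),
        u F x = (α x).compContinuousLinearMap (tangent F.1).subtypeL}
    add_mem' := by
      rintro u v ⟨α, hα, hu⟩ ⟨η, hη, hv⟩
      refine ⟨α + η, fun w => (hα w).add (hη w), fun F => ?_⟩
      filter_upwards [hu F, hv F, Lp.coeFn_add (u F) (v F)] with x h1 h2 h3
      rw [Pi.add_apply, h3, Pi.add_apply, h1, h2]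
      ext w
      simp
    zero_mem' := by
      refine ⟨0, fun w => ⟨0, by simp, by simp⟩, fun F => ?_⟩
      filter_upwards [Lp.coeFn_zero (Alt (tangent F.1) k) 2 (unif F.1)] with x h
      rw [Pi.zero_apply, h]
      ext w
      simp
    smul_mem' := by
      rintro a u ⟨α, hα, hu⟩
      refine ⟨a • α, fun w => (hα w).smul a, fun F => ?_⟩
      filter_upwards [hu F, Lp.coeFn_smul a (u F)] with x h1 h3
      rw [Pi.smul_apply, h3, Pi.smul_apply, h1]
      ext w
      simp }

/-- `v = κ u` on `T`, where `κ` is the contraction with the vector field `x ↦ x - o`, which is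
tangent to `T` if the origin `o` is in the affine span of `T`. -/
def IsKoszul {T : Finset E} {k : ℕ} (o : E) (u : Form T (k + 1)) (v : Form T k) : Prop :=
  ∀ h : T.Nonempty, ∀ᵐ x ∂(unif T), ∀ (hx : x - o ∈ tangent T) (w : Fin k → tangent T),
    v ⟨T, h, subset_rfl⟩ x w =
      u ⟨T, h, subset_rfl⟩ x (Fin.cons (⟨x - o, hx⟩ : tangent T) w : Fin (k + 1) → tangent T)

/-- `P_r^- Λ^k(T) = {u ∈ P_r Λ^k(T) : κ u ∈ P_r Λ^{k-1}(T)}`. For `k = 0`, `κ u = 0`. -/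
def trimmed (r : ℕ) : FormSystem E := fun T k =>
  match k with
  | 0 => polyForms r T 0
  | k + 1 =>
    { carrier := {u | u ∈ polyForms r T (k + 1) ∧ ∀ o ∈ affineSpan ℝ (T : Set E),
        ∃ v ∈ polyForms r T k, IsKoszul o u v}
      add_mem' := by
        rintro u u' ⟨hu, h⟩ ⟨hu', h'⟩
        refine ⟨add_mem hu hu', fun o ho => ?_⟩
        obtain ⟨v, hv, e⟩ := h o ho
        obtain ⟨v', hv', e'⟩ := h' o ho
        refine ⟨v + v', add_mem hv hv', fun hT => ?_⟩
        filter_upwards [e hT, e' hT, Lp.coeFn_add (u ⟨T, hT, subset_rfl⟩) (u' ⟨T, hT, subset_rfl⟩),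
          Lp.coeFn_add (v ⟨T, hT, subset_rfl⟩) (v' ⟨T, hT, subset_rfl⟩)] with x h1 h2 h3 h4 hx w
        rw [Pi.add_apply, Pi.add_apply, h3, h4]
        simp [h1 hx w, h2 hx w]
      zero_mem' := by
        refine ⟨zero_mem _, fun o ho => ⟨0, zero_mem _, fun hT => ?_⟩⟩
        filter_upwards [Lp.coeFn_zero (Alt (tangent T) (k + 1)) 2 (unif T),
          Lp.coeFn_zero (Alt (tangent T) k) 2 (unif T)] with x h1 h2 hx w
        rw [Pi.zero_apply, Pi.zero_apply, h1, h2]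
        simp
      smul_mem' := by
        rintro a u ⟨hu, h⟩
        refine ⟨Submodule.smul_mem _ a hu, fun o ho => ?_⟩
        obtain ⟨v, hv, e⟩ := h o ho
        refine ⟨a • v, Submodule.smul_mem _ a hv, fun hT => ?_⟩
        filter_upwards [e hT, Lp.coeFn_smul a (u ⟨T, hT, subset_rfl⟩),
          Lp.coeFn_smul a (v ⟨T, hT, subset_rfl⟩)] with x h1 h3 h4 hx w
        rw [Pi.smul_apply, Pi.smul_apply, h3, h4]
        simp [h1 hx w] }

end FES

end

/-! The proof combines a lower bound valid for every compatible system with the fact that trimmed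
forms attain it.

Lower bound. For a compatible system `B`, the sequence `0 → B_0^0(T) → ⋯ → B_0^n(T) → ℝ → 0` is
exact. Boundary conditions are imposed one facet at a time (`IsCompatibleFES.exact_vanishesOff`). A
primitive satisfying the previous conditions is closed on the new facet; there it has a primitive by
induction on the dimension, whose extension to `T` has a differential that can be subtracted.
Stokes' theorem carries the integral condition from `T` to the facet. Now let `A ⊆ B` be stable
under `d`, and consider the forms of `B_0^k(T)` whose derivative is a cocycle of `A_0`. By exactness
every cocycle of degree `k + 1` is such a derivative, so rank-nullity gives `dim B_0^k ≥ dim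
Z^{k+1}(A_0) + dim ker (d on B_0^k)`. Replacing the last kernel by that of `d` on `A_0^k` turns the
right side into `dim A_0^k + dim H^{k+1}(A_0)`. In degree `k = n` the integral plays the role of
`d`. Equality holds once all closed forms of `B` lie in `A`.

Trimmed forms attain the bound. Cartan's formula `dκ + κd = j + k + 1`, on `(k+1)`-forms with
coefficients homogeneous of degree `j`, shows that a closed form in `P_r^-` has degree `r - 1`
(`PolyMap.lower`), and that a closed form of degree `r - 1` has a primitive `κγ`
(`PolyMap.poincare`). This primitive is trimmed because `κκ = 0`, so the local sequences are exact.

Extension of trimmed forms. A trimmed form is the restriction to height one of a form on `ℝ × E`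
whose coefficients are homogeneous of degree `r` and which is annihilated by the radial field
(`IsTrimmed.exists_cone_lift`). Barycentric coordinates give a linear projection onto the cone over
a face `F`, sending the cone over `G` into the cone over `F ∩ G`. Pulling back along it extends a
form on `F` vanishing on `∂F` by zero on the faces not containing `F` (`exists_bubble_extension`).

Whole cells and complexes. Extensions make `dim B^k(T)` the sum of `dim B_0^k(F)` over the faces of
`T`, and likewise on a finite complex, so the bound for `B_0^k` implies the other two.

Weak derivatives enter through Green's formula, deduced for smooth forms from the divergence theorem
on a simplex, and through uniqueness of the weak derivative. Analyticity makes a polynomial form,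
restricted to tangent vectors, determined on the affine span by its almost everywhere values. -/

noncomputable section

namespace FES

/-! ### Homogeneous and polynomial maps between normed spaces -/

section Polynomial

variable {V W X Y : Type*} [NormedAddCommGroup V] [NormedSpace ℝ V]
  [NormedAddCommGroup W] [NormedSpace ℝ W] [NormedAddCommGroup X] [NormedSpace ℝ X]
  [NormedAddCommGroup Y] [NormedSpace ℝ Y]

/-- Homogeneous polynomial maps of degree `j` between normed spaces. -/
inductive HomPoly : ℕ → (V → X) → Prop
  | const (c : X) : HomPoly 0 (fun _ => c)
  | zero (j : ℕ) : HomPoly j (fun _ => 0)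
  | add {j : ℕ} {f g : V → X} : HomPoly j f → HomPoly j g → HomPoly j (fun x => f x + g x)
  | linmul {j : ℕ} {f : V → X} (l : V →L[ℝ] ℝ) : HomPoly j f →
      HomPoly (j + 1) (fun x => l x • f x)

namespace HomPoly

lemma homogeneous {j : ℕ} {f : V → X} (h : HomPoly j f) (t : ℝ) (x : V) :
    f (t • x) = t ^ j • f x := by
  induction h with
  | const c => simp
  | zero j => simp
  | add _ _ h1 h2 => simp [h1, h2]
  | linmul l _ h => simp [h, pow_succ, smul_smul]; congr 1; ring

lemma contDiff {j : ℕ} {f : V → X} (h : HomPoly j f) : ContDiff ℝ ∞ f := by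
  induction h with
  | const c => exact contDiff_const
  | zero j => exact contDiff_const
  | add _ _ h1 h2 => exact h1.add h2
  | linmul l _ h => exact l.contDiff.smul h

lemma differentiable {j : ℕ} {f : V → X} (h : HomPoly j f) : Differentiable ℝ f :=
  h.contDiff.differentiable (by simp)

lemma analyticOnNhd {j : ℕ} {f : V → X} (h : HomPoly j f) : AnalyticOnNhd ℝ f Set.univ := by
  induction h with
  | const c => exact analyticOnNhd_const
  | zero j => exact analyticOnNhd_const
  | add _ _ h1 h2 => exact h1.add h2
  | linmul l _ h => exact (l.analyticOnNhd _).smul h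

lemma clm_comp {j : ℕ} {f : V → X} (h : HomPoly j f) (L : X →L[ℝ] Y) :
    HomPoly j (fun x => L (f x)) := by
  induction h with
  | const c => exact const _
  | zero j => simpa using zero j
  | add _ _ h1 h2 => simpa using h1.add h2
  | linmul l _ h => simpa using h.linmul l

lemma comp_clm {j : ℕ} {f : V → X} (h : HomPoly j f) (L : W →L[ℝ] V) :
    HomPoly j (fun x => f (L x)) := by
  induction h with
  | const c => exact const _
  | zero j => exact zero j
  | add _ _ h1 h2 => exact h1.add h2
  | linmul l _ h => exact h.linmul (l.comp L)

lemma const_smul {j : ℕ} {f : V → X} (h : HomPoly j f) (a : ℝ) :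
    HomPoly j (fun x => a • f x) := by
  simpa using h.clm_comp (a • ContinuousLinearMap.id ℝ X)

lemma sum {ι : Type*} (s : Finset ι) {j : ℕ} {f : ι → V → X} (h : ∀ i ∈ s, HomPoly j (f i)) :
    HomPoly j (fun x => ∑ i ∈ s, f i x) := by
  classical
  induction s using Finset.induction_on with
  | empty => simpa using zero j
  | insert a s ha ih =>
    simp only [Finset.sum_insert ha]
    exact (h a (by simp)).add (ih fun i hi => h i (by simp [hi]))

lemma smul {i j : ℕ} {f : V → ℝ} {g : V → X} (hf : HomPoly i f) (hg : HomPoly j g) :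
    HomPoly (i + j) (fun x => f x • g x) := by
  induction hf with
  | const c => simpa using hg.const_smul c
  | zero i => simpa using zero (i + j)
  | add _ _ h1 h2 => simpa [add_smul] using h1.add h2
  | linmul l _ h => simpa [smul_smul, add_right_comm] using h.linmul l

lemma pow {f : V → ℝ} (l : V →L[ℝ] ℝ) (hf : f = l) (n : ℕ) : HomPoly n (fun x => f x ^ n) := by
  subst hf
  induction n with
  | zero => simpa using const (V := V) (1 : ℝ)
  | succ n ih => simpa [pow_succ, mul_comm] using ih.linmul l

lemma prod {ι : Type*} (s : Finset ι) (d : ι → ℕ) (f : ι → V → ℝ)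
    (h : ∀ i ∈ s, HomPoly (d i) (f i)) :
    HomPoly (∑ i ∈ s, d i) (fun x => ∏ i ∈ s, f i x) := by
  classical
  induction s using Finset.induction_on with
  | empty => simpa using const (V := V) (1 : ℝ)
  | insert a s ha ih =>
    simp only [Finset.prod_insert ha, Finset.sum_insert ha]
    exact (h a (by simp)).smul (ih fun i hi => h i (by simp [hi]))

/-- The second clause makes the induction work with truncated subtraction: at `j = 0` the term `l x
• fderiv ℝ f x` would have degree one instead of zero, and is harmless only because the derivative
vanishes. -/
lemma fderiv_aux {j : ℕ} {f : V → X} (h : HomPoly j f) :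
    HomPoly (j - 1) (fderiv ℝ f) ∧ (j = 0 → fderiv ℝ f = 0) := by
  induction h with
  | const c =>
    have : fderiv ℝ (fun _ : V => c) = fun _ => 0 := by ext; simp
    exact ⟨this ▸ zero _, fun _ => this⟩
  | zero j =>
    have : fderiv ℝ (fun _ : V => (0 : X)) = fun _ => 0 := by ext; simp
    exact ⟨this ▸ zero _, fun _ => this⟩
  | @add j f g hf hg h1 h2 =>
    have e : fderiv ℝ (fun x => f x + g x) = fun x => fderiv ℝ f x + fderiv ℝ g x := by
      ext1 x; exact fderiv_fun_add (hf.differentiable x) (hg.differentiable x)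
    rw [e]
    refine ⟨h1.1.add h2.1, fun hj => ?_⟩
    rw [h1.2 hj, h2.2 hj]; ext; simp
  | @linmul j f l hf h =>
    have e : fderiv ℝ (fun x => l x • f x) =
        fun x => l x • fderiv ℝ f x + (ContinuousLinearMap.smulRightL ℝ V X l) (f x) := by
      ext1 x
      rw [fderiv_fun_smul l.differentiableAt (hf.differentiable x)]
      ext; simp
    rw [e]
    refine ⟨?_, by simp⟩
    refine HomPoly.add ?_ (hf.clm_comp _)
    rcases j with _ | j
    · rw [h.2 rfl]; simpa using zero 0
    · exact h.1.linmul l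

lemma fderiv {j : ℕ} {f : V → X} (h : HomPoly j f) : HomPoly (j - 1) (fderiv ℝ f) :=
  h.fderiv_aux.1

lemma euler {j : ℕ} {f : V → X} (h : HomPoly j f) (x : V) :
    _root_.fderiv ℝ f x x = (j : ℝ) • f x := by
  induction h with
  | const c => simp
  | zero j => simp
  | @add j f g hf hg h1 h2 =>
    rw [fderiv_fun_add (hf.differentiable x) (hg.differentiable x)]
    simp [h1, h2]
  | @linmul j f l hf h =>
    rw [fderiv_fun_smul l.differentiableAt (hf.differentiable x)]
    simp [h, smul_smul]
    rw [← add_smul]; congr 1; ring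

lemma of_clm [FiniteDimensional ℝ V] (L : V →L[ℝ] X) : HomPoly 1 (fun x => L x) := by
  have b := Module.finBasis ℝ V
  have e : (fun x => L x) = fun x => ∑ i, (b.coord i).toContinuousLinearMap x • L (b i) := by
    ext x
    conv_lhs => rw [← b.sum_repr x]
    simp only [map_sum, map_smul]
    rfl
  rw [e]
  exact sum _ fun i _ => (const (V := V) (L (b i))).linmul _

end HomPoly

/-- Polynomial maps of degree at most `r` between normed spaces. -/
def PolyMap (r : ℕ) (f : V → X) : Prop :=
  ∃ c : ℕ → V → X, (∀ j, HomPoly j (c j)) ∧ ∀ x, f x = ∑ j ∈ Finset.range (r + 1), c j x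

lemma HomPoly.polyMap {r j : ℕ} {f : V → X} (h : HomPoly j f) (hj : j ≤ r) : PolyMap r f := by
  refine ⟨fun i => if i = j then f else fun _ => 0, fun i => ?_, fun x => ?_⟩
  · dsimp only; split_ifs with hi
    · exact hi ▸ h
    · exact .zero _
  · rw [Finset.sum_eq_single j]
    · simp
    · intro i _ hi; simp [hi]
    · intro hi; simp at hi; omega

namespace PolyMap

lemma add {r : ℕ} {f g : V → X} (hf : PolyMap r f) (hg : PolyMap r g) :
    PolyMap r (fun x => f x + g x) := by
  obtain ⟨c, hc, h⟩ := hf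
  obtain ⟨d, hd, h'⟩ := hg
  exact ⟨fun j x => c j x + d j x, fun j => (hc j).add (hd j), fun x => by
    simp only [h, h', Finset.sum_add_distrib]⟩

lemma zero (r : ℕ) : PolyMap r (fun _ : V => (0 : X)) := (HomPoly.zero 0).polyMap (by simp)

lemma const (r : ℕ) (c : X) : PolyMap r (fun _ : V => c) := (HomPoly.const c).polyMap (by simp)

lemma sum {ι : Type*} (s : Finset ι) {r : ℕ} {f : ι → V → X} (h : ∀ i ∈ s, PolyMap r (f i)) :
    PolyMap r (fun x => ∑ i ∈ s, f i x) := by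
  classical
  induction s using Finset.induction_on with
  | empty => simpa using zero r
  | insert a s ha ih =>
    simp only [Finset.sum_insert ha]
    exact (h a (by simp)).add (ih fun i hi => h i (by simp [hi]))

lemma mono {r s : ℕ} {f : V → X} (hf : PolyMap r f) (hrs : r ≤ s) : PolyMap s f := by
  obtain ⟨c, hc, h⟩ := hf
  rw [funext h]
  exact sum _ fun j hj => (hc j).polyMap (by simp at hj; omega)

lemma clm_comp {r : ℕ} {f : V → X} (h : PolyMap r f) (L : X →L[ℝ] Y) :
    PolyMap r (fun x => L (f x)) := by
  obtain ⟨c, hc, h⟩ := h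
  exact ⟨fun j x => L (c j x), fun j => (hc j).clm_comp L, fun x => by simp [h]⟩

lemma const_smul {r : ℕ} {f : V → X} (h : PolyMap r f) (a : ℝ) :
    PolyMap r (fun x => a • f x) := by
  simpa using h.clm_comp (a • ContinuousLinearMap.id ℝ X)

lemma sub {r : ℕ} {f g : V → X} (hf : PolyMap r f) (hg : PolyMap r g) :
    PolyMap r (fun x => f x - g x) := by
  simpa [sub_eq_add_neg] using hf.add (hg.const_smul (-1))

lemma linmul {r : ℕ} {f : V → X} (h : PolyMap r f) (l : V →L[ℝ] ℝ) :
    PolyMap (r + 1) (fun x => l x • f x) := by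
  obtain ⟨c, hc, h⟩ := h
  simp only [h, Finset.smul_sum]
  exact sum _ fun j hj => ((hc j).linmul l).polyMap (by simp at hj; omega)

lemma comp_clm {r : ℕ} {f : V → X} (h : PolyMap r f) (L : W →L[ℝ] V) :
    PolyMap r (fun x => f (L x)) := by
  obtain ⟨c, hc, h⟩ := h
  exact ⟨fun j x => c j (L x), fun j => (hc j).comp_clm L, fun x => h _⟩

lemma contDiff {r : ℕ} {f : V → X} (h : PolyMap r f) : ContDiff ℝ ∞ f := by
  obtain ⟨c, hc, h⟩ := h
  rw [funext h]
  exact ContDiff.sum fun j _ => (hc j).contDiff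

lemma continuous {r : ℕ} {f : V → X} (h : PolyMap r f) : Continuous f := h.contDiff.continuous

lemma differentiable {r : ℕ} {f : V → X} (h : PolyMap r f) : Differentiable ℝ f :=
  h.contDiff.differentiable (by simp)

lemma analyticOnNhd {r : ℕ} {f : V → X} (h : PolyMap r f) : AnalyticOnNhd ℝ f Set.univ := by
  obtain ⟨c, hc, h⟩ := h
  rw [funext h]
  exact Finset.analyticOnNhd_fun_sum _ fun j _ => (hc j).analyticOnNhd

lemma comp_add_const {r : ℕ} {f : V → X} (h : PolyMap r f) (a : V) :
    PolyMap r (fun x => f (x + a)) := by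
  have key : ∀ (j : ℕ) (g : V → X), HomPoly j g → PolyMap j (fun x => g (x + a)) := by
    intro j g hg
    induction hg with
    | const c => exact const _ _
    | zero j => exact zero _
    | add _ _ h1 h2 => exact h1.add h2
    | linmul l _ h =>
      simpa [add_smul] using (h.linmul l).add ((h.const_smul (l a)).mono (Nat.le_succ _))
  obtain ⟨c, hc, h⟩ := h
  rw [funext fun x => h (x + a)]
  exact sum _ fun j hj => (key j _ (hc j)).mono (by simp at hj; omega)

lemma comp_affine {r : ℕ} {f : V → X} (h : PolyMap r f) (L : W →L[ℝ] V) (a : V) :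
    PolyMap r (fun x => f (L x + a)) := (h.comp_add_const a).comp_clm L

lemma fderiv {r : ℕ} {f : V → X} (h : PolyMap r f) : PolyMap (r - 1) (fderiv ℝ f) := by
  obtain ⟨c, hc, h⟩ := h
  have e : _root_.fderiv ℝ f = fun x => ∑ j ∈ Finset.range (r + 1), _root_.fderiv ℝ (c j) x := by
    ext1 x
    rw [funext h, fderiv_fun_sum fun j _ => (hc j).differentiable x]
  rw [e]
  exact sum _ fun j hj => (hc j).fderiv.polyMap (by simp at hj; omega)

/-- Homogenization of a polynomial map. -/
lemma exists_homogenization {r : ℕ} {f : V → X} (h : PolyMap r f) :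
    ∃ F : ℝ × V → X, HomPoly r F ∧ ∀ y, F (1, y) = f y := by
  obtain ⟨c, hc, h⟩ := h
  refine ⟨fun z => ∑ j ∈ Finset.range (r + 1), z.1 ^ (r - j) • c j z.2,
    HomPoly.sum _ fun j hj => ?_, fun y => by simp [h]⟩
  have h1 : HomPoly (r - j) (fun z : ℝ × V => z.1 ^ (r - j)) :=
    HomPoly.pow (ContinuousLinearMap.fst ℝ ℝ V) rfl _
  have h2 := h1.smul ((hc j).comp_clm (ContinuousLinearMap.snd ℝ ℝ V))
  have : r - j + j = r := by simp at hj; omega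
  rw [this] at h2
  exact h2

end PolyMap

/-- Continuous linear forms separate points, which reduces the claim to a real polynomial vanishing
at every `t`. -/
lemma eq_zero_of_forall_sum_pow_smul {n : ℕ} {c : ℕ → X}
    (h : ∀ t : ℝ, ∑ j ∈ Finset.range n, t ^ j • c j = 0) {j : ℕ} (hj : j < n) : c j = 0 := by
  refine (SeparatingDual.eq_zero_iff_forall_dual_eq_zero (R := ℝ) _).2 fun l => ?_
  have hp : (∑ i ∈ Finset.range n, Polynomial.C (l (c i)) * Polynomial.X ^ i) = 0 := by
    refine Polynomial.funext fun t => ?_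
    have := congrArg l (h t)
    simpa [Polynomial.eval_finsetSum, mul_comm (l _)] using this
  have := congrArg (fun p => p.coeff j) hp
  simpa [Polynomial.finsetSum_coeff, Polynomial.coeff_C_mul, Polynomial.coeff_X_pow, hj] using this

/-- Homogeneous components of the zero polynomial map vanish. -/
lemma HomPoly.eq_zero_of_sum {n : ℕ} {c : ℕ → V → X} (hc : ∀ j, HomPoly j (c j))
    (h : ∀ x, ∑ j ∈ Finset.range n, c j x = 0) {j : ℕ} (hj : j < n) (x : V) : c j x = 0 := by
  refine eq_zero_of_forall_sum_pow_smul (c := fun j => c j x) (n := n) (fun t => ?_) hj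
  rw [← h (t • x)]
  exact Finset.sum_congr rfl fun i _ => ((hc i).homogeneous t x).symm

/-! ### Polynomial forms, the Koszul operator and the Poincaré lemma -/

/-- The contraction of a form with the radial vector field `x ↦ x`. -/
def koszul {k : ℕ} (α : V → V [⋀^Fin (k + 1)]→L[ℝ] ℝ) (x : V) : V [⋀^Fin k]→L[ℝ] ℝ :=
  (α x).curryLeft x

lemma koszul_apply {k : ℕ} (α : V → V [⋀^Fin (k + 1)]→L[ℝ] ℝ) (x : V) (w : Fin k → V) :
    koszul α x w = α x (Fin.cons x w : Fin (k + 1) → V) := rfl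

lemma koszul_koszul {k : ℕ} (α : V → V [⋀^Fin (k + 2)]→L[ℝ] ℝ) (x : V) :
    koszul (koszul α) x = 0 := by
  ext w
  rw [koszul_apply, koszul_apply]
  exact (α x).map_eq_zero_of_eq _ (i := 0) (j := 1) (by simp) (by simp)

lemma HomPoly.koszul [FiniteDimensional ℝ V] {j k : ℕ} {α : V → V [⋀^Fin (k + 1)]→L[ℝ] ℝ}
    (h : HomPoly j α) : HomPoly (j + 1) (koszul α) := by
  induction h with
  | const c => exact HomPoly.of_clm c.curryLeft
  | zero j => exact HomPoly.zero _
  | add _ _ h1 h2 => exact h1.add h2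
  | linmul l _ h => exact h.linmul l

lemma PolyMap.koszul [FiniteDimensional ℝ V] {r k : ℕ} {α : V → V [⋀^Fin (k + 1)]→L[ℝ] ℝ}
    (h : PolyMap r α) : PolyMap (r + 1) (koszul α) := by
  obtain ⟨c, hc, h⟩ := h
  have e : FES.koszul α = fun x => ∑ j ∈ Finset.range (r + 1), FES.koszul (c j) x := by
    ext x w
    simp [koszul_apply, h]
  rw [e]
  exact PolyMap.sum _ fun j hj => (hc j).koszul.polyMap (by simp at hj; omega)

lemma HomPoly.extDeriv {j k : ℕ} {α : V → V [⋀^Fin k]→L[ℝ] ℝ}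
    (h : HomPoly j α) : HomPoly (j - 1) (extDeriv α) :=
  h.fderiv.clm_comp (ContinuousAlternatingMap.alternatizeUncurryFinCLM ℝ V ℝ)

lemma PolyMap.extDeriv {r k : ℕ} {α : V → V [⋀^Fin k]→L[ℝ] ℝ}
    (h : PolyMap r α) : PolyMap (r - 1) (extDeriv α) :=
  h.fderiv.clm_comp (ContinuousAlternatingMap.alternatizeUncurryFinCLM ℝ V ℝ)

lemma extDeriv_sum {ι : Type*} (s : Finset ι) {k : ℕ} {c : ι → V → V [⋀^Fin k]→L[ℝ] ℝ}
    (h : ∀ i ∈ s, Differentiable ℝ (c i)) (x : V) :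
    extDeriv (fun x => ∑ i ∈ s, c i x) x = ∑ i ∈ s, extDeriv (c i) x := by
  simp only [extDeriv, ← ContinuousAlternatingMap.alternatizeUncurryFinCLM_apply]
  rw [fderiv_fun_sum fun i hi => h i hi x, map_sum]

lemma extDeriv_apply' {k : ℕ} (α : V → V [⋀^Fin k]→L[ℝ] ℝ) (x : V) (w : Fin (k + 1) → V) :
    extDeriv α x w = ∑ i : Fin (k + 1), (-1 : ℝ) ^ (i : ℕ) *
      fderiv ℝ α x (w i) (fun j => w (i.succAbove j)) := by
  rw [extDeriv, ContinuousAlternatingMap.alternatizeUncurryFin_apply]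
  refine Finset.sum_congr rfl fun i _ => ?_
  rw [← Int.cast_smul_eq_zsmul ℝ]
  simp
  rfl

/-- Leibniz rule: the point occurs both as the base point of `α` and as its first argument. -/
lemma fderiv_koszul {k : ℕ} {α : V → V [⋀^Fin (k + 1)]→L[ℝ] ℝ} {x : V}
    (h : DifferentiableAt ℝ α x) (y : V) (w : Fin k → V) :
    fderiv ℝ (koszul α) x y w = fderiv ℝ α x y (Fin.cons x w : Fin (k + 1) → V) +
      α x (Fin.cons y w : Fin (k + 1) → V) := by
  let L : (V [⋀^Fin (k + 1)]→L[ℝ] ℝ) →L[ℝ] (V →L[ℝ] V [⋀^Fin k]→L[ℝ] ℝ) :=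
    (ContinuousAlternatingMap.curryLeftLI (𝕜 := ℝ) (E := V) (F := ℝ) (n := k)
      ).toContinuousLinearMap
  have h0 : HasFDerivAt (𝕜 := ℝ) (⇑L) L (α x) := by apply ContinuousLinearMap.hasFDerivAt
  have hL : HasFDerivAt (fun x => (α x).curryLeft) (L.comp (fderiv ℝ α x)) x :=
    HasFDerivAt.comp (𝕜 := ℝ) (G := V →L[ℝ] V [⋀^Fin k]→L[ℝ] ℝ) x h0 h.hasFDerivAt
  have h1 := hL.differentiableAt
  have h2 : fderiv ℝ (fun x => (α x).curryLeft) x y = (fderiv ℝ α x y).curryLeft := by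
    rw [hL.fderiv]; rfl
  have h3 : fderiv ℝ (koszul α) x = _ := fderiv_clm_apply h1 differentiableAt_id
  rw [h3]
  simp [h2]
  rw [add_comm]
  rfl

/-- Cartan's formula for homogeneous polynomial forms. -/
lemma HomPoly.cartan {j k : ℕ} {α : V → V [⋀^Fin (k + 1)]→L[ℝ] ℝ} (h : HomPoly j α) (x : V) :
    _root_.extDeriv (FES.koszul α) x + FES.koszul (_root_.extDeriv α) x =
      ((j : ℝ) + k + 1) • α x := by
  ext w
  have e := congrArg (fun f => f w) (h.euler x)
  simp only [ContinuousAlternatingMap.add_apply, koszul_apply, extDeriv_apply',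
    fderiv_koszul (h.differentiable x), ContinuousAlternatingMap.smul_apply, smul_eq_mul] at e ⊢
  -- The term of index zero in `κ dα` is the radial derivative, equal to `j • α x` by Euler's
  -- formula; the others cancel the terms of `dκα` in which the coefficients of `α` are
  -- differentiated.
  rw [Fin.sum_univ_succ (n := k + 1)]
  simp only [Fin.succAbove_zero, Fin.cons_zero, Fin.cons_succ, Fin.val_zero, pow_zero, one_mul,
    Fin.val_succ]
  have e1 : (fun j : Fin (k+1) => (w j)) = w := rfl
  rw [e1, e]
  have e2 : ∀ i : Fin (k + 1), (fun m => (Fin.cons x w : Fin (k + 2) → V) (i.succ.succAbove m)) =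
      (Fin.cons x (fun m => w (i.succAbove m)) : Fin (k + 1) → V) := by
    intro i; ext m
    refine Fin.cases ?_ (fun m => ?_) m
    · simp
    · simp
  -- Moving `w i` back to position `i` costs the sign `(-1) ^ i`, so the `k + 1` terms of `dκα` that
  -- differentiate the radial field all equal `α x w`.
  have e3 : ∀ i : Fin (k + 1), (-1 : ℝ) ^ (i : ℕ) *
      α x (Fin.cons (w i) (fun m => w (i.succAbove m)) : Fin (k + 1) → V) = α x w := by
    intro i
    have := (α x).toAlternatingMap.map_insertNth i (w i) (fun m => w (i.succAbove m))
    have h2 : i.insertNth (w i) (fun m => w (i.succAbove m)) = w :=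
      Fin.insertNth_self_removeNth i w
    rw [h2] at this
    have h3 : α x w = (-1) ^ (i : ℕ) • α x (Matrix.vecCons (w i) (fun m => w (i.succAbove m))) := by
      exact this
    rw [h3]
    simp [Matrix.vecCons]
  simp only [e2, mul_add, e3, Finset.sum_add_distrib, pow_succ]
  simp
  ring

lemma HomPoly.extDeriv_eq_zero {k : ℕ} {α : V → V [⋀^Fin k]→L[ℝ] ℝ} (h : HomPoly 0 α) (x : V) :
    _root_.extDeriv α x = 0 := by
  rw [_root_.extDeriv, h.fderiv_aux.2 rfl]
  simpa using (ContinuousAlternatingMap.alternatizeUncurryFinCLM ℝ V ℝ (n := k)).map_zero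

/-- Distinct homogeneous components have derivatives of distinct degrees, apart from degrees zero
and one, which truncated subtraction merges; the constant component is therefore split off first. -/
lemma HomPoly.extDeriv_eq_zero_of_sum {r k : ℕ} {c : ℕ → V → V [⋀^Fin k]→L[ℝ] ℝ}
    (hc : ∀ j, HomPoly j (c j))
    (hd : ∀ x, _root_.extDeriv (fun x => ∑ j ∈ Finset.range (r + 1), c j x) x = 0)
    {j : ℕ} (hj : j < r + 1) (x : V) : _root_.extDeriv (c j) x = 0 := by
  have hd' : ∀ x, ∑ j ∈ Finset.range r, _root_.extDeriv (c (j + 1)) x = 0 := by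
    intro x
    have := hd x
    rwa [extDeriv_sum _ fun i _ => (hc i).differentiable, Finset.sum_range_succ',
      (hc 0).extDeriv_eq_zero, add_zero] at this
  rcases j with _ | j
  · exact (hc 0).extDeriv_eq_zero x
  · exact HomPoly.eq_zero_of_sum (c := fun j => _root_.extDeriv (c (j + 1)))
      (fun j => (hc (j + 1)).extDeriv) hd' (by omega) x

/-- The component of degree `r + 1` is closed, and its contraction is the component of degree `r +
2` of `κα`, hence zero. Cartan's formula then makes a positive multiple of that component vanish. -/
lemma PolyMap.lower {r k : ℕ} {α : V → V [⋀^Fin (k + 1)]→L[ℝ] ℝ} (h : PolyMap (r + 1) α)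
    [FiniteDimensional ℝ V] (hκ : PolyMap (r + 1) (FES.koszul α))
    (hd : ∀ x, _root_.extDeriv α x = 0) : PolyMap r α := by
  obtain ⟨c, hc, h⟩ := h
  obtain ⟨e, he, h'⟩ := hκ
  have hd2 : ∀ x, _root_.extDeriv (c (r + 1)) x = 0 :=
    HomPoly.extDeriv_eq_zero_of_sum hc (funext h ▸ hd) (Nat.lt_succ_self _)
  have hk2 : ∀ x, FES.koszul (c (r + 1)) x = 0 := by
    intro x
    -- These are the homogeneous components of `κα - κα`, the first copy expanded through `c` with a
    -- shift of degree and the second through `e`. The condition cuts `e` off at `r + 1`, beyond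
    -- which it is not constrained.
    let f : ℕ → V → V [⋀^Fin k]→L[ℝ] ℝ := fun j => match j with
      | 0 => fun x => - e 0 x
      | j + 1 => fun x => FES.koszul (c j) x - if j + 1 ≤ r + 1 then e (j + 1) x else 0
    have hf : ∀ j, HomPoly j (f j) := by
      intro j
      rcases j with _ | j
      · simpa [f] using (he 0).const_smul (-1)
      · have := ((he (j + 1)).const_smul (if j + 1 ≤ r + 1 then -1 else 0))
        refine (funext fun x => ?_ : (fun x => FES.koszul (c j) x + _) = f (j + 1)) ▸
          ((hc j).koszul.add this)
        simp only [f]; split_ifs <;> simp [sub_eq_add_neg]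
    have hsum : ∀ x, ∑ j ∈ Finset.range (r + 3), f j x = 0 := by
      intro x
      rw [Finset.sum_range_succ', Finset.sum_range_succ]
      simp only [f, Finset.sum_sub_distrib]
      have h1 : FES.koszul α x = ∑ j ∈ Finset.range (r + 2), FES.koszul (c j) x := by
        ext w; simp [koszul_apply, h]
      have h2 := h' x
      rw [h1, Finset.sum_range_succ, Finset.sum_range_succ' (n := r + 1)] at h2
      have h3 : ∑ j ∈ Finset.range (r + 1), (if j + 1 ≤ r + 1 then e (j + 1) x else 0) =
          ∑ j ∈ Finset.range (r + 1), e (j + 1) x :=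
        Finset.sum_congr rfl fun j hj => by simp at hj; simp; omega
      rw [h3]
      simp only [show ¬ (r + 1 + 1 ≤ r + 1) by omega, if_false, sub_zero]
      rw [sub_add_eq_add_sub, h2]; abel
    have := HomPoly.eq_zero_of_sum hf hsum (j := r + 2) (by omega) x
    simpa [f] using this
  have hz : ∀ x, c (r + 1) x = 0 := by
    intro x
    have := (hc (r + 1)).cartan x
    have e1 : FES.koszul (c (r + 1)) = fun _ => 0 := funext hk2
    have e2 : FES.koszul (_root_.extDeriv (c (r + 1))) x = 0 := by
      ext w; simp [koszul_apply, hd2]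
    rw [e1, e2, add_zero] at this
    have e3 : _root_.extDeriv (fun _ : V => (0 : V [⋀^Fin k]→L[ℝ] ℝ)) x = 0 := by
      ext w; simp [extDeriv_apply']
    rw [e3] at this
    refine (smul_eq_zero.1 this.symm).resolve_left ?_
    positivity
  exact ⟨c, hc, fun x => by rw [h, Finset.sum_range_succ, hz, add_zero]⟩

/-- The Poincaré lemma for polynomial forms. -/
lemma PolyMap.poincare [FiniteDimensional ℝ V] {r k : ℕ} {α : V → V [⋀^Fin (k + 1)]→L[ℝ] ℝ}
    (h : PolyMap r α) (hd : ∀ x, _root_.extDeriv α x = 0) :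
    ∃ γ : V → V [⋀^Fin (k + 1)]→L[ℝ] ℝ, PolyMap (r + 1) (FES.koszul γ) ∧
      ∀ x, _root_.extDeriv (FES.koszul γ) x = α x := by
  obtain ⟨c, hc, h⟩ := h
  have hd2 : ∀ j < r + 1, ∀ x, _root_.extDeriv (c j) x = 0 := fun j hj =>
    HomPoly.extDeriv_eq_zero_of_sum hc (funext h ▸ hd) hj
  -- On a closed component of degree `j`, `dκ` is multiplication by `j + k + 1`, which dictates the
  -- weights. Keeping the primitive in the form `κγ` later shows that it is trimmed.
  have hp : PolyMap r (fun x => ∑ j ∈ Finset.range (r + 1), ((j : ℝ) + k + 1)⁻¹ • c j x) :=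
    ⟨fun j x => ((j : ℝ) + k + 1)⁻¹ • c j x, fun j => (hc j).const_smul _, fun x => rfl⟩
  refine ⟨_, hp.koszul, fun x => ?_⟩
  have e : FES.koszul (fun x => ∑ j ∈ Finset.range (r + 1), ((j : ℝ) + k + 1)⁻¹ • c j x) =
      fun x => ∑ j ∈ Finset.range (r + 1), ((j : ℝ) + k + 1)⁻¹ • FES.koszul (c j) x := by
    ext x w; simp [koszul_apply]
  rw [e, extDeriv_sum _ fun j _ => ((hc j).koszul.const_smul _).differentiable, h]
  refine Finset.sum_congr rfl fun j hj => ?_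
  have h1 := (hc j).cartan x
  have h2 : FES.koszul (_root_.extDeriv (c j)) x = 0 := by
    ext w; simp [koszul_apply, hd2 j (by simpa using hj)]
  rw [h2, add_zero] at h1
  have h3 := extDeriv_smul (x := x) ((j : ℝ) + k + 1)⁻¹ (FES.koszul (c j))
  have h4 : _root_.extDeriv (fun x => ((j : ℝ) + k + 1)⁻¹ • FES.koszul (c j) x) x = _ := h3
  rw [h4, h1, smul_smul, inv_mul_cancel₀, one_smul]
  positivity

end Polynomial

/-! ### Finite dimensionality of spaces of polynomial maps -/

section FinitePolynomial

variable {V X : Type*} [NormedAddCommGroup V] [NormedSpace ℝ V] [FiniteDimensional ℝ V]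
  [NormedAddCommGroup X] [NormedSpace ℝ X]

/-- The values of an alternating form on tuples of basis vectors. -/
def altCoords (V : Type*) [NormedAddCommGroup V] [NormedSpace ℝ V] [FiniteDimensional ℝ V] (k : ℕ) :
    (V [⋀^Fin k]→L[ℝ] ℝ) →ₗ[ℝ] ((Fin k → Fin (Module.finrank ℝ V)) → ℝ) where
  toFun f v := f fun i => Module.finBasis ℝ V (v i)
  map_add' _ _ := rfl
  map_smul' _ _ := rfl

lemma altCoords_injective (k : ℕ) : Function.Injective (altCoords V k) := by
  intro f g h
  apply ContinuousAlternatingMap.toAlternatingMap_injective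
  exact (Module.finBasis ℝ V).ext_alternating fun v _ => congrFun h v

instance finiteDimensional_alt (k : ℕ) : FiniteDimensional ℝ (V [⋀^Fin k]→L[ℝ] ℝ) :=
  Module.Finite.of_injective _ (altCoords_injective k)

lemma PolyMap.pi {r : ℕ} {ι : Type*} [Fintype ι] {f : V → ι → ℝ}
    (h : ∀ i, PolyMap r (fun x => f x i)) : PolyMap r f := by
  classical
  have e : f = fun x => ∑ i, ContinuousLinearMap.single ℝ (fun _ : ι => ℝ) i (f x i) := by
    ext x i
    simp [Finset.sum_apply, Pi.single_apply]
  rw [e]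
  exact PolyMap.sum _ fun i _ => (h i).clm_comp _

lemma polyMap_alt_iff {r k : ℕ} {α : V → V [⋀^Fin k]→L[ℝ] ℝ} :
    PolyMap r α ↔ ∀ w : Fin k → V, PolyMap r (fun x => α x w) := by
  refine ⟨fun h w => h.clm_comp (ContinuousAlternatingMap.apply ℝ V ℝ w), fun h => ?_⟩
  obtain ⟨g, hg⟩ := LinearMap.exists_leftInverse_of_injective _
    (LinearMap.ker_eq_bot.2 (altCoords_injective (V := V) k))
  have e : α = fun x => g.toContinuousLinearMap (altCoords V k (α x)) :=
    funext fun x => (LinearMap.congr_fun hg (α x)).symm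
  rw [e]
  exact PolyMap.clm_comp (PolyMap.pi fun v => h _) _

/-- The span of the homogeneous polynomial maps of degree `j`, built degree by degree. -/
def homSpace (V X : Type*) [NormedAddCommGroup V] [NormedSpace ℝ V] [FiniteDimensional ℝ V]
    [NormedAddCommGroup X] [NormedSpace ℝ X] : ℕ → Submodule ℝ (V → X)
  | 0 => LinearMap.range (LinearMap.pi fun _ : V => (LinearMap.id : X →ₗ[ℝ] X))
  | j + 1 => ⨆ i, (homSpace V X j).map
      (LinearMap.pi fun x : V => (Module.finBasis ℝ V).coord i x • LinearMap.proj x)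

instance finiteDimensional_homSpace [FiniteDimensional ℝ X] (j : ℕ) :
    FiniteDimensional ℝ (homSpace V X j) := by
  induction j with
  | zero => rw [homSpace]; infer_instance
  | succ j ih => rw [homSpace]; infer_instance

lemma HomPoly.mem_homSpace {j : ℕ} {f : V → X} (h : HomPoly j f) : f ∈ homSpace V X j := by
  induction h with
  | const c => exact ⟨c, rfl⟩
  | zero j => exact zero_mem _
  | add _ _ h1 h2 => exact add_mem h1 h2
  | @linmul j f l _ h =>
    have e : (fun x => l x • f x) = ∑ i, l (Module.finBasis ℝ V i) •
        (fun x => (Module.finBasis ℝ V).coord i x • f x) := by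
      ext x
      have e1 : l x = ∑ i, (Module.finBasis ℝ V).repr x i • l (Module.finBasis ℝ V i) := by
        conv_lhs => rw [← (Module.finBasis ℝ V).sum_repr x]
        simp only [map_sum, map_smul]
      rw [e1]
      simp only [Finset.sum_smul, Finset.sum_apply, Pi.smul_apply, smul_smul,
        smul_eq_mul, Module.Basis.coord_apply, mul_comm]
    rw [e]
    refine Submodule.sum_mem _ fun i _ => Submodule.smul_mem _ _ ?_
    exact Submodule.mem_iSup_of_mem i ⟨f, h, rfl⟩

/-- The space of polynomial maps of degree at most `r`. -/
def polySpace (V X : Type*) [NormedAddCommGroup V] [NormedSpace ℝ V]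
    [NormedAddCommGroup X] [NormedSpace ℝ X] (r : ℕ) : Submodule ℝ (V → X) where
  carrier := {f | PolyMap r f}
  add_mem' := PolyMap.add
  zero_mem' := PolyMap.zero r
  smul_mem' a _ h := h.const_smul a

instance finiteDimensional_polySpace [FiniteDimensional ℝ X] (r : ℕ) :
    FiniteDimensional ℝ (polySpace V X r) := by
  have : polySpace V X r ≤ ⨆ j : Fin (r + 1), homSpace V X j := by
    rintro f ⟨c, hc, h⟩
    have e : f = ∑ j ∈ Finset.range (r + 1), c j := by ext x; simp [h]
    rw [e]
    refine Submodule.sum_mem _ fun j hj => ?_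
    exact Submodule.mem_iSup_of_mem (⟨j, by simpa using hj⟩ : Fin (r + 1)) (hc j).mem_homSpace
  exact Submodule.finiteDimensional_of_le this

end FinitePolynomial

/-! ### Polynomial forms and their traces on the faces of a simplex -/

variable {E : Type*} [NormedAddCommGroup E] [InnerProductSpace ℝ E] [FiniteDimensional ℝ E]
  [MeasurableSpace E] [BorelSpace E]

/-- Monomials in the variables indexed by `Module.Dual ℝ E` evaluate to products of linear forms, so
the total degree and the inductive degree of `HomPoly` match. -/
lemma isPoly_iff {r : ℕ} {f : E → ℝ} : IsPoly r f ↔ PolyMap r f := by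
  classical
  constructor
  · rintro ⟨p, hp, h⟩
    have e : f = fun x => ∑ d ∈ p.support, p.coeff d * ∏ l ∈ d.support, l x ^ d l := by
      ext x; rw [h, MvPolynomial.eval_eq]
    rw [e]
    refine PolyMap.sum _ fun d hd => ?_
    have h1 := HomPoly.prod (V := E) d.support (fun l => d l) (fun l x => l x ^ d l) fun l _ =>
      HomPoly.pow l.toContinuousLinearMap rfl _
    refine (h1.const_smul (p.coeff d)).polyMap (le_trans ?_ hp)
    exact MvPolynomial.le_totalDegree hd
  · have key : ∀ (j : ℕ) (g : E → ℝ), HomPoly j g → IsPoly j g := by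
      intro j g hg
      induction hg with
      | const c => exact ⟨MvPolynomial.C c, by simp, by simp⟩
      | zero j => exact ⟨0, by simp, by simp⟩
      | add _ _ h1 h2 => exact h1.add h2
      | @linmul j g l _ h =>
        obtain ⟨p, hp, h⟩ := h
        refine ⟨MvPolynomial.X (l : Module.Dual ℝ E) * p, ?_, fun x => by simp [h]⟩
        refine (MvPolynomial.totalDegree_mul _ _).trans ?_
        rw [MvPolynomial.totalDegree_X]; omega
    rintro ⟨c, hc, h⟩
    choose p hp h' using fun j => key j _ (hc j)
    refine ⟨∑ j ∈ Finset.range (r + 1), p j, ?_, fun x => by simp [h, h']⟩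
    refine (MvPolynomial.totalDegree_finsetSum_le fun j hj => (hp j).trans ?_)
    simp at hj; omega

/-- `u` consists of the pullbacks of the ambient form `α` to the faces of `T`. -/
def IsTrace (T : Finset E) {k : ℕ} (α : E → Alt E k) (u : Form T k) : Prop :=
  ∀ F : Face T, ∀ᵐ x ∂(unif F.1), u F x = (α x).compContinuousLinearMap (tangent F.1).subtypeL

lemma mem_polyForms_iff {r k : ℕ} {T : Finset E} {u : Form T k} :
    u ∈ polyForms r T k ↔ ∃ α : E → Alt E k, PolyMap r α ∧ IsTrace T α u := by
  simp only [polyMap_alt_iff, ← isPoly_iff]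
  rfl

namespace IsTrace

variable {T : Finset E} {k : ℕ} {α β : E → Alt E k} {u v : Form T k}

lemma unique (h : IsTrace T α u) (h' : IsTrace T α v) : u = v := by
  funext F
  refine Lp.ext ?_
  filter_upwards [h F, h' F] with x h1 h2
  rw [h1, h2]

lemma add (h : IsTrace T α u) (h' : IsTrace T β v) : IsTrace T (fun x => α x + β x) (u + v) := by
  intro F
  filter_upwards [h F, h' F, Lp.coeFn_add (u F) (v F)] with x h1 h2 h3
  rw [Pi.add_apply, h3, Pi.add_apply, h1, h2]
  ext w
  simp

lemma const_smul (h : IsTrace T α u) (a : ℝ) : IsTrace T (fun x => a • α x) (a • u) := by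
  intro F
  filter_upwards [h F, Lp.coeFn_smul a (u F)] with x h1 h3
  rw [Pi.smul_apply, h3, Pi.smul_apply, h1]
  ext w
  simp

lemma pull (h : IsTrace T α u) {F : Finset E} (hF : F ⊆ T) : IsTrace F α (pull hF k u) :=
  fun G => h ⟨G.1, G.2.1, G.2.2.trans hF⟩

end IsTrace

lemma memLp_of_continuous (F : Finset E) {X : Type*} [NormedAddCommGroup X] {f : E → X}
    (hf : Continuous f) : MemLp f 2 (unif F) := by
  have hcomp : IsCompact (convexHull ℝ (F : Set E)) := F.finite_toSet.isCompact_convexHull ℝ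
  obtain ⟨c, hc⟩ := hcomp.exists_bound_of_continuousOn hf.continuousOn
  refine MemLp.of_bound hf.aestronglyMeasurable c ?_
  filter_upwards [ae_cond_mem hcomp.measurableSet] with x hx using hc x hx

lemma memLp_restrict (F : Finset E) {k : ℕ} {α : E → Alt E k} (hα : Continuous α) :
    MemLp (fun x => (α x).compContinuousLinearMap (tangent F).subtypeL) 2 (unif F) :=
  memLp_of_continuous F (X := Alt (tangent F) k)
    ((ContinuousAlternatingMap.compContinuousLinearMapCLM (tangent F).subtypeL).continuous.comp hα)

lemma exists_isTrace (T : Finset E) {k : ℕ} {α : E → Alt E k} (hα : Continuous α) :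
    ∃ u : Form T k, IsTrace T α u :=
  ⟨fun F => (memLp_restrict F.1 hα).toLp _, fun _ => MemLp.coeFn_toLp _⟩

/-- The pullbacks of polynomial forms to the faces of `T`. -/
def polyTrace (r : ℕ) (T : Finset E) (k : ℕ) : polySpace E (Alt E k) r →ₗ[ℝ] Form T k where
  toFun α := (exists_isTrace T (PolyMap.continuous α.2)).choose
  map_add' α β := IsTrace.unique (exists_isTrace T (PolyMap.continuous (α + β).2)).choose_spec
    ((exists_isTrace T (PolyMap.continuous α.2)).choose_spec.add
      (exists_isTrace T (PolyMap.continuous β.2)).choose_spec)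
  map_smul' a α := IsTrace.unique (exists_isTrace T (PolyMap.continuous (a • α).2)).choose_spec
    ((exists_isTrace T (PolyMap.continuous α.2)).choose_spec.const_smul a)

instance finiteDimensional_polyForms (r : ℕ) (T : Finset E) (k : ℕ) :
    FiniteDimensional ℝ (polyForms r T k) := by
  have : polyForms r T k ≤ LinearMap.range (polyTrace r T k) := by
    intro u hu
    obtain ⟨α, hα, h⟩ := mem_polyForms_iff.1 hu
    exact ⟨⟨α, hα⟩, IsTrace.unique (exists_isTrace T hα.continuous).choose_spec h⟩
  exact Submodule.finiteDimensional_of_le this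

/-! ### Barycentric coordinates -/

open scoped Classical in
/-- Barycentric coordinates, as linear forms on the cone `ℝ × E` over `E`. -/
lemma exists_cone_dual {ι : Type*} {p : ι → E} (hp : AffineIndependent ℝ p) :
    ∃ Λ : ι → (ℝ × E →L[ℝ] ℝ), ∀ i j, Λ i (1, p j) = if i = j then 1 else 0 := by
  have hli : LinearIndependent ℝ (fun i => ((1 : ℝ), p i)) := by
    -- Affine independence of the points is linear independence of their lifts to height one: the
    -- height component records that the coefficients sum to zero.
    rw [linearIndependent_iff']
    intro s g hg i hi
    refine affineIndependent_iff.1 hp s g ?_ ?_ i hi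
    · simpa [Prod.fst_sum] using congrArg Prod.fst hg
    · simpa [Prod.snd_sum] using congrArg Prod.snd hg
  obtain ⟨g, hg⟩ := LinearMap.exists_extend hli.repr
  refine ⟨fun i => (Finsupp.lapply i ∘ₗ g).toContinuousLinearMap, fun i j => ?_⟩
  have h1 := LinearMap.congr_fun hg ⟨_, Submodule.subset_span (Set.mem_range_self j)⟩
  simp only [LinearMap.comp_apply, Submodule.subtype_apply] at h1
  have h2 : hli.repr ⟨_, Submodule.subset_span (Set.mem_range_self j)⟩ = Finsupp.single j 1 :=
    hli.repr_eq_single j _ rfl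
  simp only [LinearMap.coe_toContinuousLinearMap', LinearMap.comp_apply, Finsupp.lapply_apply]
  rw [h1, h2, Finsupp.single_apply]
  simp [eq_comm]

/-! ### Parametrization of simplices -/

/-- The corner simplex in `ℝ ^ n`. -/
def corner (n : ℕ) : Set (Fin n → ℝ) := {t | (∀ i, 0 ≤ t i) ∧ ∑ i, t i ≤ 1}

/-- The affine parametrization of a simplex with ordered vertices. -/
def simplexParam {n : ℕ} (p : Fin (n + 1) → E) : (Fin n → ℝ) →ᵃ[ℝ] E :=
  (Fintype.linearCombination ℝ (fun i : Fin n => p i.succ - p 0)).toAffineMap +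
    AffineMap.const ℝ _ (p 0)

lemma simplexParam_apply {n : ℕ} (p : Fin (n + 1) → E) (t : Fin n → ℝ) :
    simplexParam p t = (∑ i, t i • (p i.succ - p 0)) + p 0 := by
  simp [simplexParam, Fintype.linearCombination_apply]

lemma continuous_simplexParam {n : ℕ} (p : Fin (n + 1) → E) : Continuous (simplexParam p) :=
  AffineMap.continuous_of_finiteDimensional _

lemma cone_simplexParam {n : ℕ} (p : Fin (n + 1) → E) (L : ℝ × E →L[ℝ] ℝ) (t : Fin n → ℝ) :
    L (1, simplexParam p t) =
      ∑ i, t i * L (1, p i.succ) + (1 - ∑ i, t i) * L (1, p 0) := by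
  have e : ((1 : ℝ), simplexParam p t) =
      ∑ i, t i • ((1 : ℝ), p i.succ) + (1 - ∑ i, t i) • ((1 : ℝ), p 0) := by
    refine Prod.ext ?_ ?_
    · simp [Prod.fst_sum]
    · simp [Prod.snd_sum, simplexParam_apply, smul_sub, sub_smul, Finset.sum_smul]
      abel
  rw [e]
  simp only [map_add, map_sum, map_smul, smul_eq_mul]

lemma simplexParam_injective {n : ℕ} {p : Fin (n + 1) → E} (hp : AffineIndependent ℝ p) :
    Function.Injective (simplexParam p) := by
  classical
  obtain ⟨Λ, hΛ⟩ := exists_cone_dual hp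
  intro s t h
  ext i
  have := congrArg (fun x => Λ i.succ (1, x)) h
  simpa [cone_simplexParam, hΛ, Fin.succ_ne_zero] using this

lemma isCompact_corner (n : ℕ) : IsCompact (corner n) := by
  have hc : IsClosed (corner n) := by
    have : corner n = (⋂ i, {t | 0 ≤ t i}) ∩ {t | ∑ i, t i ≤ 1} := by
      ext t; simp [corner]
    rw [this]
    refine (isClosed_iInter fun i => ?_).inter ?_
    · exact isClosed_le continuous_const (continuous_apply i)
    · exact isClosed_le (continuous_finsetSum _ fun i _ => continuous_apply i) continuous_const
  refine (isCompact_Icc (a := (0 : Fin n → ℝ)) (b := 1)).of_isClosed_subset hc ?_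
  rintro t ⟨h0, h1⟩
  refine ⟨h0, fun i => ?_⟩
  exact (Finset.single_le_sum (fun i _ => h0 i) (Finset.mem_univ i)).trans h1

/-- The interior of the corner simplex. -/
def openCorner (n : ℕ) : Set (Fin n → ℝ) := {t | (∀ i, 0 < t i) ∧ ∑ i, t i < 1}

lemma isOpen_openCorner (n : ℕ) : IsOpen (openCorner n) := by
  have : openCorner n = (⋂ i, {t | 0 < t i}) ∩ {t | ∑ i, t i < 1} := by
    ext t; simp [openCorner]
  rw [this]
  refine (isOpen_iInter_of_finite fun i => ?_).inter ?_
  · exact isOpen_lt continuous_const (continuous_apply i)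
  · exact isOpen_lt (continuous_finsetSum _ fun i _ => continuous_apply i) continuous_const

lemma openCorner_nonempty (n : ℕ) : (openCorner n).Nonempty := by
  refine ⟨fun _ => 1 / (n + 1), fun i => by positivity, ?_⟩
  simp only [Finset.sum_const, Finset.card_univ, Fintype.card_fin, nsmul_eq_mul]
  rw [mul_one_div, div_lt_one (by positivity)]; linarith

lemma openCorner_subset (n : ℕ) : openCorner n ⊆ corner n := fun _ h => ⟨fun i => (h.1 i).le, h.2.le⟩

lemma volume_corner_ne_zero (n : ℕ) : volume (corner n) ≠ 0 :=
  (((isOpen_openCorner n).measure_pos volume (openCorner_nonempty n)).trans_le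
    (measure_mono (openCorner_subset n))).ne'

lemma volume_corner_ne_top (n : ℕ) : volume (corner n) ≠ ⊤ := (isCompact_corner n).measure_lt_top.ne

/-- The uniform probability measure on the corner simplex. -/
def unifCorner (n : ℕ) : Measure (Fin n → ℝ) := ProbabilityTheory.cond volume (corner n)

instance (n : ℕ) : IsProbabilityMeasure (unifCorner n) :=
  cond_isProbabilityMeasure_of_finite (volume_corner_ne_zero n) (volume_corner_ne_top n)

lemma simplexParam_image_corner {n : ℕ} (p : Fin (n + 1) → E) :
    simplexParam p '' corner n = convexHull ℝ (Set.range p) := by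
  apply Set.Subset.antisymm
  · rintro _ ⟨t, ⟨h0, h1⟩, rfl⟩
    have e : simplexParam p t = ∑ i : Fin (n + 1),
        (Fin.cons (1 - ∑ i, t i) t : Fin (n + 1) → ℝ) i • p i := by
      rw [Fin.sum_univ_succ]
      simp [simplexParam_apply, smul_sub, sub_smul, Finset.sum_smul]
      abel
    rw [e]
    refine (convex_convexHull ℝ _).sum_mem (fun i _ => ?_) ?_ fun i _ =>
      subset_convexHull ℝ _ (Set.mem_range_self i)
    · refine Fin.cases ?_ (fun i => ?_) i
      · simpa using h1
      · simpa using h0 i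
    · rw [Fin.sum_univ_succ]; simp
  · refine convexHull_min ?_ ?_
    · rintro _ ⟨i, rfl⟩
      refine Fin.cases ?_ (fun i => ?_) i
      · exact ⟨0, by simp [corner], by simp [simplexParam_apply]⟩
      · refine ⟨Pi.single i 1, ⟨fun j => ?_, by simp⟩, ?_⟩
        · by_cases h : j = i
          · subst h; simp
          · simp [h]
        · simp [simplexParam_apply, Pi.single_apply]
    · refine Convex.affine_image _ ?_
      intro s hs t ht a b ha hb hab
      refine ⟨fun i => ?_, ?_⟩
      · have := hs.1 i; have := ht.1 i
        simp only [Pi.add_apply, Pi.smul_apply, smul_eq_mul]; positivity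
      · simp only [Pi.add_apply, Pi.smul_apply, smul_eq_mul, Finset.sum_add_distrib,
          ← Finset.mul_sum]
        nlinarith [hs.2, ht.2]

open scoped Classical in
/-- The uniform measure on a simplex is the image of the uniform measure on the corner simplex. -/
lemma unif_image {n : ℕ} {p : Fin (n + 1) → E} (hp : AffineIndependent ℝ p) :
    unif (Finset.univ.image p) = (unifCorner n).map (simplexParam p) := by
  have hcard : ((Finset.univ.image p).card - 1 : ℕ) = n := by
    rw [Finset.card_image_of_injective _ hp.injective]; simp
  set b := Fintype.linearCombination ℝ (fun i : Fin n => p i.succ - p 0) with hb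
  have hψ : ∀ t, simplexParam p t = b t + p 0 := fun t => by
    simp [simplexParam_apply, hb, Fintype.linearCombination_apply]
  have hbi : Function.Injective b := fun s t h =>
    simplexParam_injective hp (by rw [hψ, hψ, h])
  set W := LinearMap.range b with hW
  have hfr : Module.finrank ℝ W = n := by
    rw [hW, LinearMap.finrank_range_of_inj hbi]; simp
  let φ : (Fin n → ℝ) ≃L[ℝ] W := (LinearEquiv.ofInjective b hbi).toContinuousLinearEquiv
  let ι : W → E := fun w => (w : E) + p 0
  have hι : Isometry ι := (IsometryEquiv.addRight (p 0)).isometry.comp isometry_subtype_coe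
  have hιφ : ∀ t, ι (φ t) = simplexParam p t := fun t => by rw [hψ]; rfl
  have hA : (volume.map φ).IsAddHaarMeasure := φ.isAddHaarMeasure_map _
  have hB : (Measure.hausdorffMeasure (n : ℝ) : Measure W).IsAddHaarMeasure := by
    have := isAddHaarMeasure_hausdorffMeasure (E := W)
    rwa [hfr] at this
  -- Both are Haar measures on the direction space, hence proportional; the factor cancels in the
  -- conditional probability.
  obtain ⟨c, hc, hsm⟩ : ∃ c : NNReal, 0 < c ∧
      (Measure.hausdorffMeasure (n : ℝ) : Measure W) = c • volume.map φ :=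
    ⟨_, Measure.addHaarScalarFactor_pos_of_isAddHaarMeasure _ _,
      Measure.isAddLeftInvariant_eq_smul _ _⟩
  have hme : Measurable (simplexParam p) := (continuous_simplexParam p).measurable
  have key : ∀ s : Set E, MeasurableSet s → s ⊆ Set.range ι →
      Measure.hausdorffMeasure (n : ℝ) s = c * volume (simplexParam p ⁻¹' s) := by
    intro s hs hsr
    have h1 := hι.map_hausdorffMeasure (d := (n : ℝ)) (Or.inl (by positivity))
    have h2 := congrArg (fun m => m s) h1
    simp only [Measure.restrict_apply hs, Set.inter_eq_left.2 hsr] at h2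
    rw [← h2, Measure.map_apply hι.continuous.measurable hs, hsm, Measure.smul_apply, ENNReal.smul_def, smul_eq_mul,
      Measure.map_apply φ.continuous.measurable (hι.continuous.measurable hs)]
    rfl
  have hconv : convexHull ℝ ((Finset.univ.image p : Finset E) : Set E) =
      simplexParam p '' corner n := by
    rw [simplexParam_image_corner]; simp
  have hsub : simplexParam p '' corner n ⊆ Set.range ι := by
    rintro _ ⟨t, _, rfl⟩; exact ⟨φ t, hιφ t⟩
  have hmeas : MeasurableSet (simplexParam p '' corner n) :=
    ((isCompact_corner n).image (continuous_simplexParam p)).measurableSet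
  ext s hs
  rw [unif, hcard, hconv, cond_apply hmeas, Measure.map_apply hme hs, unifCorner,
    cond_apply (isCompact_corner n).measurableSet, key _ hmeas hsub,
    key _ (hmeas.inter hs) (Set.inter_subset_left.trans hsub), Set.preimage_inter,
    Set.preimage_image_eq _ (simplexParam_injective hp)]
  have hc0 : (c : ENNReal) ≠ 0 := by simpa using hc.ne'
  rw [ENNReal.mul_inv (Or.inl hc0) (Or.inl ENNReal.coe_ne_top), mul_comm (c : ENNReal)⁻¹,
    mul_assoc, ← mul_assoc (c : ENNReal)⁻¹, ENNReal.inv_mul_cancel hc0 ENNReal.coe_ne_top, one_mul]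

/-- An enumeration of the vertices of a simplex, starting with a given vertex. -/
lemma exists_enum {T : Finset E} (hT : AffineIndependent ℝ ((↑) : T → E)) {n : ℕ}
    (hn : T.card = n + 1) {x : E} (hx : x ∈ T) :
    ∃ p : Fin (n + 1) → E, AffineIndependent ℝ p ∧ p 0 = x ∧ Set.range p = T := by
  classical
  let e : Fin (n + 1) ≃ T := (T.equivFinOfCardEq hn).symm
  let f : Fin (n + 1) ≃ T := (Equiv.swap 0 (e.symm ⟨x, hx⟩)).trans e
  refine ⟨fun i => f i, hT.comp_embedding f.toEmbedding, by simp [f], ?_⟩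
  ext y
  constructor
  · rintro ⟨i, rfl⟩; exact (f i).2
  · intro hy; exact ⟨f.symm ⟨y, hy⟩, by simp⟩

lemma unif_eq_map {n : ℕ} {p : Fin (n + 1) → E} (hp : AffineIndependent ℝ p) {T : Finset E}
    (hT : Set.range p = T) : unif T = (unifCorner n).map (simplexParam p) := by
  classical
  rw [← unif_image hp]
  congr 1
  rw [← Finset.coe_inj, ← hT]; simp

lemma integral_unif {n : ℕ} {p : Fin (n + 1) → E} (hp : AffineIndependent ℝ p) {T : Finset E}
    (hT : Set.range p = T) {f : E → ℝ} (hf : Continuous f) :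
    ∫ x, f x ∂(unif T) = ∫ t, f (simplexParam p t) ∂(unifCorner n) := by
  rw [unif_eq_map hp hT, integral_map (continuous_simplexParam p).aemeasurable
    hf.aestronglyMeasurable]

lemma isProbabilityMeasure_unif {T : Finset E} (hT : AffineIndependent ℝ ((↑) : T → E))
    (hne : T.Nonempty) : IsProbabilityMeasure (unif T) := by
  obtain ⟨n, hn⟩ := Nat.exists_eq_add_one_of_ne_zero hne.card_pos.ne'
  obtain ⟨x, hx⟩ := hne
  obtain ⟨p, hp, -, hr⟩ := exists_enum hT hn hx
  rw [unif_eq_map hp hr]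
  exact Measure.isProbabilityMeasure_map (continuous_simplexParam p).aemeasurable

/-- An analytic function which vanishes almost everywhere on a simplex vanishes on its affine
span. -/
lemma eq_zero_of_ae_unif {X : Type*} [NormedAddCommGroup X] [NormedSpace ℝ X] {T : Finset E}
    (hT : AffineIndependent ℝ ((↑) : T → E)) {f : E → X}
    (hf : AnalyticOnNhd ℝ f Set.univ) (h : ∀ᵐ x ∂(unif T), f x = 0) {x : E}
    (hx : x ∈ affineSpan ℝ (T : Set E)) : f x = 0 := by
  have hne : T.Nonempty := by
    rw [← Finset.coe_nonempty, ← affineSpan_nonempty ℝ]; exact ⟨x, hx⟩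
  obtain ⟨n, hn⟩ := Nat.exists_eq_add_one_of_ne_zero hne.card_pos.ne'
  obtain ⟨y, hy⟩ := hne
  obtain ⟨p, hp, -, hr⟩ := exists_enum hT hn hy
  have hf' : Continuous f := continuousOn_univ.1 hf.continuousOn
  have han : AnalyticOnNhd ℝ (fun t => f (simplexParam p t)) Set.univ := by
    have h1 : AnalyticOnNhd ℝ (simplexParam p) Set.univ := by
      have : (simplexParam p : (Fin n → ℝ) → E) = fun t => (Fintype.linearCombination ℝ
          (fun i : Fin n => p i.succ - p 0)).toContinuousLinearMap t + p 0 := by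
        ext t; simp [simplexParam]
      rw [this]
      exact (ContinuousLinearMap.analyticOnNhd _ _).add analyticOnNhd_const
    exact hf.comp h1 (fun _ _ => Set.mem_univ _)
  -- Continuity upgrades almost everywhere vanishing to vanishing on the open corner; the identity
  -- theorem then propagates it to the whole parameter space, whose image contains the affine span.
  have hz : ∀ t ∈ openCorner n, f (simplexParam p t) = 0 := by
    have h1 : ∀ᵐ t ∂(unifCorner n), f (simplexParam p t) = 0 := by
      rw [unif_eq_map hp hr] at h
      exact ae_of_ae_map (continuous_simplexParam p).aemeasurable h
    have h2 : ∀ᵐ t ∂(volume.restrict (corner n)), f (simplexParam p t) = 0 := by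
      refine Measure.AbsolutelyContinuous.ae_le ?_ h1
      refine Measure.AbsolutelyContinuous.mk fun s hs hs0 => ?_
      rw [unifCorner, cond_apply (isCompact_corner n).measurableSet, mul_eq_zero] at hs0
      rw [Measure.restrict_apply hs, Set.inter_comm]
      exact hs0.resolve_left (ENNReal.inv_ne_zero.2 (volume_corner_ne_top n))
    have h3 : ∀ᵐ t ∂(volume.restrict (openCorner n)), f (simplexParam p t) = 0 :=
      ae_restrict_of_ae_restrict_of_subset (openCorner_subset n) h2
    exact Measure.eqOn_open_of_ae_eq h3 (isOpen_openCorner n)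
      (hf'.comp (continuous_simplexParam p)).continuousOn continuousOn_const
  obtain ⟨t₀, ht₀⟩ := openCorner_nonempty n
  have hall : ∀ t, f (simplexParam p t) = 0 := fun t =>
    han.eqOn_zero_of_preconnected_of_eventuallyEq_zero isPreconnected_univ (Set.mem_univ t₀)
      (Filter.eventuallyEq_of_mem ((isOpen_openCorner n).mem_nhds ht₀) hz) (Set.mem_univ t)
  have hmem : x ∈ (⊤ : AffineSubspace ℝ (Fin n → ℝ)).map (simplexParam p) := by
    refine (affineSpan_le (k := ℝ)).2 ?_ hx
    rw [← hr]
    rintro _ ⟨i, rfl⟩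
    refine Fin.cases ?_ (fun i => ?_) i
    · exact ⟨0, by simp, by simp [simplexParam_apply]⟩
    · exact ⟨Pi.single i 1, by simp, by simp [simplexParam_apply, Pi.single_apply]⟩
  obtain ⟨t, -, rfl⟩ := hmem
  exact hall t

/-! ### The divergence theorem on simplices -/

/-- Fubini and the fundamental theorem of calculus: the fibre of the corner over `t` is the interval
from `0` to `1 - ∑ i, t i`. -/
lemma setIntegral_corner_succ {n : ℕ} {G g : ℝ × (Fin n → ℝ) → ℝ} (hg : Continuous g)
    (hG : ∀ s t, HasDerivAt (fun s => G (s, t)) (g (s, t)) s) :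
    ∫ t in corner (n + 1), g (t 0, fun i => t i.succ) =
      ∫ t in corner n, (G (1 - ∑ i, t i, t) - G (0, t)) := by
  set S : Set (ℝ × (Fin n → ℝ)) := {z | z.2 ∈ corner n ∧ 0 ≤ z.1 ∧ z.1 ≤ 1 - ∑ i, z.2 i} with hS
  have hScl : IsClosed S := by
    refine IsClosed.inter ((isCompact_corner n).isClosed.preimage continuous_snd)
      (IsClosed.inter ?_ ?_)
    · exact isClosed_le continuous_const continuous_fst
    · exact isClosed_le continuous_fst (by fun_prop)
  have hSco : IsCompact S := by
    refine (isCompact_Icc (a := (0 : ℝ)) (b := 1)).prod (isCompact_corner n)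
      |>.of_isClosed_subset hScl ?_
    rintro ⟨s, t⟩ ⟨h1, h2, h3⟩
    have : 0 ≤ ∑ i, t i := Finset.sum_nonneg fun i _ => h1.1 i
    refine ⟨⟨h2, ?_⟩, h1⟩
    simp only at h3 ⊢; linarith
  have hmp := volume_preserving_piFinSuccAbove (fun _ : Fin (n + 1) => ℝ) 0
  set e := MeasurableEquiv.piFinSuccAbove (fun _ : Fin (n + 1) => ℝ) 0 with he
  have het : ∀ t, e t = (t 0, fun i => t i.succ) := fun t => rfl
  have hpre : corner (n + 1) = e ⁻¹' S := by
    ext t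
    simp only [corner, hS, Set.mem_ofPred_eq, Set.mem_preimage, het, Fin.sum_univ_succ]
    constructor
    · rintro ⟨h0, h1⟩
      exact ⟨⟨fun i => h0 _, by linarith [h0 0]⟩, h0 0, by linarith⟩
    · rintro ⟨⟨h0, h1⟩, h2, h3⟩
      exact ⟨Fin.cases h2 h0, by linarith⟩
  have h1 := hmp.setIntegral_preimage_emb e.measurableEmbedding g S
  rw [hpre]
  refine Eq.trans ?_ (h1.trans ?_)
  · rfl
  have hint : IntegrableOn g S (volume.prod volume) :=
    hg.continuousOn.integrableOn_compact hSco
  rw [← integral_indicator hScl.measurableSet, Measure.volume_eq_prod, integral_prod_symm _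
    ((integrable_indicator_iff hScl.measurableSet).2 hint),
    ← integral_indicator (isCompact_corner n).measurableSet]
  congr 1
  ext t
  by_cases ht : t ∈ corner n
  · rw [Set.indicator_of_mem ht]
    have hs : 0 ≤ 1 - ∑ i, t i := by linarith [ht.2]
    have e1 : (fun s => S.indicator g (s, t)) =
        (Set.Icc 0 (1 - ∑ i, t i)).indicator (fun s => g (s, t)) := by
      ext s
      by_cases h : s ∈ Set.Icc 0 (1 - ∑ i, t i)
      · rw [Set.indicator_of_mem h, Set.indicator_of_mem]
        exact ⟨ht, h.1, h.2⟩
      · rw [Set.indicator_of_notMem h, Set.indicator_of_notMem]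
        exact fun h' => h ⟨h'.2.1, h'.2.2⟩
    rw [e1, integral_indicator measurableSet_Icc, integral_Icc_eq_integral_Ioc,
      ← intervalIntegral.integral_of_le hs]
    exact intervalIntegral.integral_eq_sub_of_hasDerivAt (fun s _ => hG s t)
      ((hg.comp (by fun_prop)).intervalIntegrable _ _)
  · rw [Set.indicator_of_notMem ht]
    have e1 : (fun s => S.indicator g (s, t)) = fun _ => 0 := by
      ext s
      exact Set.indicator_of_notMem (fun h => ht h.1) _
    rw [e1]; simp

lemma integral_unifCorner {n : ℕ} (f : (Fin n → ℝ) → ℝ) :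
    ∫ t, f t ∂(unifCorner n) = (volume.real (corner n))⁻¹ * ∫ t in corner n, f t := by
  rw [unifCorner, ProbabilityTheory.cond, integral_smul_measure]
  simp [Measure.real]

lemma volumeReal_corner_pos (n : ℕ) : 0 < volume.real (corner n) :=
  ENNReal.toReal_pos (volume_corner_ne_zero n) (volume_corner_ne_top n)

lemma continuous_cone (L : ℝ × E →L[ℝ] ℝ) : Continuous (fun x : E => L (1, x)) := by fun_prop

/-- The barycentre of a simplex. -/
lemma integral_unifCorner_one_sub {n : ℕ} {p : Fin (n + 1) → E} (hp : AffineIndependent ℝ p) :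
    ((n : ℝ) + 1) * ∫ t, (1 - ∑ i, t i) ∂(unifCorner n) = 1 := by
  classical
  obtain ⟨Λ, hΛ⟩ := exists_cone_dual hp
  have hr : Set.range p = (Finset.univ.image p : Finset E) := by simp
  -- Relabelling the vertices shows that all barycentric coordinates have the same mean; since there
  -- are `n + 1` of them with sum one, that mean is `1 / (n + 1)`.
  have h1 : ∀ i, ∫ x, Λ i (1, x) ∂(unif (Finset.univ.image p)) =
      ∫ t, (1 - ∑ i, t i) ∂(unifCorner n) := by
    intro i
    have hq : AffineIndependent ℝ (p ∘ Equiv.swap 0 i) :=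
      hp.comp_embedding (Equiv.swap 0 i).toEmbedding
    rw [integral_unif hq (by rw [← hr]; exact (Equiv.swap 0 i).surjective.range_comp p)
      (continuous_cone _)]
    refine integral_congr_ae (Filter.Eventually.of_forall fun t => ?_)
    simp only [cone_simplexParam, Function.comp_apply, hΛ]
    have : ∀ j : Fin n, (Equiv.swap 0 i) j.succ ≠ i := by
      intro j hj
      have : (Equiv.swap 0 i) j.succ = (Equiv.swap 0 i) 0 := by rw [hj]; simp
      exact Fin.succ_ne_zero j ((Equiv.swap 0 i).injective this)
    simp [fun j => (this j).symm]
  have hint : ∀ i, Integrable (fun x => Λ i (1, x)) (unif (Finset.univ.image p)) := fun i =>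
    (memLp_of_continuous _ (continuous_cone (Λ i))).integrable (by norm_num)
  have h2 : ∑ i, ∫ x, Λ i (1, x) ∂(unif (Finset.univ.image p)) = 1 := by
    rw [← integral_finsetSum _ fun i _ => hint i,
      integral_unif hp hr (continuous_finsetSum _ fun i _ => continuous_cone (Λ i))]
    rw [integral_congr_ae (g := fun _ => (1 : ℝ)) (Filter.Eventually.of_forall fun t => ?_)]
    · simp
    · simp only [cone_simplexParam, hΛ]
      rw [Finset.sum_add_distrib, Finset.sum_comm]
      simp
  simp only [h1, Finset.sum_const, Finset.card_univ, Fintype.card_fin, nsmul_eq_mul] at h2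
  simpa using h2

/-- By Fubini the volume of the larger corner is the integral of `1 - ∑ i, t i` over the smaller
one, and the mean of this function is known. The points `p` serve only to invoke that mean. -/
lemma volume_corner_succ {n : ℕ} {p : Fin (n + 1) → E} (hp : AffineIndependent ℝ p) :
    volume.real (corner n) = ((n : ℝ) + 1) * volume.real (corner (n + 1)) := by
  have h1 := integral_unifCorner_one_sub hp
  have h2 := setIntegral_corner_succ (n := n) (G := fun z => z.1) (g := fun _ => 1)
    continuous_const (fun s t => hasDerivAt_id s)
  simp only [sub_zero] at h2
  rw [integral_unifCorner, ← h2] at h1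
  have h3 : ∫ t in corner (n + 1), (1 : ℝ) = volume.real (corner (n + 1)) := by simp
  rw [h3] at h1
  have := volumeReal_corner_pos n
  field_simp at h1
  linarith

/-- Integrating along the lines parallel to the edge from `p 0` to `p 1` leaves the values of `f` on
the facets opposite to these two vertices. Normalization of the measures produces the factor `n +
1`. -/
lemma integral_fderiv_aux {n : ℕ} {p : Fin (n + 2) → E} (hp : AffineIndependent ℝ p)
    {f : E → ℝ} (hf : ContDiff ℝ 1 f) :
    ∫ t, fderiv ℝ f (simplexParam p t) (p 1 - p 0) ∂(unifCorner (n + 1)) =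
      ((n : ℝ) + 1) * (∫ t, f (simplexParam (p ∘ Fin.succ) t) ∂(unifCorner n) -
        ∫ t, f (simplexParam (p ∘ Fin.succAbove 1) t) ∂(unifCorner n)) := by
  have hp1 : AffineIndependent ℝ (p ∘ Fin.succ) := hp.comp_embedding (Fin.succEmb _)
  let m : ℝ × (Fin n → ℝ) → E := fun z => simplexParam (p ∘ Fin.succAbove 1) z.2 +
    z.1 • (p 1 - p 0)
  have hm : Continuous m := by
    have := continuous_simplexParam (p ∘ Fin.succAbove 1)
    fun_prop
  have hG : ∀ s t, HasDerivAt (fun s => f (m (s, t))) (fderiv ℝ f (m (s, t)) (p 1 - p 0)) s := by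
    intro s t
    have h1 : HasDerivAt (fun s => m (s, t)) (p 1 - p 0) s := by
      have := ((hasDerivAt_id s).smul_const (p 1 - p 0)).const_add
        (simplexParam (p ∘ Fin.succAbove 1) t)
      rw [one_smul] at this
      exact this
    exact ((hf.differentiable (by simp)) _).hasFDerivAt.comp_hasDerivAt s h1
  have hg : Continuous (fun z => fderiv ℝ f (m z) (p 1 - p 0)) :=
    ((hf.continuous_fderiv (by simp)).comp hm).clm_apply continuous_const
  have key := setIntegral_corner_succ (G := fun z => f (m z)) hg hG
  have e1 : ∀ t : Fin (n + 1) → ℝ, m (t 0, fun i => t i.succ) = simplexParam p t := by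
    intro t
    simp only [m, simplexParam_apply, Fin.sum_univ_succ, Function.comp_apply]
    simp
    abel
  have e2 : ∀ t : Fin n → ℝ, m (1 - ∑ i, t i, t) = simplexParam (p ∘ Fin.succ) t := by
    intro t
    simp only [m, simplexParam_apply, Function.comp_apply]
    simp [sub_smul, smul_sub, Finset.sum_smul]
    abel
  have e3 : ∀ t : Fin n → ℝ, m (0, t) = simplexParam (p ∘ Fin.succAbove 1) t := by
    intro t; simp [m]
  simp only [e1, e2, e3] at key
  have hi : ∀ q : Fin (n + 1) → E, IntegrableOn (fun t => f (simplexParam q t)) (corner n) :=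
    fun q => (hf.continuous.comp (continuous_simplexParam q)).continuousOn.integrableOn_compact
      (isCompact_corner n)
  rw [integral_sub (hi _) (hi _)] at key
  simp only [integral_unifCorner, key, volume_corner_succ hp1]
  have := volumeReal_corner_pos (n + 1)
  field_simp

lemma integral_fderiv_edge {T : Finset E} [DecidableEq E] (hT : AffineIndependent ℝ ((↑) : T → E))
    {x y : E} (hx : x ∈ T) (hy : y ∈ T) (hxy : x ≠ y) {f : E → ℝ} (hf : ContDiff ℝ 1 f) :
    ∫ z, fderiv ℝ f z (y - x) ∂(unif T) = ((T.card - 1 : ℕ) : ℝ) *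
      (∫ z, f z ∂(unif (T.erase x)) - ∫ z, f z ∂(unif (T.erase y))) := by
  obtain ⟨n, hn⟩ : ∃ n, T.card = n + 1 + 1 := by
    have : 1 < T.card := Finset.one_lt_card.2 ⟨x, hx, y, hy, hxy⟩
    exact ⟨T.card - 2, by omega⟩
  obtain ⟨p, hp, hp0, hp1, hr⟩ : ∃ p : Fin (n + 2) → E, AffineIndependent ℝ p ∧ p 0 = x ∧
      p 1 = y ∧ Set.range p = T := by
    obtain ⟨q, hq, hq0, hr⟩ := exists_enum hT hn hx
    obtain ⟨j, hj⟩ : y ∈ Set.range q := by rw [hr]; exact hy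
    have hj0 : j ≠ 0 := fun h => hxy (by rw [← hq0, ← hj, h])
    refine ⟨q ∘ Equiv.swap 1 j, hq.comp_embedding (Equiv.swap 1 j).toEmbedding, ?_, by simp [hj],
      by rw [(Equiv.swap 1 j).surjective.range_comp, hr]⟩
    rw [Function.comp_apply, Equiv.swap_apply_of_ne_of_ne (by simp) hj0.symm, hq0]
  have hinj := hp.injective
  have hr1 : Set.range (p ∘ Fin.succ) = (T.erase x : Finset E) := by
    rw [Finset.coe_erase, ← hr, ← hp0]
    ext z
    constructor
    · rintro ⟨i, rfl⟩
      exact ⟨⟨_, rfl⟩, fun h => Fin.succ_ne_zero i (hinj h)⟩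
    · rintro ⟨⟨i, rfl⟩, h⟩
      obtain ⟨j, rfl⟩ := Fin.exists_succ_eq.2 (fun h0 : i = 0 => h (by simp [h0]))
      exact ⟨j, rfl⟩
  have hr2 : Set.range (p ∘ Fin.succAbove 1) = (T.erase y : Finset E) := by
    rw [Finset.coe_erase, ← hr, ← hp1]
    ext z
    constructor
    · rintro ⟨i, rfl⟩
      exact ⟨⟨_, rfl⟩, fun h => Fin.succAbove_ne 1 i (hinj h)⟩
    · rintro ⟨⟨i, rfl⟩, h⟩
      obtain ⟨j, rfl⟩ := Fin.exists_succAbove_eq (fun h0 : i = 1 => h (by simp [h0]))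
      exact ⟨j, rfl⟩
  have hps : AffineIndependent ℝ (p ∘ Fin.succ) := hp.comp_embedding (Fin.succEmb _)
  have hpa : AffineIndependent ℝ (p ∘ Fin.succAbove 1) :=
    hp.comp_embedding (Fin.succAboveEmb 1)
  rw [hn, integral_unif hp hr ((hf.continuous_fderiv (by simp)).clm_apply continuous_const),
    integral_unif hps hr1 hf.continuous, integral_unif hpa hr2 hf.continuous, ← hp0, ← hp1,
    integral_fderiv_aux hp hf]
  simp

open scoped Classical in
/-- The divergence theorem on a simplex. -/
lemma integral_fderiv_unif {T : Finset E} (hT : AffineIndependent ℝ ((↑) : T → E))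
    {c : E → ℝ} (hc : ∑ y ∈ T, c y = 0) {f : E → ℝ} (hf : ContDiff ℝ 1 f) :
    ∫ z, fderiv ℝ f z (∑ y ∈ T, c y • y) ∂(unif T) = - ((T.card - 1 : ℕ) : ℝ) *
      ∑ x ∈ T, c x * ∫ z, f z ∂(unif (T.erase x)) := by
  rcases T.eq_empty_or_nonempty with rfl | ⟨x, hx⟩
  · simp
  have e : ∑ y ∈ T, c y • y = ∑ y ∈ T, c y • (y - x) := by
    simp [smul_sub, ← Finset.sum_smul, hc]
  have hi : ∀ y, Integrable (fun z => fderiv ℝ f z (y - x)) (unif T) := fun y =>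
    (memLp_of_continuous T ((hf.continuous_fderiv (by simp)).clm_apply
      continuous_const)).integrable (by norm_num)
  simp only [e, map_sum, map_smul, smul_eq_mul]
  rw [integral_finsetSum _ fun y _ => (hi y).const_mul _]
  simp only [integral_const_mul]
  have h1 : ∀ y ∈ T, c y * ∫ z, fderiv ℝ f z (y - x) ∂(unif T) = c y * (((T.card - 1 : ℕ) : ℝ) *
      (∫ z, f z ∂(unif (T.erase x)) - ∫ z, f z ∂(unif (T.erase y)))) := by
    intro y hy
    by_cases hxy : x = y
    · subst hxy; simp
    · rw [integral_fderiv_edge hT hx hy hxy hf]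
  rw [Finset.sum_congr rfl h1]
  have h2 : ∀ y, c y * (((T.card - 1 : ℕ) : ℝ) *
      (∫ z, f z ∂(unif (T.erase x)) - ∫ z, f z ∂(unif (T.erase y)))) =
      c y * (((T.card - 1 : ℕ) : ℝ) * ∫ z, f z ∂(unif (T.erase x))) -
      ((T.card - 1 : ℕ) : ℝ) * (c y * ∫ z, f z ∂(unif (T.erase y))) := fun y => by ring
  simp only [h2, Finset.sum_sub_distrib, ← Finset.sum_mul, hc, ← Finset.mul_sum]
  ring

/-! ### Tangent vectors and barycentric coordinates -/

lemma sum_smul_mem_tangent {F : Finset E} {c : E → ℝ} (hc : ∑ y ∈ F, c y = 0) :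
    ∑ y ∈ F, c y • y ∈ tangent F := by
  rcases F.eq_empty_or_nonempty with rfl | ⟨x, hx⟩
  · simp
  have e : ∑ y ∈ F, c y • y = ∑ y ∈ F, c y • (y - x) := by
    simp [smul_sub, ← Finset.sum_smul, hc]
  rw [e]
  exact Submodule.sum_mem _ fun y hy => Submodule.smul_mem _ _ (vsub_mem_vectorSpan ℝ hy hx)

lemma tangent_mono {F T : Finset E} (h : F ⊆ T) : tangent F ≤ tangent T :=
  vectorSpan_mono ℝ (Finset.coe_subset.2 h)

/-- `Λ` is a family of linear forms on `ℝ × E` giving the barycentric coordinates of `T`. -/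
def IsBary (T : Finset E) (Λ : E → (ℝ × E →L[ℝ] ℝ)) : Prop :=
  (∀ x ∈ T, Λ x (1, x) = 1) ∧ ∀ x ∈ T, ∀ y ∈ T, x ≠ y → Λ x (1, y) = 0

lemma exists_isBary {T : Finset E} (hT : AffineIndependent ℝ ((↑) : T → E)) :
    ∃ Λ, IsBary T Λ := by
  classical
  obtain ⟨Λ, hΛ⟩ := exists_cone_dual hT
  refine ⟨fun x => if h : x ∈ T then Λ ⟨x, h⟩ else 0, fun x hx => ?_, fun x hx y hy hxy => ?_⟩
  · have := hΛ ⟨x, hx⟩ ⟨x, hx⟩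
    simpa [hx] using this
  · have := hΛ ⟨x, hx⟩ ⟨y, hy⟩
    simpa [hx, hxy] using this

namespace IsBary

variable {T : Finset E} {Λ : E → (ℝ × E →L[ℝ] ℝ)}

lemma mono (h : IsBary T Λ) {F : Finset E} (hF : F ⊆ T) : IsBary F Λ :=
  ⟨fun x hx => h.1 x (hF hx), fun x hx y hy => h.2 x (hF hx) y (hF hy)⟩

lemma sum_smul (h : IsBary T Λ) {c : E → ℝ} {x : E} (hx : x ∈ T) :
    Λ x (∑ y ∈ T, c y • ((1 : ℝ), y)) = c x := by
  rw [map_sum, Finset.sum_eq_single x]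
  · rw [map_smul, h.1 x hx]; simp
  · intro y hy hyx; rw [map_smul, h.2 x hx y hy hyx.symm]; simp
  · exact fun h => absurd hx h

/-- Every vector of the cone over the affine span is recovered from its coordinates. -/
lemma sum_eq (h : IsBary T Λ) {z : ℝ × E}
    (hz : z ∈ Submodule.span ℝ ((fun y => ((1 : ℝ), y)) '' (T : Set E))) :
    ∑ y ∈ T, Λ y z • ((1 : ℝ), y) = z := by
  classical
  induction hz using Submodule.span_induction with
  | mem z hz =>
    obtain ⟨x, hx, rfl⟩ := hz
    rw [Finset.sum_eq_single x]
    · simp [h.1 x hx]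
    · intro y hy hyx; simp [h.2 y hy x hx hyx]
    · exact fun h => absurd hx h
  | zero => simp
  | add a b _ _ ha hb => simp only [map_add, add_smul, Finset.sum_add_distrib, ha, hb]
  | smul t a _ ha => simp only [map_smul, smul_eq_mul, mul_smul, ← Finset.smul_sum, ha]

lemma eq_zero_of_notMem (h : IsBary T Λ) {F : Finset E} (hF : F ⊆ T) {x : E} (hx : x ∈ T)
    (hxF : x ∉ F) {z : ℝ × E}
    (hz : z ∈ Submodule.span ℝ ((fun y => ((1 : ℝ), y)) '' (F : Set E))) : Λ x z = 0 := by
  induction hz using Submodule.span_induction with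
  | mem z hz =>
    obtain ⟨y, hy, rfl⟩ := hz
    exact h.2 x hx y (hF hy) (fun e => hxF (e ▸ hy))
  | zero => simp
  | add a b _ _ ha hb => simp [ha, hb]
  | smul t a _ ha => simp [ha]

end IsBary

lemma tangent_mem_cone {T : Finset E} {w : E} (hw : w ∈ tangent T) :
    ((0 : ℝ), w) ∈ Submodule.span ℝ ((fun y => ((1 : ℝ), y)) '' (T : Set E)) := by
  have : tangent T ≤ (Submodule.span ℝ ((fun y => ((1 : ℝ), y)) '' (T : Set E))).comap
      (LinearMap.inr ℝ ℝ E) := by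
    rw [tangent, vectorSpan_def, Submodule.span_le]
    rintro _ ⟨a, ha, b, hb, rfl⟩
    have := Submodule.sub_mem _ (Submodule.subset_span (R := ℝ) (Set.mem_image_of_mem
      (fun y : E => ((1 : ℝ), y)) ha)) (Submodule.subset_span (Set.mem_image_of_mem
      (fun y : E => ((1 : ℝ), y)) hb))
    simpa using this
  exact this hw

lemma affineSpan_mem_cone {T : Finset E} {x : E} (hx : x ∈ affineSpan ℝ (T : Set E)) :
    ((1 : ℝ), x) ∈ Submodule.span ℝ ((fun y => ((1 : ℝ), y)) '' (T : Set E)) := by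
  have hne : (T : Set E).Nonempty := by rw [← affineSpan_nonempty ℝ]; exact ⟨x, hx⟩
  obtain ⟨y, hy⟩ := hne
  have h1 : x - y ∈ tangent T := by
    rw [tangent, ← direction_affineSpan]
    exact AffineSubspace.vsub_mem_direction hx (mem_affineSpan ℝ hy)
  have h2 := Submodule.add_mem _ (tangent_mem_cone h1) (Submodule.subset_span (R := ℝ)
    (Set.mem_image_of_mem (fun y : E => ((1 : ℝ), y)) hy))
  simpa using h2

namespace IsBary

variable {T : Finset E} {Λ : E → (ℝ × E →L[ℝ] ℝ)}

lemma sum_tangent (h : IsBary T Λ) {w : E} (hw : w ∈ tangent T) :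
    ∑ y ∈ T, Λ y (0, w) = 0 ∧ ∑ y ∈ T, Λ y (0, w) • y = w := by
  have := h.sum_eq (tangent_mem_cone hw)
  exact ⟨by simpa [Prod.fst_sum] using congrArg Prod.fst this,
    by simpa [Prod.snd_sum] using congrArg Prod.snd this⟩

lemma coeff_eq (h : IsBary T Λ) {c : E → ℝ} (hc : ∑ y ∈ T, c y = 0) {x : E} (hx : x ∈ T) :
    c x = Λ x (0, ∑ y ∈ T, c y • y) := by
  rw [← h.sum_smul (c := c) hx]
  congr 1
  exact Prod.ext (by simp [Prod.fst_sum, hc]) (by simp [Prod.snd_sum])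

end IsBary

/-! ### Uniqueness of the weak exterior derivative -/

lemma ae_eq_zero_of_apply {F : Finset E} {k : ℕ} {u : L2Form F k}
    (h : ∀ w : Fin k → tangent F, ∀ᵐ x ∂(unif F), u x w = 0) : u = 0 := by
  refine Lp.ext ?_
  have h1 : ∀ᵐ x ∂(unif F), ∀ v : Fin k → Fin (Module.finrank ℝ (tangent F)),
      u x (fun i => Module.finBasis ℝ (tangent F) (v i)) = 0 := ae_all_iff.2 fun v => h _
  filter_upwards [h1, Lp.coeFn_zero (Alt (tangent F) k) 2 (unif F)] with x hx h0
  rw [h0]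
  exact altCoords_injective k (by ext v; simpa [altCoords] using hx v)

lemma integrable_apply {F : Finset E} {k : ℕ} (u : L2Form F k) (w : Fin k → tangent F) :
    Integrable (fun x => u x w) (unif F) := by
  simpa using integrable_avg F (g := fun _ => 1) continuous_const w u

/-- The fundamental lemma of the calculus of variations, applied to each component. `unif F` is a
measure on all of `E`, so test functions on `E` suffice. -/
lemma eq_zero_of_avg {F : Finset E} {k : ℕ} {u : L2Form F k}
    (h : ∀ (w : Fin k → tangent F) (φ : E → ℝ), ContDiff ℝ ∞ φ → avg F φ w u = 0) : u = 0 := by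
  refine ae_eq_zero_of_apply fun w => ?_
  refine ae_eq_zero_of_integral_contDiff_smul_eq_zero (integrable_apply u w).locallyIntegrable
    fun g hg _ => ?_
  exact h w g hg

lemma IsExtDeriv.sub {T : Finset E} {k : ℕ} {u u' : Form T k} {v v' : Form T (k + 1)}
    (h : IsExtDeriv u v) (h' : IsExtDeriv u' v') : IsExtDeriv (u - u') (v - v') := by
  simpa [sub_eq_add_neg] using h.add (h'.smul (-1))

/-- With `u = 0`, Green's formula only says that `v` is orthogonal to all test functions. The
barycentric components it asks for exist by affine independence. -/
lemma IsExtDeriv.eq_zero {T : Finset E} (hT : AffineIndependent ℝ ((↑) : T → E)) {k : ℕ}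
    {v : Form T (k + 1)} (h : IsExtDeriv 0 v) : v = 0 := by
  funext F
  obtain ⟨Λ, hΛ⟩ := exists_isBary hT
  refine eq_zero_of_avg fun w φ hφ => ?_
  have := h F φ hφ w (fun j y => Λ y (0, (w j : E)))
    (fun j => ((hΛ.mono F.2.2).sum_tangent (w j).2).1)
    (fun j => ((hΛ.mono F.2.2).sum_tangent (w j).2).2)
  simpa [avg_zero, facetTerm] using this

/-- The weak exterior derivative is unique. -/
lemma IsExtDeriv.unique {T : Finset E} (hT : AffineIndependent ℝ ((↑) : T → E)) {k : ℕ}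
    {u : Form T k} {v v' : Form T (k + 1)} (h : IsExtDeriv u v) (h' : IsExtDeriv u v') :
    v = v' := by
  have := h.sub h'
  rw [sub_self] at this
  exact sub_eq_zero.1 (this.eq_zero hT)

lemma IsExtDeriv.pull {T F : Finset E} {k : ℕ} {u : Form T k} {v : Form T (k + 1)}
    (h : IsExtDeriv u v) (hF : F ⊆ T) : IsExtDeriv (pull hF k u) (pull hF (k + 1) v) :=
  fun G φ hφ w c hc hw => h ⟨G.1, G.2.1, G.2.2.trans hF⟩ φ hφ w c hc hw

/-! ### Green's formula for smooth forms -/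

/-- The exterior product `l ∧ a` depends only on the restriction of `a` to the kernel of `l`. -/
lemma sum_wedge_eq {V : Type*} [NormedAddCommGroup V] [NormedSpace ℝ V] [FiniteDimensional ℝ V]
    (l : V →L[ℝ] ℝ) {k : ℕ} {a a' : V [⋀^Fin k]→L[ℝ] ℝ}
    (h : ∀ w : Fin k → V, (∀ i, l (w i) = 0) → a w = a' w) (w : Fin (k + 1) → V) :
    ∑ j : Fin (k + 1), (-1 : ℝ) ^ (j : ℕ) * l (w j) * a (fun i => w (j.succAbove i)) =
      ∑ j : Fin (k + 1), (-1 : ℝ) ^ (j : ℕ) * l (w j) * a' (fun i => w (j.succAbove i)) := by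
  by_cases hl : l = 0
  · simp [hl]
  obtain ⟨e, he⟩ : ∃ e, l e = 1 := by
    obtain ⟨v, hv⟩ : ∃ v, l v ≠ 0 := by
      by_contra! hc
      exact hl (ContinuousLinearMap.ext hc)
    exact ⟨(l v)⁻¹ • v, by simp [hv]⟩
  let N := LinearMap.ker (l : V →ₗ[ℝ] ℝ)
  let b := Module.Basis.mkFinCons e (Module.finBasis ℝ N)
    (fun c x hx hcx => by
      have h1 := congrArg l hcx
      have h2 : l x = 0 := hx
      simpa [he, h2] using h1)
    (fun z => ⟨-l z, by
      change l (z + (-l z) • e) = 0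
      simp [he]⟩)
  have hb : ∀ i, i ≠ 0 → l (b i) = 0 := by
    intro i hi
    obtain ⟨j, rfl⟩ := Fin.exists_succ_eq.2 hi
    simp only [b, Module.Basis.coe_mkFinCons, Fin.cons_succ]
    exact (Module.finBasis ℝ N j).2
  have hs : ∀ (c : V [⋀^Fin k]→L[ℝ] ℝ) (w : Fin (k + 1) → V),
      ContinuousAlternatingMap.alternatizeUncurryFin (l.smulRight c) w =
      ∑ j : Fin (k + 1), (-1 : ℝ) ^ (j : ℕ) * l (w j) * c (fun i => w (j.succAbove i)) := by
    intro c w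
    rw [ContinuousAlternatingMap.alternatizeUncurryFin_apply]
    refine Finset.sum_congr rfl fun i _ => ?_
    rw [← Int.cast_smul_eq_zsmul ℝ]
    simp only [ContinuousLinearMap.smulRight_apply, Int.cast_pow, Int.cast_neg, Int.cast_one,
      smul_eq_mul, mul_assoc]
    rfl
  rw [← hs, ← hs]
  refine congrArg (fun f : V [⋀^Fin (k + 1)]→ₗ[ℝ] ℝ => f w) (?_ :
    (ContinuousAlternatingMap.alternatizeUncurryFin (l.smulRight a)).toAlternatingMap =
    (ContinuousAlternatingMap.alternatizeUncurryFin (l.smulRight a')).toAlternatingMap)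
  refine b.ext_alternating fun v hv => ?_
  refine (hs a _).trans (Eq.trans ?_ (hs a' _).symm)
  refine Finset.sum_congr rfl fun j _ => ?_
  -- Among distinct basis vectors at most one, `b 0`, lies outside `ker l`. A term survives only if
  -- that vector is the one fed to `l`, and then all arguments of `a` are in the kernel.
  by_cases hj : v j = 0
  · rw [h]
    intro i
    refine hb _ fun h0 => ?_
    exact Fin.succAbove_ne j i (hv (h0.trans hj.symm))
  · simp [hb _ hj]

lemma integrable_unif {F : Finset E} {g : E → ℝ} (hg : Continuous g) : Integrable g (unif F) :=
  (memLp_of_continuous _ hg).integrable (by norm_num)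

lemma sum_mul_integral {ι : Type*} (s : Finset ι) {F : Finset E} {φ : E → ℝ} (hφ : Continuous φ)
    (a : ι → ℝ) {q : ι → E → ℝ} (hq : ∀ j, Continuous (q j)) :
    ∑ j ∈ s, a j * ∫ z, φ z * q j z ∂(unif F) = ∫ z, φ z * ∑ j ∈ s, a j * q j z ∂(unif F) := by
  have hc : ∀ j, Continuous (fun z => φ z * (a j * q j z)) := fun j =>
    hφ.mul (continuous_const.mul (hq j))
  simp only [Finset.mul_sum, ← integral_const_mul]
  rw [integral_finsetSum _ fun j _ => integrable_unif (hc j)]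
  exact Finset.sum_congr rfl fun j _ => by congr 1; ext x; ring

lemma avg_isTrace {T : Finset E} {k : ℕ} {α : E → Alt E k} {u : Form T k} (h : IsTrace T α u)
    (F : Face T) (φ : E → ℝ) (w : Fin k → tangent F.1) :
    avg F.1 φ w (u F) = ∫ x, φ x * α x (fun i => (w i : E)) ∂(unif F.1) := by
  refine integral_congr_ae ?_
  filter_upwards [h F] with x hx
  rw [hx]
  rfl

/-- The strong exterior derivative of a smooth form is its weak exterior derivative. -/
lemma IsTrace.isExtDeriv {T : Finset E} (hT : AffineIndependent ℝ ((↑) : T → E)) {k : ℕ}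
    {α : E → Alt E k} (hα : ContDiff ℝ ∞ α) {u : Form T k} {v : Form T (k + 1)}
    (hu : IsTrace T α u) (hv : IsTrace T (extDeriv α) v) : IsExtDeriv u v := by
  classical
  intro F φ hφ w c hc hw
  have hF : AffineIndependent ℝ ((↑) : F.1 → E) := hT.mono (Finset.coe_subset.2 F.2.2)
  obtain ⟨Λ, hΛ⟩ := exists_isBary hF
  -- The divergence theorem is applied to each `f j` in direction `w j`; the alternating sum of
  -- these derivatives is `φ dα + dφ ∧ α` evaluated on `w`.
  let f : Fin (k + 1) → E → ℝ := fun j x => φ x * α x (fun i => (w (j.succAbove i) : E))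
  have hαw : ∀ w : Fin k → E, ContDiff ℝ ∞ (fun x => α x w) := fun w =>
    (ContinuousAlternatingMap.apply ℝ E ℝ w).contDiff.comp hα
  have hf : ∀ j, ContDiff ℝ ∞ (f j) := fun j => hφ.mul (hαw _)
  have hst := fun j => integral_fderiv_unif hF (hc j) ((hf j).of_le (by simp : (1 : WithTop ℕ∞) ≤ ∞))
  simp only [hw] at hst
  have hcα : ∀ w : Fin k → E, Continuous (fun x => α x w) := fun w => (hαw w).continuous
  have hdφ : ∀ j, Continuous (fun x => fderiv ℝ φ x (w j : E)) := fun j =>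
    (hφ.continuous_fderiv (by simp)).clm_apply continuous_const
  have hdα : ∀ j, ∀ v : Fin k → E, Continuous (fun x => fderiv ℝ α x (w j : E) v) := fun j v =>
    (ContinuousAlternatingMap.apply ℝ E ℝ v).continuous.comp
      ((hα.continuous_fderiv (by simp)).clm_apply continuous_const)
  have hdf : ∀ j x, fderiv ℝ (f j) x (w j : E) =
      φ x * fderiv ℝ α x (w j : E) (fun i => (w (j.succAbove i) : E)) +
        fderiv ℝ φ x (w j : E) * α x (fun i => (w (j.succAbove i) : E)) := by
    intro j x
    have h1 : HasFDerivAt (fun x => α x (fun i => (w (j.succAbove i) : E)))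
        ((ContinuousAlternatingMap.apply ℝ E ℝ (fun i => (w (j.succAbove i) : E))).comp
          (fderiv ℝ α x)) x :=
      (ContinuousAlternatingMap.apply ℝ E ℝ (fun i => (w (j.succAbove i) : E))).hasFDerivAt.comp x
        ((hα.differentiable (by simp)) x).hasFDerivAt
    have h2 : HasFDerivAt (f j) _ x := ((hφ.differentiable (by simp)) x).hasFDerivAt.mul h1
    rw [h2.fderiv]
    simp [mul_comm]
  have lhs : avg F.1 φ w (v F) + ∑ j : Fin (k + 1), (-1 : ℝ) ^ (j : ℕ) *
      avg F.1 (fun x => fderiv ℝ φ x (w j : E)) (fun i => w (j.succAbove i)) (u F) =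
      ∑ j : Fin (k + 1), (-1 : ℝ) ^ (j : ℕ) * ∫ x, fderiv ℝ (f j) x (w j : E) ∂(unif F.1) := by
    rw [avg_isTrace hv]
    simp only [avg_isTrace hu, extDeriv_apply', hdf]
    rw [← sum_mul_integral _ hφ.continuous (fun j : Fin (k + 1) => (-1 : ℝ) ^ (j : ℕ))
      (fun j => hdα j _), ← Finset.sum_add_distrib]
    refine Finset.sum_congr rfl fun j _ => ?_
    have c1 : Continuous (fun x => φ x * fderiv ℝ α x (w j : E)
        (fun i => (w (j.succAbove i) : E))) := hφ.continuous.mul (hdα j _)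
    have c2 : Continuous (fun x => fderiv ℝ φ x (w j : E) *
        α x (fun i => (w (j.succAbove i) : E))) := (hdφ j).mul (hcα _)
    rw [integral_add (integrable_unif c1) (integrable_unif c2), mul_add]
  rw [lhs]
  simp only [hst]
  -- On a vertex the factor `dim F` kills the boundary terms, whose facets are empty.
  rcases Nat.eq_zero_or_pos (F.1.card - 1) with h0 | hpos
  · simp [h0]
  have key : ∀ x ∈ F.1, facetTerm u F φ w c x =
      ∑ j : Fin (k + 1), (-1 : ℝ) ^ (j : ℕ) * (c j x * ∫ z, f j z ∂(unif (F.1.erase x))) := by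
    intro x hx
    have hne : (F.1.erase x).Nonempty := by
      rw [← Finset.card_pos, Finset.card_erase_of_mem hx]; exact hpos
    unfold facetTerm
    rw [dif_pos hne]
    have ha : ∀ v : Fin k → tangent (F.1.erase x), avg (F.1.erase x) φ v
        (u ⟨F.1.erase x, hne, (F.1.erase_subset x).trans F.2.2⟩) =
        ∫ z, φ z * α z (fun i => (v i : E)) ∂(unif (F.1.erase x)) := fun v =>
      avg_isTrace hu ⟨F.1.erase x, hne, (F.1.erase_subset x).trans F.2.2⟩ φ v
    simp only [ha]
    -- `l` is the differential of the barycentric coordinate at `x`. Its kernel is tangent to the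
    -- opposite facet, where the orthogonal projection is the identity, so `sum_wedge_eq` removes
    -- the projection.
    let l : tangent F.1 →L[ℝ] ℝ := (Λ x).comp ((ContinuousLinearMap.inr ℝ ℝ E).comp
      (tangent F.1).subtypeL)
    have hl : ∀ j, c j x = l (w j) := by
      intro j
      rw [hΛ.coeff_eq (hc j) hx, hw]; rfl
    let P : tangent F.1 →L[ℝ] E := (tangent (F.1.erase x)).subtypeL.comp
      ((tangent (F.1.erase x)).orthogonalProjectionOnto.comp (tangent F.1).subtypeL)
    have hP : ∀ y : tangent F.1, l y = 0 → P y = y := by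
      intro y hy
      obtain ⟨h1, h2⟩ := hΛ.sum_tangent y.2
      rw [← Finset.add_sum_erase _ _ hx] at h1 h2
      have hy0 : Λ x (0, (y : E)) = 0 := hy
      rw [hy0, zero_add] at h1
      rw [hy0, zero_smul, zero_add] at h2
      have hm : (y : E) ∈ tangent (F.1.erase x) := by
        rw [← h2]; exact sum_smul_mem_tangent h1
      have := (tangent (F.1.erase x)).orthogonalProjectionOnto_mem_subspace_eq_self ⟨(y : E), hm⟩
      exact congrArg Subtype.val this
    have hpt : ∀ z, ∑ j : Fin (k + 1), (-1 : ℝ) ^ (j : ℕ) * c j x *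
        α z (fun i => P (w (j.succAbove i))) = ∑ j : Fin (k + 1), (-1 : ℝ) ^ (j : ℕ) * c j x *
        α z (fun i => (w (j.succAbove i) : E)) := by
      intro z
      simp only [hl]
      refine sum_wedge_eq l (a := (α z).compContinuousLinearMap P)
        (a' := (α z).compContinuousLinearMap (tangent F.1).subtypeL) (fun y hy => ?_) w
      simp only [ContinuousAlternatingMap.compContinuousLinearMap_apply]
      congr 1
      ext i
      exact hP _ (hy i)
    simp only [← mul_assoc]
    refine Eq.trans (sum_mul_integral _ hφ.continuous
      (fun j : Fin (k + 1) => (-1 : ℝ) ^ (j : ℕ) * c j x)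
      (q := fun j z => α z (fun i => P (w (j.succAbove i)))) fun j => hcα _) ?_
    rw [integral_congr_ae (Filter.Eventually.of_forall fun z => congrArg (fun s => φ z * s) (hpt z))]
    exact (sum_mul_integral _ hφ.continuous _ fun j => hcα _).symm
  rw [Finset.sum_congr rfl key, Finset.sum_comm, Finset.mul_sum]
  refine Finset.sum_congr rfl fun j _ => ?_
  rw [← Finset.mul_sum]; ring

/-! ### Forms adapted to a simplex -/

/-- The pullback of a form by the orthogonal projection onto the affine span of a simplex `T`
containing the point `o`. -/
def adapt (T : Finset E) (o : E) {k : ℕ} (α : E → Alt E k) (x : E) : Alt E k :=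
  (α ((tangent T).starProjection x + (o - (tangent T).starProjection o))).compContinuousLinearMap
    (tangent T).starProjection

lemma PolyMap.adapt {r k : ℕ} {α : E → Alt E k} (h : PolyMap r α) (T : Finset E) (o : E) :
    PolyMap r (adapt T o α) :=
  (h.comp_affine _ _).clm_comp
    (ContinuousAlternatingMap.compContinuousLinearMapCLM (tangent T).starProjection)

lemma sub_mem_tangent {T : Finset E} {x y : E} (hx : x ∈ affineSpan ℝ (T : Set E))
    (hy : y ∈ affineSpan ℝ (T : Set E)) : x - y ∈ tangent T := by
  rw [tangent, ← direction_affineSpan]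
  exact AffineSubspace.vsub_mem_direction hx hy

lemma add_mem_affineSpan {T : Finset E} {v o : E} (hv : v ∈ tangent T)
    (ho : o ∈ affineSpan ℝ (T : Set E)) : v + o ∈ affineSpan ℝ (T : Set E) := by
  refine AffineSubspace.vadd_mem_of_mem_direction ?_ ho
  rwa [direction_affineSpan]

lemma retract_mem {T : Finset E} {o : E} (ho : o ∈ affineSpan ℝ (T : Set E)) (x : E) :
    (tangent T).starProjection x + (o - (tangent T).starProjection o) ∈
      affineSpan ℝ (T : Set E) := by
  have h := add_mem_affineSpan (Submodule.starProjection_apply_mem (tangent T) (x - o)) ho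
  rw [map_sub] at h
  convert h using 1
  abel

lemma retract_eq {T : Finset E} {o : E} (ho : o ∈ affineSpan ℝ (T : Set E)) {x : E}
    (hx : x ∈ affineSpan ℝ (T : Set E)) :
    (tangent T).starProjection x + (o - (tangent T).starProjection o) = x := by
  have h := Submodule.starProjection_eq_self_iff.2 (sub_mem_tangent hx ho)
  rw [map_sub] at h
  rw [add_sub_left_comm, h]; abel

lemma adapt_apply {T : Finset E} {o : E} (ho : o ∈ affineSpan ℝ (T : Set E)) {k : ℕ}
    (α : E → Alt E k) {x : E} (hx : x ∈ affineSpan ℝ (T : Set E)) {w : Fin k → E}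
    (hw : ∀ i, w i ∈ tangent T) : adapt T o α x w = α x w := by
  simp only [adapt, retract_eq ho hx, ContinuousAlternatingMap.compContinuousLinearMap_apply]
  congr 1
  ext i
  exact Submodule.starProjection_eq_self_iff.2 (hw i)

lemma ae_unif_mem (F : Finset E) : ∀ᵐ x ∂(unif F), x ∈ affineSpan ℝ (F : Set E) := by
  filter_upwards [ae_cond_mem (F.finite_toSet.isCompact_convexHull ℝ).measurableSet] with x hx
  exact convexHull_subset_affineSpan _ hx

lemma IsTrace.congr {T : Finset E} {k : ℕ} {α β : E → Alt E k} {u : Form T k}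
    (h : IsTrace T α u) (hαβ : ∀ F : Face T, ∀ x ∈ affineSpan ℝ (F.1 : Set E),
      ∀ w : Fin k → E, (∀ i, w i ∈ tangent F.1) → α x w = β x w) : IsTrace T β u := by
  intro F
  filter_upwards [h F, ae_unif_mem F.1] with x hx hxF
  rw [hx]
  ext w
  exact hαβ F x hxF _ fun i => (w i).2

lemma IsTrace.adapt {T : Finset E} {o : E} (ho : o ∈ affineSpan ℝ (T : Set E)) {k : ℕ}
    {α : E → Alt E k} {u : Form T k} (h : IsTrace T α u) : IsTrace T (adapt T o α) u :=
  h.congr fun F _ hx _ hw => (adapt_apply ho α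
    (affineSpan_mono ℝ (Finset.coe_subset.2 F.2.2) hx) fun i => tangent_mono F.2.2 (hw i)).symm

/-- A polynomial form is determined on the affine span of a simplex by its trace. -/
lemma IsTrace.eq_of_eq {T : Finset E} (hT : AffineIndependent ℝ ((↑) : T → E)) {r s k : ℕ}
    {α β : E → Alt E k} (hα : PolyMap r α) (hβ : PolyMap s β) (hne : T.Nonempty)
    {u v : Form T k} (hu : IsTrace T α u) (hv : IsTrace T β v)
    (huv : u ⟨T, hne, subset_rfl⟩ = v ⟨T, hne, subset_rfl⟩) {x : E}
    (hx : x ∈ affineSpan ℝ (T : Set E)) {w : Fin k → E} (hw : ∀ i, w i ∈ tangent T) :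
    α x w = β x w := by
  have h1 : PolyMap (max r s) (fun x => (ContinuousAlternatingMap.compContinuousLinearMapCLM
      (tangent T).subtypeL (α x - β x) : Alt (tangent T) k)) :=
    ((hα.mono (le_max_left r s)).sub (hβ.mono (le_max_right r s))).clm_comp _
  have h2 := eq_zero_of_ae_unif hT h1.analyticOnNhd (by
    filter_upwards [hu ⟨T, hne, subset_rfl⟩, hv ⟨T, hne, subset_rfl⟩] with x h1 h2
    rw [huv, h2] at h1
    rw [map_sub]
    exact sub_eq_zero.2 h1.symm) hx
  have h3 := congrArg (fun f => f fun i => ⟨w i, hw i⟩) h2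
  exact sub_eq_zero.1 h3

lemma adapt_eq_zero {T : Finset E} {o : E} (ho : o ∈ affineSpan ℝ (T : Set E)) {k : ℕ}
    {α : E → Alt E k} (h : ∀ x ∈ affineSpan ℝ (T : Set E), ∀ w : Fin k → E,
      (∀ i, w i ∈ tangent T) → α x w = 0) (x : E) : adapt T o α x = 0 := by
  ext w
  exact h _ (retract_mem ho x) _ fun i => Submodule.starProjection_apply_mem _ _

lemma adapt_adapt {T : Finset E} {o : E} (ho : o ∈ affineSpan ℝ (T : Set E)) {k : ℕ}
    (α : E → Alt E k) : adapt T o (adapt T o α) = adapt T o α := by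
  ext x w
  exact adapt_apply ho α (retract_mem ho x) fun i => Submodule.starProjection_apply_mem _ _

lemma extDeriv_adapt {k : ℕ} (T : Finset E) (o : E) {α : E → Alt E k} (hα : Differentiable ℝ α) :
    extDeriv (adapt T o α) = adapt T o (extDeriv α) := by
  ext1 x
  have hf : ∀ x, fderiv ℝ (fun x => (tangent T).starProjection x +
      (o - (tangent T).starProjection o)) x = (tangent T).starProjection := fun x => by
    rw [fderiv_add_const]; exact ContinuousLinearMap.fderiv _
  have := extDeriv_pullback (r := ∞) (f := fun x => (tangent T).starProjection x +
      (o - (tangent T).starProjection o)) (x := x) (hα ((tangent T).starProjection x +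
      (o - (tangent T).starProjection o)))
      (((tangent T).starProjection.contDiff.add contDiff_const).contDiffAt) (by simp; exact WithTop.coe_le_coe.2 (le_top : (2 : ℕ∞) ≤ ⊤))
  simp only [hf] at this
  exact this

/-! ### Trimmed polynomial forms on the ambient space -/

section

variable {V : Type*} [NormedAddCommGroup V] [NormedSpace ℝ V]

/-- Polynomial forms of degree at most `r` whose Koszul contraction has degree at most `r`. -/
def IsTrimmed (r : ℕ) : {k : ℕ} → (V → V [⋀^Fin k]→L[ℝ] ℝ) → Prop
  | 0, α => PolyMap r α
  | _ + 1, α => PolyMap r α ∧ PolyMap r (koszul α)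

lemma IsTrimmed.polyMap {r k : ℕ} {α : V → V [⋀^Fin k]→L[ℝ] ℝ} (h : IsTrimmed r α) :
    PolyMap r α := by
  cases k with
  | zero => exact h
  | succ k => exact h.1

lemma IsTrimmed.of_polyMap [FiniteDimensional ℝ V] {r k : ℕ} {α : V → V [⋀^Fin k]→L[ℝ] ℝ}
    (hr : 1 ≤ r) (h : PolyMap (r - 1) α) : IsTrimmed r α := by
  cases k with
  | zero => exact h.mono (Nat.sub_le _ _)
  | succ k => exact ⟨h.mono (Nat.sub_le _ _), by simpa [Nat.sub_add_cancel hr] using h.koszul⟩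

lemma PolyMap.curryLeft {W : Type*} [NormedAddCommGroup W] [NormedSpace ℝ W] {r k : ℕ}
    {α : W → V [⋀^Fin (k + 1)]→L[ℝ] ℝ} (h : PolyMap r α) (o : V) :
    PolyMap r (fun x => (α x).curryLeft o) :=
  h.clm_comp (X := V [⋀^Fin (k + 1)]→L[ℝ] ℝ) (Y := V [⋀^Fin k]→L[ℝ] ℝ)
    ((ContinuousLinearMap.apply ℝ (V [⋀^Fin k]→L[ℝ] ℝ) o).comp
      (ContinuousAlternatingMap.curryLeftLI (𝕜 := ℝ) (E := V) (F := ℝ)).toContinuousLinearMap)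

end

lemma coe_cons {T : Finset E} {k : ℕ} (v : tangent T) (w : Fin k → tangent T) :
    (fun i => ((Fin.cons v w : Fin (k + 1) → tangent T) i : E)) =
      (Fin.cons (v : E) (fun i => (w i : E)) : Fin (k + 1) → E) := by
  ext i
  refine Fin.cases ?_ (fun i => ?_) i <;> simp

/-- The trimmed forms on `T` are the traces of the trimmed forms on the ambient space. -/
lemma mem_trimmed_of_isTrace {T : Finset E} {r k : ℕ} {α : E → Alt E k} (hα : IsTrimmed r α)
    {u : Form T k} (h : IsTrace T α u) : u ∈ trimmed r T k := by
  cases k with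
  | zero => exact mem_polyForms_iff.2 ⟨α, hα, h⟩
  | succ k =>
    refine ⟨mem_polyForms_iff.2 ⟨α, hα.1, h⟩, fun o _ => ?_⟩
    -- Contraction with `x - o` differs from `κ` by contraction with a constant vector, which does
    -- not raise the degree.
    have hp : PolyMap r (fun x => koszul α x - (α x).curryLeft o) := hα.2.sub (hα.1.curryLeft o)
    obtain ⟨v, hv⟩ := exists_isTrace T hp.continuous
    refine ⟨v, mem_polyForms_iff.2 ⟨_, hp, hv⟩, fun hT => ?_⟩
    filter_upwards [h ⟨T, hT, subset_rfl⟩, hv ⟨T, hT, subset_rfl⟩] with x h1 h2 hx w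
    rw [h1, h2, koszul, ← map_sub]
    simp only [ContinuousAlternatingMap.compContinuousLinearMap_apply]
    refine congrArg (α x) ?_
    exact (coe_cons ⟨x - o, hx⟩ w).symm

/-- Membership constrains a representative only along `T`, so an arbitrary polynomial representative
need not be trimmed on `E`. Pulling back by the orthogonal retraction onto the affine span turns
identities on `T` into identities on `E`. -/
lemma exists_isTrimmed_of_mem {T : Finset E} (hT : AffineIndependent ℝ ((↑) : T → E)) {o : E}
    (ho : o ∈ affineSpan ℝ (T : Set E)) {r k : ℕ} {u : Form T k} (hu : u ∈ trimmed r T k) :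
    ∃ α : E → Alt E k, IsTrimmed r α ∧ IsTrace T α u ∧ adapt T o α = α := by
  have hne : T.Nonempty := by rw [← Finset.coe_nonempty, ← affineSpan_nonempty ℝ]; exact ⟨o, ho⟩
  cases k with
  | zero =>
    obtain ⟨α, hα, h⟩ := mem_polyForms_iff.1 hu
    exact ⟨adapt T o α, hα.adapt T o, h.adapt ho, adapt_adapt ho α⟩
  | succ k =>
    obtain ⟨hu1, hu2⟩ := hu
    obtain ⟨α, hα, h⟩ := mem_polyForms_iff.1 hu1
    obtain ⟨v, hv, hκ⟩ := hu2 o ho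
    obtain ⟨β, hβ, hv⟩ := mem_polyForms_iff.1 hv
    refine ⟨adapt T o α, ⟨hα.adapt T o, ?_⟩, h.adapt ho, adapt_adapt ho α⟩
    have hp : PolyMap (r + 1) (fun x => koszul α x - (α x).curryLeft o) :=
      hα.koszul.sub ((hα.curryLeft o).mono (Nat.le_succ r))
    obtain ⟨v', hv'⟩ := exists_isTrace T hp.continuous
    have hvv : v ⟨T, hne, subset_rfl⟩ = v' ⟨T, hne, subset_rfl⟩ := by
      refine Lp.ext ?_
      filter_upwards [hκ hne, h ⟨T, hne, subset_rfl⟩, hv' ⟨T, hne, subset_rfl⟩, ae_unif_mem T]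
        with x h1 h2 h3 hx
      ext w
      rw [h1 (sub_mem_tangent hx ho) w, h2, h3, koszul, ← map_sub]
      simp only [ContinuousAlternatingMap.compContinuousLinearMap_apply]
      refine congrArg (α x) ?_
      exact coe_cons ⟨x - o, sub_mem_tangent hx ho⟩ w
    -- With `y` the retraction of `x`, the projection of `x` is `(y - o)` plus the projection of
    -- `o`. The first part gives the contraction known to have degree at most `r`; the second is
    -- constant.
    have e : koszul (adapt T o α) = fun x => adapt T o β x + (adapt T o α x).curryLeft o := by
      ext x w
      set y := (tangent T).starProjection x + (o - (tangent T).starProjection o) with hy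
      have h1 := hv.eq_of_eq hT hβ hp hne hv' hvv (retract_mem ho x)
        (w := fun i => (tangent T).starProjection (w i))
        (fun i => Submodule.starProjection_apply_mem _ _)
      have h2 : adapt T o β x w = (α y).curryLeft (y - o)
          (fun i => (tangent T).starProjection (w i)) := by
        rw [map_sub]; exact h1
      have h3 : ∀ z, (adapt T o α x).curryLeft z w = (α y).curryLeft ((tangent T).starProjection z)
          (fun i => (tangent T).starProjection (w i)) := by
        intro z
        change (α y) _ = (α y) _
        congr 1
        ext i
        refine Fin.cases ?_ (fun i => ?_) i <;> rfl
      rw [ContinuousAlternatingMap.add_apply, h2, koszul, h3, h3,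
        ← ContinuousAlternatingMap.add_apply, ← map_add]
      congr 2
      rw [hy]; abel
    rw [e]
    exact (hβ.adapt T o).add ((hα.adapt T o).curryLeft o)

lemma isTrace_zero (T : Finset E) (k : ℕ) :
    IsTrace T (fun _ : E => (0 : Alt E k)) (0 : Form T k) := by
  intro F
  filter_upwards [Lp.coeFn_zero (Alt (tangent F.1) k) 2 (unif F.1)] with x hx
  rw [Pi.zero_apply, hx]
  ext w; simp

/-- A closed trimmed form is the trace of a closed trimmed form on the ambient space. -/
lemma exists_closed_of_mem_trimmed {T : Finset E} (hT : AffineIndependent ℝ ((↑) : T → E))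
    (hne : T.Nonempty) {r k : ℕ} {u : Form T k} (hu : u ∈ trimmed r T k) (hd : IsExtDeriv u 0) :
    ∃ α : E → Alt E k, IsTrimmed r α ∧ IsTrace T α u ∧ ∀ x, extDeriv α x = 0 := by
  obtain ⟨o, ho⟩ := hne
  have ho' := mem_affineSpan ℝ (s := (T : Set E)) ho
  obtain ⟨α, hα, h, ha⟩ := exists_isTrimmed_of_mem hT ho' hu
  refine ⟨α, hα, h, ?_⟩
  obtain ⟨v, hv⟩ := exists_isTrace T hα.polyMap.extDeriv.continuous
  -- Uniqueness of the weak derivative makes the strong one vanish on `T`; being adapted to `T`, it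
  -- then vanishes on all of `E`.
  have hv0 : v = 0 := (h.isExtDeriv hT hα.polyMap.contDiff hv).unique hT hd
  rw [← ha, extDeriv_adapt T o hα.polyMap.differentiable]
  refine adapt_eq_zero ho' fun x hx w hw => ?_
  exact hv.eq_of_eq hT hα.polyMap.extDeriv (PolyMap.zero 0) ⟨o, ho⟩ (isTrace_zero T _) (by rw [hv0])
    hx hw

lemma const_of_extDeriv_eq_zero {V : Type*} [NormedAddCommGroup V] [NormedSpace ℝ V]
    {α : V → V [⋀^Fin 0]→L[ℝ] ℝ} (hα : Differentiable ℝ α) (h : ∀ x, extDeriv α x = 0) (x : V) :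
    α x = α 0 := by
  refine is_const_of_fderiv_eq_zero hα (fun x => ?_) x 0
  ext v w
  have h1 := congrArg (fun f => f fun _ => v) (h x)
  simp only [extDeriv_apply'] at h1
  simp at h1
  rw [Subsingleton.elim w fun _ => v]
  simpa using h1

lemma IsConst.isTrace {T : Finset E} {u : Form T 0} {a : ℝ} (h : IsConst u a) :
    IsTrace T (fun _ : E => ContinuousAlternatingMap.constOfIsEmpty ℝ E (Fin 0) a) u := by
  intro F
  filter_upwards [h F] with x hx
  ext w
  rw [hx w]; rfl

lemma extDeriv_const {V : Type*} [NormedAddCommGroup V] [NormedSpace ℝ V] {k : ℕ}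
    (c : V [⋀^Fin k]→L[ℝ] ℝ) : extDeriv (fun _ : V => c) = fun _ => 0 := by
  ext x w; simp [extDeriv_apply']

lemma IsConst.isExtDeriv {T : Finset E} (hT : AffineIndependent ℝ ((↑) : T → E)) {u : Form T 0}
    {a : ℝ} (h : IsConst u a) : IsExtDeriv u 0 :=
  h.isTrace.isExtDeriv hT contDiff_const (by rw [extDeriv_const]; exact isTrace_zero T 1)

/-- Closed trimmed forms have lower degree. -/
lemma mem_polyForms_of_closed {T : Finset E} (hT : AffineIndependent ℝ ((↑) : T → E))
    (hne : T.Nonempty) {r k : ℕ} (hr : 1 ≤ r) {u : Form T k} (hu : u ∈ trimmed r T k)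
    (hd : IsExtDeriv u 0) : u ∈ polyForms (r - 1) T k := by
  obtain ⟨α, hα, h, hd⟩ := exists_closed_of_mem_trimmed hT hne hu hd
  refine mem_polyForms_iff.2 ⟨α, ?_, h⟩
  cases k with
  | zero =>
    rw [funext (const_of_extDeriv_eq_zero hα.polyMap.differentiable hd)]
    exact PolyMap.const _ _
  | succ k =>
    obtain ⟨r, rfl⟩ := Nat.exists_eq_add_of_le' hr
    exact hα.1.lower hα.2 hd

lemma polyForms_le_trimmed {T : Finset E} {r k : ℕ} (hr : 1 ≤ r) :
    polyForms (r - 1) T k ≤ trimmed r T k := by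
  intro u hu
  obtain ⟨α, hα, h⟩ := mem_polyForms_iff.1 hu
  exact mem_trimmed_of_isTrace (IsTrimmed.of_polyMap hr hα) h

/-- The exterior derivative of a trimmed form has lower degree. -/
lemma exists_isExtDeriv_of_mem_trimmed {T : Finset E} (hT : AffineIndependent ℝ ((↑) : T → E))
    (hne : T.Nonempty) {r k : ℕ} {u : Form T k} (hu : u ∈ trimmed r T k) :
    ∃ v ∈ polyForms (r - 1) T (k + 1), IsExtDeriv u v ∧ IsExtDeriv v 0 := by
  obtain ⟨o, ho⟩ := hne
  obtain ⟨α, hα, h, -⟩ := exists_isTrimmed_of_mem hT (mem_affineSpan ℝ ho) hu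
  obtain ⟨v, hv⟩ := exists_isTrace T hα.polyMap.extDeriv.continuous
  refine ⟨v, mem_polyForms_iff.2 ⟨_, hα.polyMap.extDeriv, hv⟩,
    h.isExtDeriv hT hα.polyMap.contDiff hv, ?_⟩
  refine hv.isExtDeriv hT hα.polyMap.extDeriv.contDiff ?_
  rw [extDeriv_extDeriv hα.polyMap.contDiff (by simp; exact WithTop.coe_le_coe.2 (le_top : (2 : ℕ∞) ≤ ⊤))]
  exact isTrace_zero T _

/-- A closed trimmed form has one degree less, the primitive `κγ` regains that degree, and it is
trimmed because `κκγ = 0`. -/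
lemma locallyExact_trimmed {T : Finset E} (hT : AffineIndependent ℝ ((↑) : T → E))
    (hne : T.Nonempty) {r : ℕ} (hr : 1 ≤ r) : LocallyExact (trimmed r) T where
  exact_zero u := by
    constructor
    · rintro ⟨hu, hd⟩
      obtain ⟨α, hα, h, hd⟩ := exists_closed_of_mem_trimmed hT hne hu hd
      refine ⟨α 0 0, fun F => ?_⟩
      filter_upwards [h F] with x hx w
      rw [hx, const_of_extDeriv_eq_zero hα.polyMap.differentiable hd x]
      exact congrArg (α 0) (Subsingleton.elim _ _)
    · rintro ⟨a, ha⟩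
      exact ⟨mem_polyForms_iff.2 ⟨_, PolyMap.const _ _, ha.isTrace⟩, ha.isExtDeriv hT⟩
  exact_succ k v hv := by
    constructor
    · intro hd
      obtain ⟨α, hα, h, hd⟩ := exists_closed_of_mem_trimmed hT hne hv hd
      obtain ⟨s, rfl⟩ := Nat.exists_eq_add_of_le' hr
      obtain ⟨γ, hγ, hγα⟩ := (hα.1.lower hα.2 hd).poincare hd
      obtain ⟨u, hu⟩ := exists_isTrace T hγ.continuous
      have ht : IsTrimmed (s + 1) (koszul γ) := by
        cases k with
        | zero => exact hγ
        | succ k => exact ⟨hγ, by rw [funext (koszul_koszul γ)]; exact PolyMap.zero _⟩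
      refine ⟨u, mem_trimmed_of_isTrace ht hu, hu.isExtDeriv hT hγ.contDiff ?_⟩
      rw [funext hγα]; exact h
    · rintro ⟨u, hu, huv⟩
      obtain ⟨v', -, h1, h2⟩ := exists_isExtDeriv_of_mem_trimmed hT hne hu
      rwa [huv.unique hT h1]

/-! ### Conical forms -/

section

variable {V : Type*} [NormedAddCommGroup V] [NormedSpace ℝ V]

/-- A form annihilated by `z` descends to the quotient by the line of `z`; the induction peels off
one argument at a time. -/
lemma radial_invariant {z : V} : ∀ {k : ℕ} {f : V [⋀^Fin k]→L[ℝ] ℝ},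
    (∀ v i, v i = z → f v = 0) → ∀ (v : Fin k → V) (c : Fin k → ℝ),
      f (fun i => v i - c i • z) = f v
  | 0, f, _, v, c => congrArg f (Subsingleton.elim _ _)
  | k + 1, f, h, v, c => by
    have h1 : f (fun i => v i - c i • z) =
        f.curryLeft (v 0 - c 0 • z) (fun i => v i.succ - c i.succ • z) := by
      rw [ContinuousAlternatingMap.curryLeft_apply_apply]
      congr 1
      ext i
      refine Fin.cases ?_ (fun i => ?_) i <;> simp
    have h2 : f.curryLeft z = 0 := by
      ext w
      exact h _ 0 (by simp)
    rw [h1, map_sub, map_smul, h2, smul_zero, sub_zero,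
      radial_invariant (f := f.curryLeft (v 0)) fun w i hi => h _ i.succ (by simpa using hi)]
    rw [ContinuousAlternatingMap.curryLeft_apply_apply]
    congr 1
    ext i
    refine Fin.cases ?_ (fun i => ?_) i <;> simp

lemma radial_of_cons {z : V} {k : ℕ} {f : V [⋀^Fin (k + 1)]→L[ℝ] ℝ}
    (h : f.curryLeft z = 0) (v : Fin (k + 1) → V) (i : Fin (k + 1)) (hi : v i = z) : f v = 0 := by
  have key : ∀ v : Fin (k + 1) → V, v 0 = z → f v = 0 := fun v hv => by
    have := congrArg (fun g => g (fun i => v i.succ)) h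
    refine Eq.trans ?_ this
    change f v = f (Matrix.vecCons z _)
    congr 1
    ext i
    refine Fin.cases ?_ (fun i => ?_) i <;> simp [hv]
  by_cases h0 : (0 : Fin (k + 1)) = i
  · exact key v (h0 ▸ hi)
  · have h1 := f.toAlternatingMap.map_swap v h0
    have h2 := key (v ∘ Equiv.swap 0 i) (by simpa using hi)
    have h3 : f v = - f (v ∘ Equiv.swap 0 i) := by
      rw [eq_neg_iff_add_eq_zero, add_comm, ← eq_neg_iff_add_eq_zero]; exact h1
    rw [h3, h2, neg_zero]

/-- A homogeneous map that vanishes on the points of height one of a subspace of `ℝ × V` vanishes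
on the whole subspace. -/
lemma eq_zero_of_height_one {X : Type*} [NormedAddCommGroup X] [NormedSpace ℝ X] {j : ℕ}
    {G : ℝ × V → X} (hc : Continuous G) (hG : ∀ (t : ℝ) z, G (t • z) = t ^ j • G z)
    {S : Submodule ℝ (ℝ × V)} {p : ℝ × V} (hp : p ∈ S) (hp1 : p.1 = 1)
    (h : ∀ z ∈ S, z.1 = 1 → G z = 0) {z : ℝ × V} (hz : z ∈ S) : G z = 0 := by
  have key : ∀ z ∈ S, z.1 ≠ 0 → G z = 0 := fun z hz h1 => by
    have := hG z.1 (z.1⁻¹ • z)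
    rw [h _ (S.smul_mem _ hz) (by simp [h1]), smul_zero, smul_smul, mul_inv_cancel₀ h1,
      one_smul] at this
    exact this
  -- Points of nonzero height rescale to height one; a point of height zero is a limit of such
  -- points along `z + t • p`.
  by_cases h1 : z.1 = 0
  · have h2 : Continuous fun t : ℝ => G (z + t • p) := by fun_prop
    have h3 : ∀ t ∈ ({0}ᶜ : Set ℝ), G (z + t • p) = 0 := fun t ht =>
      key _ (S.add_mem hz (S.smul_mem _ hp)) (by simpa [h1, hp1] using ht)
    have h4 : (fun t : ℝ => G (z + t • p)) = fun _ => 0 :=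
      Continuous.ext_on (dense_compl_singleton (0 : ℝ)) h2 continuous_const h3
    simpa using congrFun h4 0
  · exact key z hz h1

end

section

variable {V : Type*} [NormedAddCommGroup V] [NormedSpace ℝ V] [FiniteDimensional ℝ V]

/-- The exterior product with the first coordinate of `ℝ × V`. -/
def wedgeFst (V : Type*) [NormedAddCommGroup V] [NormedSpace ℝ V] (k : ℕ) :
    ((ℝ × V) [⋀^Fin k]→L[ℝ] ℝ) →L[ℝ] ((ℝ × V) [⋀^Fin (k + 1)]→L[ℝ] ℝ) :=
  (ContinuousAlternatingMap.alternatizeUncurryFinCLM ℝ (ℝ × V) ℝ).comp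
    (ContinuousLinearMap.smulRightL ℝ (ℝ × V) ((ℝ × V) [⋀^Fin k]→L[ℝ] ℝ)
      (ContinuousLinearMap.fst ℝ ℝ V))

lemma wedgeFst_apply (k : ℕ) (f : (ℝ × V) [⋀^Fin k]→L[ℝ] ℝ) (v : Fin (k + 1) → ℝ × V) :
    wedgeFst V k f v = ∑ i : Fin (k + 1), (-1 : ℝ) ^ (i : ℕ) *
      ((v i).1 * f (fun j => v (i.succAbove j))) := by
  simp only [wedgeFst, ContinuousLinearMap.comp_apply,
    ContinuousAlternatingMap.alternatizeUncurryFinCLM_apply,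
    ContinuousAlternatingMap.alternatizeUncurryFin_apply]
  refine Finset.sum_congr rfl fun i _ => ?_
  simp only [ContinuousLinearMap.smulRightL_apply_apply, zsmul_eq_mul, Int.cast_pow, Int.cast_neg,
    Int.cast_one]
  rfl

/-- A trimmed form is the restriction to height one of a conical form. -/
lemma IsTrimmed.exists_cone_lift : ∀ {r k : ℕ} {α : V → V [⋀^Fin k]→L[ℝ] ℝ}, IsTrimmed r α →
    ∃ Ω : ℝ × V → (ℝ × V) [⋀^Fin k]→L[ℝ] ℝ, HomPoly r Ω ∧
      (∀ z v i, v i = z → Ω z v = 0) ∧ ∀ y w, Ω (1, y) (fun i => (0, w i)) = α y w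
  | r, 0, α, h => by
    obtain ⟨F, hF, hFα⟩ := PolyMap.exists_homogenization (show PolyMap r α from h)
    refine ⟨fun z => ContinuousAlternatingMap.compContinuousLinearMapCLM
      (ContinuousLinearMap.snd ℝ ℝ V) (F z), hF.clm_comp _, fun _ _ i => i.elim0, fun y w => ?_⟩
    rw [← hFα]; rfl
  | r, k + 1, α, h => by
    obtain ⟨F, hF, hFα⟩ := h.1.exists_homogenization
    obtain ⟨K, hK, hKα⟩ := h.2.exists_homogenization
    set P := ContinuousLinearMap.snd ℝ ℝ V
    -- With `s` the height, this is `F - ds ∧ K`, where `F` and `K` homogenize `α` and `κα`. At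
    -- height one, contraction with `(1, y)` gives `κα - κα + ds ∧ κκα = 0`. Both homogenizations
    -- can have the same degree `r` precisely because `α` is trimmed.
    set Ω : ℝ × V → (ℝ × V) [⋀^Fin (k + 1)]→L[ℝ] ℝ := fun z =>
      ContinuousAlternatingMap.compContinuousLinearMapCLM P (F z) +
        (-1 : ℝ) • wedgeFst V k (ContinuousAlternatingMap.compContinuousLinearMapCLM P (K z)) with hΩ
    have hh : HomPoly r Ω :=
      (hF.clm_comp _).add (((hK.clm_comp _).clm_comp (wedgeFst V k)).const_smul _)
    have happ : ∀ y (v : Fin (k + 1) → ℝ × V), Ω (1, y) v = α y (fun i => (v i).2) -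
        ∑ i : Fin (k + 1), (-1 : ℝ) ^ (i : ℕ) *
          ((v i).1 * koszul α y (fun j => (v (i.succAbove j)).2)) := fun y v => by
      rw [hΩ, ContinuousAlternatingMap.add_apply, ContinuousAlternatingMap.smul_apply,
        wedgeFst_apply, hFα, hKα, neg_one_smul, sub_eq_add_neg]
      rfl
    refine ⟨Ω, hh, fun z v i hi => radial_of_cons ?_ v i hi, fun y w => ?_⟩
    · change koszul Ω z = 0
      refine eq_zero_of_height_one (S := ⊤) (p := (1, 0)) hh.koszul.contDiff.continuous
        hh.koszul.homogeneous trivial rfl (fun z _ hz => ?_) trivial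
      obtain ⟨s, y⟩ := z
      obtain rfl : s = 1 := hz
      ext w
      rw [koszul_apply, happ, Fin.sum_univ_succ, Finset.sum_eq_zero]
      · have : (fun i => ((Fin.cons (1, y) w : Fin (k + 1) → ℝ × V) i).2) =
            (Fin.cons y (fun i => (w i).2) : Fin (k + 1) → V) := by
          ext i
          refine Fin.cases ?_ (fun i => ?_) i <;> simp
        rw [this]
        simp [koszul_apply]
      · intro i _
        cases k with
        | zero => exact i.elim0
        | succ k =>
          have h0 := congrArg (fun f => f fun j => (Fin.cons (α := fun _ => ℝ × V) (1, y) w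
            (i.succ.succAbove j.succ)).2) (koszul_koszul α y)
          rw [koszul_apply] at h0
          refine mul_eq_zero_of_right _ (mul_eq_zero_of_right _ (Eq.trans ?_ h0))
          congr 1
          ext j
          refine Fin.cases ?_ (fun j => ?_) j <;> simp
    · rw [happ]
      simp

end

/-! ### Extension of trimmed forms -/

lemma cone_mem {H : Finset E} {z : ℝ × E}
    (hz : z ∈ Submodule.span ℝ ((fun y => ((1 : ℝ), y)) '' (H : Set E))) {p : E} (hp : p ∈ H) :
    z.2 - z.1 • p ∈ tangent H := by
  induction hz using Submodule.span_induction with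
  | mem x hx =>
    obtain ⟨y, hy, rfl⟩ := hx
    simpa using sub_mem_tangent (mem_affineSpan ℝ hy) (mem_affineSpan ℝ (Finset.mem_coe.2 hp))
  | zero => simp
  | add x y _ _ hx hy =>
    have := add_mem hx hy
    convert this using 1
    simp only [Prod.snd_add, Prod.fst_add, add_smul]; abel
  | smul a x _ hx =>
    have := Submodule.smul_mem _ a hx
    convert this using 1
    simp [smul_sub, smul_smul]

/-- A conical form that vanishes at height one on the cone over a simplex vanishes on the cone. -/
lemma cone_form_eq_zero {H : Finset E} {r k : ℕ} {Ω : ℝ × E → (ℝ × E) [⋀^Fin k]→L[ℝ] ℝ}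
    (hr : 1 ≤ r) (hΩ : HomPoly r Ω) (hrad : ∀ z v i, v i = z → Ω z v = 0)
    (h : ∀ y ∈ affineSpan ℝ (H : Set E), ∀ w : Fin k → E, (∀ i, w i ∈ tangent H) →
      Ω (1, y) (fun i => (0, w i)) = 0) {z : ℝ × E} {v : Fin k → ℝ × E}
    (hz : z ∈ Submodule.span ℝ ((fun y => ((1 : ℝ), y)) '' (H : Set E)))
    (hv : ∀ i, v i ∈ Submodule.span ℝ ((fun y => ((1 : ℝ), y)) '' (H : Set E))) : Ω z v = 0 := by
  -- For empty `H` the cone is the origin, where `Ω` vanishes because its degree is positive. This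
  -- case occurs for disjoint faces.
  rcases H.eq_empty_or_nonempty with rfl | ⟨p, hp⟩
  · have h0 : z = 0 := by simpa using hz
    have := hΩ.homogeneous 0 0
    rw [zero_smul, zero_pow (by omega), zero_smul] at this
    rw [h0, this]; rfl
  · refine eq_zero_of_height_one (G := fun z => Ω z v) (j := r) (p := (1, p)) ?_ ?_
      (Submodule.subset_span (Set.mem_image_of_mem _ (Finset.mem_coe.2 hp))) rfl ?_ hz
    · exact (ContinuousAlternatingMap.apply ℝ (ℝ × E) ℝ v).continuous.comp hΩ.contDiff.continuous
    · intro t z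
      rw [hΩ.homogeneous]; rfl
    · rintro ⟨s, y⟩ hz hs
      obtain rfl : s = 1 := hs
      have h1 : y - p ∈ tangent H := by simpa using cone_mem hz hp
      change Ω (1, y) v = 0
      -- Subtracting multiples of the radial vector `(1, y)` makes all arguments horizontal.
      rw [← radial_invariant (hrad (1, y)) v fun i => (v i).1]
      have hy : y ∈ affineSpan ℝ (H : Set E) := by
        simpa using add_mem_affineSpan h1 (mem_affineSpan ℝ (Finset.mem_coe.2 hp))
      have h2 : (fun i => v i - (v i).1 • ((1 : ℝ), y)) =
          fun i => ((0 : ℝ), (v i).2 - (v i).1 • y) := by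
        ext i <;> simp
      rw [h2]
      refine h y hy _ fun i => ?_
      have := sub_mem (cone_mem (hv i) hp) (Submodule.smul_mem _ (v i).1 h1)
      convert this using 1
      rw [smul_sub]; abel

/-- The linear projection of `ℝ × E` onto the cone over the face `F`. -/
def coneProj (Λ : E → (ℝ × E →L[ℝ] ℝ)) (F : Finset E) : ℝ × E →L[ℝ] ℝ × E :=
  ∑ y ∈ F, (Λ y).smulRight ((1 : ℝ), y)

lemma coneProj_apply (Λ : E → (ℝ × E →L[ℝ] ℝ)) (F : Finset E) (z : ℝ × E) :
    coneProj Λ F z = ∑ y ∈ F, Λ y z • ((1 : ℝ), y) := by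
  simp [coneProj]

lemma IsBary.coneProj_eq {T : Finset E} {Λ : E → (ℝ × E →L[ℝ] ℝ)} (h : IsBary T Λ) {F : Finset E}
    (hF : F ⊆ T) {z : ℝ × E}
    (hz : z ∈ Submodule.span ℝ ((fun y => ((1 : ℝ), y)) '' (F : Set E))) : coneProj Λ F z = z := by
  rw [coneProj_apply, (h.mono hF).sum_eq hz]

/-- On the cone over `G` the coordinates at vertices outside `G` vanish, so only vertices of `F ∩ G`
contribute. -/
lemma IsBary.coneProj_mem [DecidableEq E] {T : Finset E} {Λ : E → (ℝ × E →L[ℝ] ℝ)}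
    (h : IsBary T Λ) {F G : Finset E} (hF : F ⊆ T) (hG : G ⊆ T) {z : ℝ × E}
    (hz : z ∈ Submodule.span ℝ ((fun y => ((1 : ℝ), y)) '' (G : Set E))) :
    coneProj Λ F z ∈
      Submodule.span ℝ ((fun y => ((1 : ℝ), y)) '' ((F ∩ G : Finset E) : Set E)) := by
  rw [coneProj_apply]
  refine Submodule.sum_mem _ fun y hy => ?_
  by_cases hyG : y ∈ G
  · exact Submodule.smul_mem _ _ (Submodule.subset_span (Set.mem_image_of_mem _
      (Finset.mem_coe.2 (Finset.mem_inter.2 ⟨hy, hyG⟩))))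
  · rw [h.eq_zero_of_notMem hG (hF hy) hyG hz, zero_smul]
    exact zero_mem _

/-- The pullback of a conical form by `x ↦ coneProj Λ F (1, x)`. -/
def coneForm (Λ : E → (ℝ × E →L[ℝ] ℝ)) (F : Finset E) {k : ℕ}
    (Ω : ℝ × E → (ℝ × E) [⋀^Fin k]→L[ℝ] ℝ) (x : E) : Alt E k :=
  (Ω (coneProj Λ F (1, x))).compContinuousLinearMap
    ((coneProj Λ F).comp (ContinuousLinearMap.inr ℝ ℝ E))

/-- The Koszul field is sent by the projection to `coneProj Λ F (1, x) - coneProj Λ F (1, 0)`. The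
first vector is radial and annihilates `Ω`, the second is constant, so contraction does not raise
the degree. -/
lemma isTrimmed_coneForm (Λ : E → (ℝ × E →L[ℝ] ℝ)) (F : Finset E) {r k : ℕ}
    {Ω : ℝ × E → (ℝ × E) [⋀^Fin k]→L[ℝ] ℝ} (hΩ : HomPoly r Ω)
    (hrad : ∀ z v i, v i = z → Ω z v = 0) : IsTrimmed r (coneForm Λ F Ω) := by
  have h1 : PolyMap r (fun x : E => Ω (coneProj Λ F (1, x))) := by
    have := ((hΩ.comp_clm (coneProj Λ F)).polyMap le_rfl).comp_affine
      (ContinuousLinearMap.inr ℝ ℝ E) ((1 : ℝ), (0 : E))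
    simpa using this
  have h2 := h1.clm_comp (ContinuousAlternatingMap.compContinuousLinearMapCLM
    ((coneProj Λ F).comp (ContinuousLinearMap.inr ℝ ℝ E)))
  cases k with
  | zero => exact h2
  | succ k =>
    refine ⟨h2, ?_⟩
    have h3 := (((h1.curryLeft (coneProj Λ F (1, 0))).const_smul (-1)).clm_comp
      (ContinuousAlternatingMap.compContinuousLinearMapCLM
        ((coneProj Λ F).comp (ContinuousLinearMap.inr ℝ ℝ E))))
    convert h3 using 1
    ext x w
    have e : coneProj Λ F (0, x) = coneProj Λ F (1, x) - coneProj Λ F (1, 0) := by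
      rw [← map_sub]; simp
    have e1 : koszul (coneForm Λ F Ω) x w = (Ω (coneProj Λ F (1, x))).curryLeft
        (coneProj Λ F (0, x)) (fun i => coneProj Λ F (0, w i)) := by
      change Ω _ _ = Ω _ _
      congr 1
      ext1 i
      refine Fin.cases ?_ (fun i => ?_) i <;> rfl
    have e2 : (Ω (coneProj Λ F (1, x))).curryLeft (coneProj Λ F (1, x)) = 0 := by
      ext w
      exact hrad _ _ 0 (by simp)
    rw [e1, e, map_sub, e2]
    simp
    rfl

/-- A trimmed form on a face that vanishes on the boundary of the face extends to a trimmed form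
vanishing on the faces that do not contain the given one. -/
lemma exists_bubble_extension {T : Finset E} (hT : AffineIndependent ℝ ((↑) : T → E)) {r k : ℕ}
    (hr : 1 ≤ r) (F : Face T) {u : Form F.1 k} (hu : u ∈ bdryZero (trimmed r) F.1 k) :
    ∃ v ∈ trimmed r T k, v F = u ⟨F.1, F.2.1, subset_rfl⟩ ∧ ∀ G : Face T, ¬ F.1 ⊆ G.1 → v G = 0 := by
  classical
  obtain ⟨F, hne, hF⟩ := F
  have hF' : AffineIndependent ℝ ((↑) : F → E) := hT.mono (Finset.coe_subset.2 hF)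
  obtain ⟨o, ho⟩ := id hne
  obtain ⟨α, hα, hαu, -⟩ := exists_isTrimmed_of_mem hF' (mem_affineSpan ℝ ho) hu.1
  obtain ⟨Ω, hΩ, hrad, hΩα⟩ := hα.exists_cone_lift
  obtain ⟨Λ, hΛ⟩ := exists_isBary hT
  have ht := isTrimmed_coneForm Λ F hΩ hrad
  obtain ⟨v, hv⟩ := exists_isTrace T ht.polyMap.continuous
  refine ⟨v, mem_trimmed_of_isTrace ht hv, ?_, ?_⟩
  · refine Lp.ext ?_
    filter_upwards [hv ⟨F, hne, hF⟩, hαu ⟨F, hne, subset_rfl⟩, ae_unif_mem F] with x h1 h2 hx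
    rw [h1, h2]
    ext w
    have e : ∀ i, coneProj Λ F (0, (w i : E)) = (0, (w i : E)) := fun i =>
      hΛ.coneProj_eq hF (tangent_mem_cone (w i).2)
    change Ω (coneProj Λ F (1, x)) (fun i => coneProj Λ F (0, (w i : E))) = α x (fun i => w i)
    simp only [e, hΛ.coneProj_eq hF (affineSpan_mem_cone hx), hΩα]
  · rintro ⟨G, hGne, hG⟩ hFG
    refine Lp.ext ?_
    filter_upwards [hv ⟨G, hGne, hG⟩, isTrace_zero T k ⟨G, hGne, hG⟩, ae_unif_mem G] with x h1 h2 hx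
    rw [Pi.zero_apply] at h2
    rw [h1, h2]
    ext w
    change Ω (coneProj Λ F (1, x)) (fun i => coneProj Λ F (0, (w i : E))) = 0
    -- The cone over `G` is projected into the cone over `F ∩ G`, a proper face of `F` or empty, on
    -- which `u` vanishes.
    refine cone_form_eq_zero (H := F ∩ G) hr hΩ hrad (fun y hy w hw => ?_)
      (hΛ.coneProj_mem hF hG (affineSpan_mem_cone hx))
      (fun i => hΛ.coneProj_mem hF hG (tangent_mem_cone (w i).2))
    have hH : (F ∩ G).Nonempty := by
      rw [← Finset.coe_nonempty, ← affineSpan_nonempty ℝ]; exact ⟨y, hy⟩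
    have hH' : (⟨F ∩ G, hH, Finset.inter_subset_left⟩ : Face F).1 ≠ F := fun h =>
      hFG (Finset.inter_eq_left.1 h)
    rw [hΩα]
    exact (hαu.pull Finset.inter_subset_left).eq_of_eq
      (hF'.mono (Finset.coe_subset.2 Finset.inter_subset_left)) hα.polyMap (PolyMap.zero 0) hH
      (isTrace_zero (F ∩ G) k) (hu.2 _ hH') hy hw

/-- A `Form` records its pullbacks to all faces, so compatible boundary data amount to one form `g`
whose component on `T` is irrelevant. -/
lemma admitsExtensions_iff {A : FormSystem E} {T : Finset E} {k : ℕ} :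
    AdmitsExtensions A T k ↔ ∀ g : Form T k, (∀ F : Face T, F.1 ≠ T → pull F.2.2 k g ∈ A F.1 k) →
      ∃ u ∈ A T k, ∀ F : Face T, F.1 ≠ T → u F = g F := by
  classical
  constructor
  · intro h g hg
    obtain ⟨u, hu, hug⟩ := h (fun F => pull F.2.2.subset k g)
      (fun F => hg ⟨F.1, F.2.1, F.2.2.subset⟩ F.2.2.ne) (fun F G hFG => rfl)
    refine ⟨u, hu, fun F hF => ?_⟩
    exact congrFun (hug ⟨F.1, F.2.1, F.2.2.ssubset_of_ne hF⟩) ⟨F.1, F.2.1, subset_rfl⟩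
  · intro h b hb hbb
    obtain ⟨u, hu, hug⟩ := h (fun F => if hF : F.1 ≠ T then
      b ⟨F.1, F.2.1, F.2.2.ssubset_of_ne hF⟩ ⟨F.1, F.2.1, subset_rfl⟩ else 0) (fun F hF => by
        convert hb ⟨F.1, F.2.1, F.2.2.ssubset_of_ne hF⟩ using 1
        ext1 G
        have hG : G.1 ≠ T := (G.2.2.trans_ssubset (F.2.2.ssubset_of_ne hF)).ne
        change dite _ _ _ = _
        rw [dif_pos hG]
        exact (congrFun (hbb ⟨F.1, F.2.1, F.2.2.ssubset_of_ne hF⟩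
          ⟨G.1, G.2.1, (G.2.2.trans F.2.2).ssubset_of_ne hG⟩ G.2.2) ⟨G.1, G.2.1, subset_rfl⟩).symm)
    refine ⟨u, hu, fun F => ?_⟩
    ext1 G
    have hG : G.1 ≠ T := (G.2.2.trans_ssubset F.2.2).ne
    have := hug ⟨G.1, G.2.1, G.2.2.trans F.2.2.subset⟩ hG
    rw [dif_pos hG] at this
    refine Eq.trans this ?_
    exact (congrFun (hbb F ⟨G.1, G.2.1, (G.2.2.trans F.2.2.subset).ssubset_of_ne hG⟩ G.2.2)
      ⟨G.1, G.2.1, subset_rfl⟩).symm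

lemma pull_mem_trimmed {T F : Finset E} (hT : AffineIndependent ℝ ((↑) : T → E)) (hne : T.Nonempty)
    (h : F ⊆ T) {r k : ℕ} {u : Form T k} (hu : u ∈ trimmed r T k) : pull h k u ∈ trimmed r F k := by
  obtain ⟨o, ho⟩ := hne
  obtain ⟨α, hα, hαu, -⟩ := exists_isTrimmed_of_mem hT (mem_affineSpan ℝ ho) hu
  exact mem_trimmed_of_isTrace hα (hαu.pull h)

/-- The data are matched face by face, on growing sets of faces closed under passing to subfaces.
The error on a newly added maximal face vanishes on its boundary, and its extension by
`exists_bubble_extension` does not disturb the faces already treated. -/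
lemma admitsExtensions_trimmed {T : Finset E} (hT : AffineIndependent ℝ ((↑) : T → E))
    (hne : T.Nonempty) {r : ℕ} (hr : 1 ≤ r) (k : ℕ) : AdmitsExtensions (trimmed r) T k := by
  classical
  refine admitsExtensions_iff.2 fun g hg => ?_
  suffices H : ∀ n, ∀ L : Finset (Finset E), L.card = n → (∀ F ∈ L, F.Nonempty ∧ F ⊂ T) →
      (∀ F ∈ L, ∀ G ⊆ F, G.Nonempty → G ∈ L) →
      ∃ u ∈ trimmed r T k, ∀ F : Face T, F.1 ∈ L → u F = g F by
    obtain ⟨u, hu, h⟩ := H _ (T.ssubsets.filter Finset.Nonempty) rfl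
      (fun F hF => by simpa [and_comm] using hF) (fun F hF G hG hGne => by
        simp only [Finset.mem_filter, Finset.mem_ssubsets] at hF ⊢
        exact ⟨hG.trans_ssubset hF.1, hGne⟩)
    exact ⟨u, hu, fun F hF => h F (by simp [F.2.2.ssubset_of_ne hF, F.2.1])⟩
  intro n
  induction n with
  | zero =>
    intro L hL _ _
    rw [Finset.card_eq_zero] at hL
    exact ⟨0, zero_mem _, by simp [hL]⟩
  | succ n ih =>
    intro L hL hsub hdown
    obtain ⟨F, hFL, hF⟩ := L.exists_max_image Finset.card (Finset.card_pos.1 (by omega))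
    have hmax : ∀ G ∈ L, F ⊆ G → G = F := fun G hG h => (Finset.eq_of_subset_of_card_le h (hF G hG)).symm
    obtain ⟨u, hu, hug⟩ := ih (L.erase F) (by rw [Finset.card_erase_of_mem hFL, hL]; rfl)
      (fun G hG => hsub G (Finset.mem_of_mem_erase hG)) (fun G hG H hH hHne =>
        Finset.mem_erase.2 ⟨fun h => (Finset.mem_erase.1 hG).1
          (hmax G (Finset.mem_of_mem_erase hG) (h ▸ hH)),
          hdown G (Finset.mem_of_mem_erase hG) H hH hHne⟩)
    obtain ⟨hFne, hFT⟩ := hsub F hFL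
    set F' : Face T := ⟨F, hFne, hFT.subset⟩
    obtain ⟨v, hv, hvF, hv0⟩ := exists_bubble_extension hT hr F'
      (u := pull F'.2.2 k g - pull F'.2.2 k u)
      ⟨sub_mem (hg F' hFT.ne) (pull_mem_trimmed hT hne _ hu), fun G hG => by
        have : u ⟨G.1, G.2.1, G.2.2.trans hFT.subset⟩ = g ⟨G.1, G.2.1, G.2.2.trans hFT.subset⟩ :=
          hug _ (Finset.mem_erase.2 ⟨hG, hdown F hFL _ G.2.2 G.2.1⟩)
        exact sub_eq_zero.2 this.symm⟩
    refine ⟨u + v, add_mem hu hv, fun G hG => ?_⟩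
    rw [Pi.add_apply]
    by_cases hGF : F ⊆ G.1
    · obtain rfl : G = F' := Subtype.ext (hmax _ hG hGF)
      rw [hvF]
      exact add_sub_cancel _ _
    · rw [hv0 G hGF, add_zero]
      exact hug G (Finset.mem_erase.2 ⟨fun h => hGF h.ge, hG⟩)

lemma isCompatibleFES_trimmed (K : Geometry.SimplicialComplex ℝ E) {r : ℕ} (hr : 1 ≤ r) :
    IsCompatibleFES K (trimmed r) where
  finite T _ k := by
    have h : trimmed r T k ≤ polyForms r T k := by
      cases k with
      | zero => exact le_rfl
      | succ k => exact fun u hu => hu.1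
    exact Submodule.finiteDimensional_of_le h
  le_sobolev T hT k u hu := by
    obtain ⟨v, -, hv, -⟩ := exists_isExtDeriv_of_mem_trimmed (K.indep hT)
      (K.nonempty_of_mem_faces hT) hu
    exact ⟨v, hv⟩
  extDeriv_mem T hT k u hu := by
    obtain ⟨v, hv, h, -⟩ := exists_isExtDeriv_of_mem_trimmed (K.indep hT)
      (K.nonempty_of_mem_faces hT) hu
    exact ⟨v, polyForms_le_trimmed hr hv, h⟩
  pull_mem T hT F _ h k u hu := pull_mem_trimmed (K.indep hT) (K.nonempty_of_mem_faces hT) h hu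
  extensions T hT k := admitsExtensions_trimmed (K.indep hT) (K.nonempty_of_mem_faces hT) hr k
  locallyExact T hT := locallyExact_trimmed (K.indep hT) (K.nonempty_of_mem_faces hT) hr

/-! ### Integration and Stokes' theorem -/

lemma finrank_tangent {F : Finset E} (hF : AffineIndependent ℝ ((↑) : F → E)) {n : ℕ}
    (hn : F.card = n + 1) : Module.finrank ℝ (tangent F) = n := by
  have := hF.finrank_vectorSpan (n := n) (by simpa using hn)
  rwa [show Set.range ((↑) : F → E) = (F : Set E) by ext; simp] at this

lemma l2Form_eq_zero {F : Finset E} (hF : AffineIndependent ℝ ((↑) : F → E)) (hne : F.Nonempty)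
    {k : ℕ} (hk : F.card ≤ k) (u : L2Form F k) : u = 0 := by
  refine ae_eq_zero_of_apply fun w => Filter.Eventually.of_forall fun x => ?_
  refine (u x).toAlternatingMap.map_linearDependent w fun h => ?_
  have h1 := h.fintype_card_le_finrank
  have h2 := hne.card_pos
  rw [finrank_tangent hF (n := F.card - 1) (by omega), Fintype.card_fin] at h1
  omega

lemma form_eq_zero {T : Finset E} (hT : AffineIndependent ℝ ((↑) : T → E)) {k : ℕ}
    (hk : T.card ≤ k) (u : Form T k) : u = 0 := by
  ext1 F
  exact l2Form_eq_zero (hT.mono (Finset.coe_subset.2 F.2.2)) F.2.1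
    ((Finset.card_le_card F.2.2).trans hk) _

lemma integral_apply_eq_avg {F : Finset E} {k : ℕ} (u : L2Form F k) (w : Fin k → tangent F) :
    (∫ x, u x ∂(unif F)) w = avg F (fun _ => 1) w u := by
  have h := ContinuousLinearMap.integral_comp_comm
    (ContinuousAlternatingMap.apply ℝ (tangent F) ℝ w : Alt (tangent F) k →L[ℝ] ℝ)
    ((Lp.memLp u).integrable (by norm_num))
  simp only [avg, one_mul]
  exact h.symm

/-- The mean of a form of top degree is an alternating form of top degree on the tangent space,
hence zero as soon as it vanishes on one basis. This removes the arbitrary enumeration of the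
vertices. -/
lemma integralForm_eq_zero_iff {T : Finset E} (hT : AffineIndependent ℝ ((↑) : T → E)) {k : ℕ}
    (hk : T.card = k + 1) (hne : T.Nonempty) (u : Form T k) :
    integralForm T u = 0 ↔ ∀ w, avg T (fun _ => 1) w (u ⟨T, hne, subset_rfl⟩) = 0 := by
  rw [integralForm, dif_pos hk, mul_eq_zero_iff_left (by positivity)]
  refine ⟨fun h w => ?_, fun h => h _⟩
  rw [← integral_apply_eq_avg] at h ⊢
  set e := T.equivFinOfCardEq hk
  have hli : LinearIndependent ℝ (fun i : Fin k => (⟨(e.symm i.succ : E) - e.symm 0,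
      vsub_mem_vectorSpan ℝ (Subtype.prop _) (Subtype.prop _)⟩ : tangent T)) := by
    refine LinearIndependent.of_comp (tangent T).subtype ?_
    have h1 := (affineIndependent_iff_linearIndependent_vsub ℝ _ (0 : Fin (k + 1))).1
      (hT.comp_embedding e.symm.toEmbedding)
    exact h1.comp (fun i : Fin k => (⟨i.succ, Fin.succ_ne_zero i⟩ : {x : Fin (k + 1) // x ≠ 0}))
      fun i j hij => by simpa using hij
  set b := basisOfLinearIndependentOfCardEqFinrank' _ hli (by
    rw [finrank_tangent hT hk, Fintype.card_fin])
  have h2 := (AlternatingMap.map_basis_eq_zero_iff b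
    (∫ x, u ⟨T, hne, subset_rfl⟩ x ∂(unif T)).toAlternatingMap).1 (by
      rw [coe_basisOfLinearIndependentOfCardEqFinrank']; exact h)
  exact congrArg (fun f => f w) h2

-- Stokes' theorem: in Green's formula on `T` with `φ = 1`, only the facet opposite to `x`
-- contributes, with the nonzero factor `dim T`.
open scoped Classical in
lemma integralForm_erase_eq_zero {T : Finset E}
    (hT : AffineIndependent ℝ ((↑) : T → E))
    {k : ℕ} (hk : T.card = k + 2) {x : E} (hx : x ∈ T) {w : Form T k} {z : Form T (k + 1)}
    (hwz : IsExtDeriv w z) (hw : ∀ F : Face T, ∀ y ∈ T, y ≠ x → F.1 = T.erase y → w F = 0)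
    (hz : integralForm T z = 0) : integralForm (T.erase x) (pull (T.erase_subset x) k w) = 0 := by
  have hcard : (T.erase x).card = k + 1 := by rw [Finset.card_erase_of_mem hx, hk]; rfl
  have hGne : (T.erase x).Nonempty := Finset.card_pos.1 (by omega)
  have hTne : T.Nonempty := ⟨x, hx⟩
  have hG := hT.mono (Finset.coe_subset.2 (T.erase_subset x))
  rw [integralForm_eq_zero_iff hG hcard hGne]
  rw [integralForm_eq_zero_iff hT hk hTne] at hz
  intro v
  obtain ⟨Λ, hΛ⟩ := exists_isBary hT
  obtain ⟨p, hp⟩ := id hGne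
  have hpT := Finset.mem_of_mem_erase hp
  have htan : tangent (T.erase x) ≤ tangent T := tangent_mono (T.erase_subset x)
  -- The barycentric coordinate at `x` increases by one along `x - p` and is constant along the
  -- other vectors, so only the index `j = 0` survives on the facet.
  set W : Fin (k + 1) → tangent T := Fin.cons ⟨x - p, sub_mem_tangent (mem_affineSpan ℝ hx)
    (mem_affineSpan ℝ (Finset.mem_coe.2 hpT))⟩ (fun i => ⟨v i, htan (v i).2⟩) with hW
  have h := hwz ⟨T, hTne, subset_rfl⟩ (fun _ => 1) contDiff_const W (fun j y => Λ y (0, W j))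
    (fun j => (hΛ.sum_tangent (W j).2).1) (fun j => (hΛ.sum_tangent (W j).2).2)
  have h0 : ∀ j, avg T (fun y => fderiv ℝ (fun _ : E => (1 : ℝ)) y (W j : E))
      (fun i => W (j.succAbove i)) (w ⟨T, hTne, subset_rfl⟩) = 0 := fun j => by
    simp [avg]
  simp only [h0, hz, mul_zero, Finset.sum_const_zero, add_zero] at h
  rw [eq_comm, neg_mul, neg_eq_zero, mul_eq_zero_iff_left (by rw [hk]; exact Nat.cast_ne_zero.2 (by omega)),
    Finset.sum_eq_single x] at h
  · simp only [facetTerm, dif_pos hGne] at h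
    rw [Fin.sum_univ_succ, Finset.sum_eq_zero, add_zero] at h
    · have h1 : Λ x (0, (W 0 : E)) = 1 := by
        have : ((0 : ℝ), (W 0 : E)) = (1, x) - (1, p) := by simp [hW]
        rw [this, map_sub, hΛ.1 x hx, hΛ.2 x hx p hpT (Finset.ne_of_mem_erase hp).symm, sub_zero]
      have h2 : (fun i => (tangent (T.erase x)).orthogonalProjectionOnto
          (W (Fin.succAbove 0 i) : E)) = v := by
        ext1 i
        rw [Fin.succAbove_zero, hW, Fin.cons_succ]
        exact Submodule.orthogonalProjectionOnto_mem_subspace_eq_self _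
      rw [h1, h2] at h
      have h3 : avg (T.erase x) (fun _ => 1) v
          (w ⟨T.erase x, hGne, T.erase_subset x⟩) = 0 := by simpa using h
      exact h3
    · intro i _
      have h1 : Λ x (0, (W i.succ : E)) = 0 := by
        rw [hW, Fin.cons_succ]
        exact hΛ.eq_zero_of_notMem (T.erase_subset x) hx (by simp) (tangent_mem_cone (v i).2)
      rw [h1]; ring
  · intro y hy hyx
    rw [facetTerm]
    split_ifs with hy'
    · refine Finset.sum_eq_zero fun j _ => ?_
      rw [hw _ y hy hyx rfl, avg_zero, mul_zero]
    · rfl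
  · exact fun hx' => absurd hx hx'

/-! ### Exactness with partial boundary conditions -/

section

variable {K : Geometry.SimplicialComplex ℝ E} {B : FormSystem E}

lemma face_mem {T : Finset E} (hT : T ∈ K.faces) (F : Face T) : F.1 ∈ K.faces :=
  K.down_closed hT F.2.2 F.2.1

/-- Data given on a subcomplex of `T` extend to `T`. -/
lemma IsCompatibleFES.exists_extension (hB : IsCompatibleFES K B) {T : Finset E}
    (hT : T ∈ K.faces) {k : ℕ} (P : Finset E → Prop) (hP : ∀ F G : Face T, F.1 ⊆ G.1 → P G.1 → P F.1)
    (g : Form T k) (hg : ∀ F : Face T, P F.1 → pull F.2.2 k g ∈ B F.1 k) :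
    ∃ u ∈ B T k, ∀ F : Face T, P F.1 → u F = g F := by
  classical
  induction hn : (T.powerset.filter fun F => F.Nonempty ∧ ¬ P F).card generalizing P g with
  | zero =>
    rw [Finset.card_eq_zero, Finset.filter_eq_empty_iff] at hn
    have hTne := K.nonempty_of_mem_faces hT
    have h : P T := by
      have := hn (x := T) (by simp)
      tauto
    exact ⟨g, hg ⟨T, hTne, subset_rfl⟩ h, fun _ _ => rfl⟩
  | succ n ih =>
    -- All proper faces of a smallest missing face already carry data, so the extension property
    -- applies there and one more face is covered.
    obtain ⟨F, hF, hmin⟩ := Finset.exists_min_image _ Finset.card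
      (Finset.card_pos.1 (by omega : 0 < (T.powerset.filter fun F => F.Nonempty ∧ ¬ P F).card))
    simp only [Finset.mem_filter, Finset.mem_powerset] at hF hmin
    obtain ⟨hFT, hFne, hPF⟩ := hF
    have hsub : ∀ G, G.Nonempty → G ⊂ F → P G := fun G hG hGF => by
      by_contra h
      exact absurd (hmin G ⟨hGF.subset.trans hFT, hG, h⟩) (not_le.2 (Finset.card_lt_card hGF))
    set F' : Face T := ⟨F, hFne, hFT⟩
    obtain ⟨v, hv, hvg⟩ := admitsExtensions_iff.1 (hB.extensions F (face_mem hT F') k)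
      (pull hFT k g) fun G hG => hg ⟨G.1, G.2.1, G.2.2.trans hFT⟩
        (hsub G.1 G.2.1 (G.2.2.ssubset_of_ne hG))
    set g' : Form T k := Function.update g F' (v ⟨F, hFne, subset_rfl⟩)
    have hg' : ∀ G : Face T, G.1 ≠ F → g' G = g G := fun G hG =>
      Function.update_of_ne (fun h => hG (congrArg Subtype.val h)) _ _
    obtain ⟨u, hu, hug⟩ := ih (fun G => P G ∨ G = F) (fun G H hGH h => by
        rcases h with h | h
        · exact Or.inl (hP G H hGH h)
        · by_cases hGF : G.1 = F
          · exact Or.inr hGF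
          · exact Or.inl (hsub _ G.2.1 ((hGH.trans h.le).ssubset_of_ne hGF))) g' (fun G hG => by
        by_cases hGF : G = F'
        · subst hGF
          convert hv using 1
          ext1 H
          by_cases hH : H.1 = F
          · obtain rfl : H = ⟨F, hFne, subset_rfl⟩ := Subtype.ext hH
            exact Function.update_self _ _ _
          · exact (hg' ⟨H.1, H.2.1, H.2.2.trans hFT⟩ hH).trans (hvg H hH).symm
        · have hGF' : G.1 ≠ F := fun h => hGF (Subtype.ext h)
          have hPG := hG.resolve_right hGF'
          convert hg G hPG using 1
          ext1 H
          refine hg' ⟨H.1, H.2.1, H.2.2.trans G.2.2⟩ fun h => hPF ?_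
          exact hP F' G (h.symm.subset.trans H.2.2) hPG) (by
        refine Eq.trans (congrArg Finset.card (?_ : _ =
          (T.powerset.filter fun G => G.Nonempty ∧ ¬ P G).erase F)) ?_
        · ext G
          simp only [Finset.mem_filter, Finset.mem_erase]
          tauto
        · rw [Finset.card_erase_of_mem (by simp [hFT, hFne, hPF]), hn]
          rfl)
    refine ⟨u, hu, fun G hG => (hug G (Or.inl hG)).trans (hg' G fun h => hPF (h ▸ hG))⟩

/-- The forms vanishing on the faces that do not contain `S`. -/
def VanishesOff (S : Finset E) {T : Finset E} {k : ℕ} (u : Form T k) : Prop :=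
  ∀ F : Face T, ¬ S ⊆ F.1 → u F = 0

open scoped Classical in
lemma VanishesOff.integralForm_erase_eq_zero {T : Finset E}
    (hT : AffineIndependent ℝ ((↑) : T → E)) {k : ℕ} (hk : T.card = k + 2) {x : E} (hx : x ∈ T)
    {w : Form T k} (hw : VanishesOff (T.erase x) w) {z : Form T (k + 1)} (hwz : IsExtDeriv w z)
    (hz : integralForm T z = 0) : integralForm (T.erase x) (FES.pull (T.erase_subset x) k w) = 0 := by
  refine FES.integralForm_erase_eq_zero hT hk hx hwz (fun F y hy hyx hF => hw F fun h => ?_) hz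
  rw [hF] at h
  exact Finset.notMem_erase y T (h (Finset.mem_erase.2 ⟨hyx, hy⟩))

lemma VanishesOff.pull {S T G : Finset E} {k : ℕ} {u : Form T k} (h : VanishesOff S u)
    (hG : G ⊆ T) : VanishesOff S (pull hG k u) :=
  fun F hF => h ⟨F.1, F.2.1, F.2.2.trans hG⟩ hF

/-- The extension by zero of a form on a face. -/
def extendZero (T : Finset E) {G : Finset E} {k : ℕ} (y : Form G k) : Form T k :=
  open scoped Classical in
  fun F => if h : F.1 ⊆ G then y ⟨F.1, F.2.1, h⟩ else 0

lemma extendZero_of_subset {T G : Finset E} {k : ℕ} (y : Form G k) {F : Face T} (h : F.1 ⊆ G) :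
    extendZero T y F = y ⟨F.1, F.2.1, h⟩ := dif_pos h

lemma VanishesOff.extendZero {S T G : Finset E} {k : ℕ} {y : Form G k} (hy : VanishesOff S y) :
    VanishesOff S (extendZero T y) := by
  intro F hF
  rw [FES.extendZero]
  split_ifs with h
  · exact hy _ hF
  · rfl

/-- The faces of `G` together with those not containing `S` are closed under taking subfaces.
Prescribing `y` on the former and zero on the latter is consistent because `y` vanishes off `S`. -/
lemma IsCompatibleFES.exists_extension_zero (hB : IsCompatibleFES K B) {T G S : Finset E}
    (hT : T ∈ K.faces) (hG : G ⊆ T) {k : ℕ} {y : Form G k} (hy : y ∈ B G k)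
    (hyS : VanishesOff S y) : ∃ u ∈ B T k, VanishesOff S u ∧ pull hG k u = y := by
  obtain ⟨u, hu, h⟩ := hB.exists_extension hT (fun F => F ⊆ G ∨ ¬ S ⊆ F)
    (fun F H hFH h => h.imp (fun h => hFH.trans h) fun h h' => h (h'.trans hFH))
    (extendZero T y) (fun F hF => by
      rcases hF with hF | hF
      · have hGne : G.Nonempty := F.2.1.mono hF
        have := hB.pull_mem G (K.down_closed hT hG hGne) F.1 (face_mem hT F) hF k y hy
        convert this using 1
        ext1 H
        exact extendZero_of_subset y (F := ⟨H.1, H.2.1, H.2.2.trans F.2.2⟩) (H.2.2.trans hF)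
      · convert zero_mem (B F.1 k) using 1
        ext1 H
        exact hyS.extendZero ⟨H.1, H.2.1, H.2.2.trans F.2.2⟩ fun h' => hF (h'.trans H.2.2))
  refine ⟨u, hu, fun F hF => ?_, ?_⟩
  · rw [h F (Or.inr hF)]
    exact hyS.extendZero F hF
  · ext1 F
    refine (h ⟨F.1, F.2.1, F.2.2.trans hG⟩ (Or.inl F.2.2)).trans ?_
    exact extendZero_of_subset y (F := ⟨F.1, F.2.1, F.2.2.trans hG⟩) F.2.2

lemma IsConst.pull {T G : Finset E} {u : Form T 0} {a : ℝ} (h : IsConst u a) (hG : G ⊆ T) :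
    IsConst (pull hG 0 u) a := fun F => h ⟨F.1, F.2.1, F.2.2.trans hG⟩

lemma IsConst.unique {T : Finset E} {u v : Form T 0} {a : ℝ} (h : IsConst u a)
    (h' : IsConst v a) : u = v :=
  h.isTrace.unique h'.isTrace

lemma exists_isConst (T : Finset E) (a : ℝ) : ∃ u : Form T 0, IsConst u a := by
  obtain ⟨u, hu⟩ := exists_isTrace T (α := fun _ : E =>
    ContinuousAlternatingMap.constOfIsEmpty ℝ E (Fin 0) a) continuous_const
  refine ⟨u, fun F => ?_⟩
  filter_upwards [hu F] with x hx w
  rw [hx]; rfl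

lemma IsConst.avg {T : Finset E} (hT : AffineIndependent ℝ ((↑) : T → E)) {u : Form T 0} {a : ℝ}
    (h : IsConst u a) (F : Face T) (w : Fin 0 → tangent F.1) :
    avg F.1 (fun _ => 1) w (u F) = a := by
  have := isProbabilityMeasure_unif (hT.mono (Finset.coe_subset.2 F.2.2)) F.2.1
  rw [FES.avg, integral_congr_ae (g := fun _ => a)]
  · simp
  · filter_upwards [h F] with x hx
    rw [hx, one_mul]

lemma IsConst.eq_zero {T : Finset E} {u : Form T 0} (h : IsConst u 0) : u = 0 := by
  refine h.isTrace.unique ?_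
  convert isTrace_zero T 0 using 2
  ext x; rfl

/-- A closed form of degree zero which vanishes on the faces not containing `S` is zero. -/
lemma IsCompatibleFES.closed_zero (hB : IsCompatibleFES K B) {T S : Finset E}
    (hT : T ∈ K.faces) (hST : S ⊆ T) (hS : S.Nonempty) {u : Form T 0} (hu : u ∈ B T 0)
    (huS : VanishesOff S u) (hd : IsExtDeriv u 0) (hi : S = T → integralForm T u = 0) : u = 0 := by
  obtain ⟨a, ha⟩ := ((hB.locallyExact T hT).exact_zero u).1 ⟨hu, hd⟩
  have hTi := K.indep hT
  obtain ⟨s, hs⟩ := id hS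
  have hpos := Finset.card_pos.2 (K.nonempty_of_mem_faces hT)
  suffices h : a = 0 by subst h; exact ha.eq_zero
  -- At a vertex the integral is the constant itself. Otherwise some vertex differs from `s`, hence
  -- does not contain `S`, and the constant is read off there.
  by_cases h1 : T.card = 1
  · have hST' : S = T := Finset.eq_of_subset_of_card_le hST (by rw [h1]; exact hS.card_pos)
    have h2 := (integralForm_eq_zero_iff hTi (k := 0) h1 (K.nonempty_of_mem_faces hT) u).1 (hi hST')
    rw [← ha.avg hTi ⟨T, K.nonempty_of_mem_faces hT, subset_rfl⟩ 0]
    exact h2 0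
  · obtain ⟨y, hy, hys⟩ := Finset.exists_mem_ne (by omega : 1 < T.card) s
    rw [← ha.avg hTi ⟨{y}, by simp, by simpa using hy⟩ 0, huS, avg_zero]
    intro h
    exact hys (Finset.mem_singleton.1 (h hs)).symm

lemma IsCompatibleFES.extDeriv_closed (hB : IsCompatibleFES K B) {T : Finset E}
    (hT : T ∈ K.faces) {k : ℕ} {u : Form T k} (hu : u ∈ B T k) :
    ∃ v ∈ B T (k + 1), IsExtDeriv u v ∧ IsExtDeriv v 0 := by
  obtain ⟨v, hv, h⟩ := hB.extDeriv_mem T hT k u hu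
  exact ⟨v, hv, h, ((hB.locallyExact T hT).exact_succ k v hv).2 ⟨u, hu, h⟩⟩

lemma VanishesOff.extDeriv {S T : Finset E} (hT : AffineIndependent ℝ ((↑) : T → E)) {k : ℕ}
    {u : Form T k} {v : Form T (k + 1)} (hu : VanishesOff S u) (h : IsExtDeriv u v) :
    VanishesOff S v := by
  intro F hF
  have h1 := h.pull F.2.2
  have h2 : FES.pull F.2.2 k u = 0 := by
    ext1 G
    exact hu ⟨G.1, G.2.1, G.2.2.trans F.2.2⟩ fun h => hF (h.trans G.2.2)
  rw [h2] at h1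
  exact congrFun (h1.eq_zero (hT.mono (Finset.coe_subset.2 F.2.2))) ⟨F.1, F.2.1, subset_rfl⟩

/-- Exactness of the complexes with boundary conditions on the facets opposite to the vertices
in `S`. -/
theorem IsCompatibleFES.exact_vanishesOff (hB : IsCompatibleFES K B) {T S : Finset E}
    (hT : T ∈ K.faces) (hST : S ⊆ T) {k : ℕ} {z : Form T (k + 1)} (hz : z ∈ B T (k + 1))
    (hzS : VanishesOff S z) (hd : IsExtDeriv z 0) (hi : S = T → integralForm T z = 0) :
    ∃ u ∈ B T k, VanishesOff S u ∧ IsExtDeriv u z := by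
  classical
  -- The outer induction supplies primitives on facets in all degrees; the inner one adds boundary
  -- conditions one vertex at a time.
  induction hn : T.card using Nat.strong_induction_on generalizing T S k with
  | _ n IH =>
  subst hn
  induction S using Finset.induction_on with
  | empty =>
    obtain ⟨u, hu, h⟩ := ((hB.locallyExact T hT).exact_succ k z hz).1 hd
    exact ⟨u, hu, fun F hF => absurd (Finset.empty_subset _) hF, h⟩
  | insert x S hxS ih =>
    have hTi := K.indep hT
    have hxT : x ∈ T := hST (Finset.mem_insert_self x S)
    have hST' : S ⊆ T := (Finset.subset_insert x S).trans hST
    by_cases hk : T.card ≤ k + 1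
    · obtain rfl : z = 0 := form_eq_zero hTi hk z
      exact ⟨0, zero_mem _, fun _ _ => rfl, IsExtDeriv.zero⟩
    -- The primitive `w` meets the conditions for `S`; only its trace on the facet opposite to `x`
    -- remains to be corrected. The integral condition is void here, since `x ∉ S` excludes `S = T`.
    obtain ⟨w, hw, hwS, hwz⟩ := ih hST'
      (fun F hF => hzS F fun h => hF ((Finset.subset_insert x S).trans h))
      (fun h => absurd (h ▸ hxT) hxS)
    set G := T.erase x with hG
    have hGT : G ⊆ T := T.erase_subset x
    have hGcard : G.card = T.card - 1 := Finset.card_erase_of_mem hxT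
    have hGne : G.Nonempty := Finset.card_pos.1 (by omega)
    have hGK : G ∈ K.faces := K.down_closed hT hGT hGne
    have hSG : S ⊆ G := fun y hy => Finset.mem_erase.2 ⟨fun h => hxS (h ▸ hy), hST' hy⟩
    have hwG : pull hGT k w ∈ B G k := hB.pull_mem T hT G hGK hGT k w hw
    have hwGd : IsExtDeriv (pull hGT k w) 0 := by
      convert hwz.pull hGT using 1
      ext1 F
      refine (hzS ⟨F.1, F.2.1, F.2.2.trans hGT⟩ fun h => ?_).symm
      exact Finset.notMem_erase x T (F.2.2 (h (Finset.mem_insert_self x S)))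
    -- When the facet carries full boundary conditions and `w` has top degree there, Stokes' theorem
    -- converts the vanishing integral of `z` into that of `w` on the facet.
    have hwGi : S = T.erase x → integralForm (T.erase x) (pull hGT k w) = 0 := by
      intro h
      by_cases hk2 : T.card = k + 2
      · subst h
        exact hwS.integralForm_erase_eq_zero hTi hk2 hxT hwz (hi (Finset.insert_erase hxT))
      · rw [integralForm, dif_neg (by rw [← hG, hGcard]; omega)]
    have hsplit : ∀ F : Face T, ¬ insert x S ⊆ F.1 → F.1 ⊆ G ∨ ¬ S ⊆ F.1 := fun F hF => by
      rw [Finset.insert_subset_iff, not_and_or] at hF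
      exact hF.imp (fun h y hy => Finset.mem_erase.2 ⟨fun e => h (e ▸ hy), F.2.2 hy⟩) id
    -- It suffices to find a closed `v` vanishing off `S` with the trace of `w` on the facet: `w -
    -- v` is then the primitive sought.
    suffices H : ∃ v ∈ B T k, IsExtDeriv v 0 ∧ VanishesOff S v ∧ pull hGT k v = pull hGT k w by
      obtain ⟨v, hv, hvd, hvS, hvw⟩ := H
      refine ⟨w - v, sub_mem hw hv, fun F hF => ?_, by simpa using hwz.sub hvd⟩
      rcases hsplit F hF with h | h
      · exact sub_eq_zero.2 (congrFun hvw ⟨F.1, F.2.1, h⟩).symm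
      · rw [Pi.sub_apply, hwS F h, hvS F h, sub_zero]
    -- In degree zero the closed trace is a constant, which extends as such if `S` is empty and is
    -- zero otherwise. In positive degree it is `dy` on the facet, and `v` is the derivative of an
    -- extension of `y`.
    cases k with
    | zero =>
      rcases S.eq_empty_or_nonempty with rfl | hS
      · obtain ⟨a, ha⟩ := ((hB.locallyExact G hGK).exact_zero _).1 ⟨hwG, hwGd⟩
        obtain ⟨v, hv⟩ := exists_isConst T a
        obtain ⟨hvB, hvd⟩ := ((hB.locallyExact T hT).exact_zero v).2 ⟨a, hv⟩
        exact ⟨v, hvB, hvd, fun F hF => absurd (Finset.empty_subset _) hF,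
          (hv.pull hGT).unique ha⟩
      · have h0 := hB.closed_zero hGK hSG hS hwG (hwS.pull hGT) hwGd hwGi
        exact ⟨0, zero_mem _, IsExtDeriv.zero, fun _ _ => rfl, by rw [h0, map_zero]⟩
    | succ k =>
      obtain ⟨y, hy, hyS, hyw⟩ := IH G.card (by omega) hGK hSG hwG (hwS.pull hGT) hwGd hwGi rfl
      obtain ⟨y', hy', hyS', rfl⟩ := hB.exists_extension_zero hT hGT hy hyS
      obtain ⟨v, hv, hyv, hvd⟩ := hB.extDeriv_closed hT hy'
      exact ⟨v, hv, hvd, hyS'.extDeriv hTi hyv, (hyv.pull hGT).unique (K.indep hGK) hyw⟩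

/-- Some form in `B_0^n(T)`, `n = dim T`, has nonzero integral. -/
lemma IsCompatibleFES.exists_integralForm_ne_zero (hB : IsCompatibleFES K B) {n : ℕ} :
    ∀ {T : Finset E}, T ∈ K.faces → T.card = n + 1 →
      ∃ u ∈ bdryZero B T n, integralForm T u ≠ 0 := by
  classical
  induction n with
  | zero =>
    intro T hT hn
    obtain ⟨u, hu⟩ := exists_isConst T 1
    refine ⟨u, ⟨(((hB.locallyExact T hT).exact_zero u).2 ⟨1, hu⟩).1, fun F hF => ?_⟩, fun h => ?_⟩
    · exact absurd (Finset.eq_of_subset_of_card_le F.2.2 (by rw [hn]; exact F.2.1.card_pos)) hF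
    · have h1 := (integralForm_eq_zero_iff (K.indep hT) hn (K.nonempty_of_mem_faces hT) u).1 h 0
      rw [hu.avg (K.indep hT) ⟨T, K.nonempty_of_mem_faces hT, subset_rfl⟩] at h1
      exact one_ne_zero h1
  | succ n ih =>
    intro T hT hn
    obtain ⟨x, hx⟩ := K.nonempty_of_mem_faces hT
    have hcard : (T.erase x).card = n + 1 := by rw [Finset.card_erase_of_mem hx, hn]; rfl
    have hGne : (T.erase x).Nonempty := Finset.card_pos.1 (by omega)
    have hGT := T.erase_subset x
    obtain ⟨y, hy, hyi⟩ := ih (K.down_closed hT hGT hGne) hcard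
    -- A form with nonzero integral on one facet is extended by zero to the other facets. By Stokes'
    -- theorem its derivative has nonzero integral, and it vanishes on the boundary for reasons of
    -- degree.
    obtain ⟨w, hw, hwS, rfl⟩ := hB.exists_extension_zero (S := T.erase x) hT hGT hy.1
      fun F hF => hy.2 F fun h => hF h.ge
    obtain ⟨z, hz, hwz, -⟩ := hB.extDeriv_closed hT hw
    refine ⟨z, ⟨hz, fun F hF => ?_⟩, fun h => hyi ?_⟩
    · refine l2Form_eq_zero ((K.indep hT).mono (Finset.coe_subset.2 F.2.2)) F.2.1 ?_ _
      have := Finset.card_lt_card (F.2.2.ssubset_of_ne hF)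
      omega
    · exact hwS.integralForm_erase_eq_zero (K.indep hT) hn hx hwz h

/-- Exactness with boundary conditions: the sequence
`0 → B_0^0(T) → ⋯ → B_0^n(T) → ℝ → 0` is exact in positive degrees. -/
lemma IsCompatibleFES.exact_bdryZero (hB : IsCompatibleFES K B) {T : Finset E}
    (hT : T ∈ K.faces) {k : ℕ} {z : Form T (k + 1)} (hz : z ∈ bdryZero B T (k + 1))
    (hd : IsExtDeriv z 0) (hi : integralForm T z = 0) :
    ∃ u ∈ bdryZero B T k, IsExtDeriv u z := by
  have hv : ∀ F : Face T, ¬ T ⊆ F.1 ↔ F.1 ≠ T := fun F =>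
    ⟨fun h h' => h h'.ge, fun h h' => h (F.2.2.antisymm h')⟩
  obtain ⟨u, hu, huT, h⟩ := hB.exact_vanishesOff hT subset_rfl hz.1
    (fun F hF => hz.2 F ((hv F).1 hF)) hd fun _ => hi
  exact ⟨u, ⟨hu, fun F hF => huT F ((hv F).2 hF)⟩, h⟩

end

/-! ### Dimensions of spaces of compatible families -/

lemma finrank_map_add_finrank_inf_ker {V W : Type*} [AddCommGroup V] [Module ℝ V] [AddCommGroup W]
    [Module ℝ W] (f : V →ₗ[ℝ] W) (S : Submodule ℝ V) [FiniteDimensional ℝ S] :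
    Module.finrank ℝ (S.map f) + Module.finrank ℝ (S ⊓ LinearMap.ker f : Submodule ℝ V) =
      Module.finrank ℝ S := by
  have h := LinearMap.finrank_range_add_finrank_ker (f.domRestrict S)
  rw [LinearMap.range_domRestrict, LinearMap.ker_domRestrict] at h
  rw [← h, inf_comm]
  congr 1
  have e : (LinearMap.ker f).comap S.subtype = (LinearMap.ker f ⊓ S).comap S.subtype := by simp
  rw [e]
  exact (Submodule.comapSubtypeEquivOfLe inf_le_right).finrank_eq.symm

/-- The families of forms attached to all the simplices. -/
abbrev Family (E : Type*) [NormedAddCommGroup E] [InnerProductSpace ℝ E]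
    [MeasurableSpace E] [BorelSpace E] (k : ℕ) := (F : Finset E) → L2Form F k

/-- The part of a family that lives on the faces of `T`. -/
def Family.toForm (T : Finset E) (k : ℕ) : Family E k →ₗ[ℝ] Form T k where
  toFun u := fun F => u F.1
  map_add' _ _ := rfl
  map_smul' _ _ := rfl

/-- The families of forms supported in `L` whose restrictions to the simplices `T` in `L` belong
to `B^k(T)`. -/
def families (B : FormSystem E) (k : ℕ) (L : Finset (Finset E)) : Submodule ℝ (Family E k) where
  carrier := {u | (∀ F, F ∉ L → u F = 0) ∧ ∀ F ∈ L, Family.toForm F k u ∈ B F k}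
  add_mem' := by
    rintro u v ⟨hu, hu'⟩ ⟨hv, hv'⟩
    exact ⟨fun F hF => by simp [hu F hF, hv F hF], fun F hF => by
      rw [map_add]; exact add_mem (hu' F hF) (hv' F hF)⟩
  zero_mem' := ⟨fun _ _ => rfl, fun F _ => by rw [map_zero]; exact zero_mem _⟩
  smul_mem' := by
    rintro a u ⟨hu, hu'⟩
    exact ⟨fun F hF => by simp [hu F hF], fun F hF => by
      rw [map_smul]; exact Submodule.smul_mem _ a (hu' F hF)⟩

/-- Replacing the component on `F` of a family by zero. -/
def Family.remove (F : Finset E) (k : ℕ) : Family E k →ₗ[ℝ] Family E k :=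
  open scoped Classical in
  LinearMap.pi fun G => if G = F then 0 else LinearMap.proj G

lemma Family.remove_self (F : Finset E) {k : ℕ} (u : Family E k) : Family.remove F k u F = 0 := by
  simp [Family.remove]

lemma Family.remove_of_ne {F G : Finset E} {k : ℕ} (u : Family E k) (h : G ≠ F) :
    Family.remove F k u G = u G := by
  simp [Family.remove, h]

section

variable {K : Geometry.SimplicialComplex ℝ E} {B : FormSystem E}

lemma IsFES.finiteDimensional_families (hB : IsFES K B) {k : ℕ} {L : Finset (Finset E)}
    (hL : ∀ F ∈ L, F ∈ K.faces) : FiniteDimensional ℝ (families B k L) := by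
  have : ∀ F : L, FiniteDimensional ℝ (B F.1 k) := fun F => hB.finite F.1 (hL _ F.2) k
  let f : families B k L →ₗ[ℝ] ((F : L) → B F.1 k) := LinearMap.pi fun F =>
    ((Family.toForm F.1 k).comp (families B k L).subtype).codRestrict (B F.1 k)
      fun u => u.2.2 F.1 F.2
  refine FiniteDimensional.of_injective f ((injective_iff_map_eq_zero f).2 fun u hu => ?_)
  ext1
  funext F
  by_cases hF : F ∈ L
  · exact congrFun (congrArg Subtype.val (congrFun hu ⟨F, hF⟩))
      ⟨F, K.nonempty_of_mem_faces (hL F hF), subset_rfl⟩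
  · exact u.2.1 F hF

lemma finiteDimensional_bdryZero {A : FormSystem E} {T : Finset E} {k : ℕ}
    (h : FiniteDimensional ℝ (A T k)) : FiniteDimensional ℝ (bdryZero A T k) :=
  Submodule.finiteDimensional_of_le (S₂ := A T k) fun _ hu => hu.1

lemma Family.toForm_eq_of_eq {L : Finset (Finset E)} {F : Finset E}
    (hmax : ∀ G ∈ L, F ⊆ G → G = F) {k : ℕ} {u v : Family E k} (huv : ∀ G, G ≠ F → u G = v G)
    {H : Finset E} (hH : H ∈ L) (hHF : H ≠ F) : Family.toForm H k u = Family.toForm H k v :=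
  funext fun G => huv G.1 fun h => hHF (hmax H hH (h ▸ G.2.2))

lemma Family.exists_update {F : Finset E} (hF : F.Nonempty) {k : ℕ} (u : Family E k) (v : Form F k)
    (h : ∀ G : Face F, G.1 ≠ F → v G = u G.1) :
    ∃ u' : Family E k, (∀ G, G ≠ F → u' G = u G) ∧ Family.toForm F k u' = v := by
  classical
  have hu : ∀ G, G ≠ F → Function.update u F (v ⟨F, hF, subset_rfl⟩) G = u G := fun G hG =>
    Function.update_of_ne hG _ _
  refine ⟨Function.update u F (v ⟨F, hF, subset_rfl⟩), hu, funext fun G => ?_⟩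
  by_cases hG : G.1 = F
  · obtain rfl : G = ⟨F, hF, subset_rfl⟩ := Subtype.ext hG
    exact Function.update_self _ _ _
  · exact (hu _ hG).trans (h G hG).symm

/-- A family in the kernel lives on `F` alone. Since `F` is maximal in `L`, its component there is
constrained by no other simplex of `L`. -/
lemma finrank_families_inf_ker {L : Finset (Finset E)} {F : Finset E} (hF : F.Nonempty)
    (hFL : F ∈ L) (hmax : ∀ G ∈ L, F ⊆ G → G = F) (k : ℕ) :
    Module.finrank ℝ (families B k L ⊓ LinearMap.ker (Family.remove F k) : Submodule ℝ _) =
      Module.finrank ℝ (bdryZero B F k) := by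
  have hker : ∀ u : Family E k, u ∈ LinearMap.ker (Family.remove F k) ↔ ∀ G, G ≠ F → u G = 0 := by
    intro u
    rw [LinearMap.mem_ker]
    refine ⟨fun h G hG => ?_, fun h => funext fun G => ?_⟩
    · have := congrFun h G
      rwa [Family.remove_of_ne u hG] at this
    · by_cases hG : G = F
      · subst hG; exact Family.remove_self G u
      · rw [Family.remove_of_ne u hG, h G hG]; rfl
  set N : Submodule ℝ (Family E k) := families B k L ⊓ LinearMap.ker (Family.remove F k)
  have hN : ∀ u ∈ N, Family.toForm F k u ∈ bdryZero B F k := fun u hu =>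
    ⟨hu.1.2 F hFL, fun G hG => (hker u).1 hu.2 G.1 hG⟩
  refine LinearEquiv.finrank_eq (LinearEquiv.ofBijective
    (((Family.toForm F k).comp N.subtype).codRestrict (bdryZero B F k) fun u => hN u.1 u.2) ⟨?_, ?_⟩)
  · refine (injective_iff_map_eq_zero _).2 fun u h => Subtype.ext (funext fun G => ?_)
    by_cases hG : G = F
    · subst hG
      exact congrFun (congrArg Subtype.val h) ⟨G, hF, subset_rfl⟩
    · exact (hker _).1 u.2.2 G hG
  · rintro ⟨v, hv, hv0⟩
    obtain ⟨u, hu, rfl⟩ := Family.exists_update hF 0 v hv0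
    refine ⟨⟨u, ⟨fun G hG => hu G fun h => hG (h ▸ hFL), fun H hH => ?_⟩, (hker u).2 hu⟩, rfl⟩
    by_cases hHF : H = F
    · subst hHF; exact hv
    · rw [Family.toForm_eq_of_eq hmax hu hH hHF, map_zero]; exact zero_mem _

-- The extension property on `F` is exactly the surjectivity of restriction from `L` to `L` without
-- `F`.
open scoped Classical in
lemma map_remove_families {L : Finset (Finset E)} {F : Finset E} (hF : F.Nonempty) (hFL : F ∈ L)
    (hmax : ∀ G ∈ L, F ⊆ G → G = F) (hdown : ∀ G ⊆ F, G.Nonempty → G ∈ L) {k : ℕ}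
    (hB : AdmitsExtensions B F k) :
    (families B k L).map (Family.remove F k) = families B k (L.erase F) := by
  ext u
  constructor
  · rintro ⟨u, hu, rfl⟩
    refine ⟨fun G hG => ?_, fun G hG => ?_⟩
    · by_cases hGF : G = F
      · subst hGF; exact Family.remove_self G u
      · rw [Family.remove_of_ne u hGF]
        exact hu.1 G fun h => hG (Finset.mem_erase.2 ⟨hGF, h⟩)
    · obtain ⟨hGF, hGL⟩ := Finset.mem_erase.1 hG
      rw [Family.toForm_eq_of_eq hmax (fun H hH => Family.remove_of_ne u hH) hGL hGF]
      exact hu.2 G hGL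
  · intro hu
    obtain ⟨v, hv, hvu⟩ := admitsExtensions_iff.1 hB (Family.toForm F k u) fun G hG =>
      hu.2 G.1 (Finset.mem_erase.2 ⟨hG, hdown G.1 G.2.2 G.2.1⟩)
    obtain ⟨u', hu', rfl⟩ := Family.exists_update hF u v hvu
    refine ⟨u', ⟨fun G hG => ?_, fun H hH => ?_⟩, funext fun G => ?_⟩
    · rw [hu' G fun h => hG (h ▸ hFL)]
      exact hu.1 G fun h => hG (Finset.mem_of_mem_erase h)
    · by_cases hHF : H = F
      · subst hHF; exact hv
      · rw [Family.toForm_eq_of_eq hmax hu' hH hHF]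
        exact hu.2 H (Finset.mem_erase.2 ⟨hHF, hH⟩)
    · by_cases hG : G = F
      · subst hG
        rw [Family.remove_self, hu.1 G (Finset.notMem_erase G L)]
      · rw [Family.remove_of_ne _ hG, hu' G hG]

/-- Maximal simplices are removed one after the other; by rank-nullity each contributes the
dimension of its forms vanishing on the boundary. -/
lemma IsCompatibleFES.finrank_families (hB : IsCompatibleFES K B) (k : ℕ) (L : Finset (Finset E))
    (hL : ∀ F ∈ L, F ∈ K.faces) (hdown : ∀ F ∈ L, ∀ G ⊆ F, G.Nonempty → G ∈ L) :
    Module.finrank ℝ (families B k L) = ∑ F ∈ L, Module.finrank ℝ (bdryZero B F k) := by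
  classical
  induction hn : L.card generalizing L with
  | zero =>
    rw [Finset.card_eq_zero] at hn
    subst hn
    have : families B k ∅ = ⊥ := by
      rw [eq_bot_iff]
      exact fun u hu => funext fun F => hu.1 F (by simp)
    rw [this]; simp
  | succ n ih =>
    obtain ⟨F, hFL, hF⟩ := L.exists_max_image Finset.card (Finset.card_pos.1 (by omega))
    have hmax : ∀ G ∈ L, F ⊆ G → G = F := fun G hG h =>
      (Finset.eq_of_subset_of_card_le h (hF G hG)).symm
    have hFne := K.nonempty_of_mem_faces (hL F hFL)
    have := hB.finiteDimensional_families (k := k) hL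
    rw [← Finset.add_sum_erase L _ hFL, ← ih (L.erase F)
      (fun G hG => hL G (Finset.mem_of_mem_erase hG)) (fun G hG H hH hHne =>
        Finset.mem_erase.2 ⟨fun h => (Finset.mem_erase.1 hG).1
          (hmax G (Finset.mem_of_mem_erase hG) (h ▸ hH)),
          hdown G (Finset.mem_of_mem_erase hG) H hH hHne⟩)
      (by rw [Finset.card_erase_of_mem hFL, hn]; rfl),
      ← finrank_map_add_finrank_inf_ker (Family.remove F k), add_comm,
      finrank_families_inf_ker hFne hFL hmax,
      map_remove_families hFne hFL hmax (hdown F hFL) (hB.extensions F (hL F hFL) k)]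

lemma IsCompatibleFES.finrank_cell (hB : IsCompatibleFES K B) {T : Finset E} (hT : T ∈ K.faces)
    (k : ℕ) : Module.finrank ℝ (B T k) =
      ∑ F ∈ T.powerset.filter Finset.Nonempty, Module.finrank ℝ (bdryZero B F k) := by
  classical
  have hmem : ∀ F, F ∈ T.powerset.filter Finset.Nonempty ↔ F ⊆ T ∧ F.Nonempty := fun F => by simp
  have hTne := K.nonempty_of_mem_faces hT
  have hTL := (hmem T).2 ⟨subset_rfl, hTne⟩
  rw [← hB.finrank_families k _ (fun F hF => K.down_closed hT ((hmem F).1 hF).1 ((hmem F).1 hF).2)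
    fun F hF G hG hGne => (hmem G).2 ⟨hG.trans ((hmem F).1 hF).1, hGne⟩]
  refine (LinearEquiv.finrank_eq (LinearEquiv.ofBijective
    (((Family.toForm T k).comp (families B k _).subtype).codRestrict (B T k) fun u => u.2.2 T hTL)
    ⟨?_, ?_⟩)).symm
  · refine (injective_iff_map_eq_zero _).2 ?_
    rintro ⟨u, hu⟩ h
    ext1
    funext F
    by_cases hF : F ⊆ T ∧ F.Nonempty
    · exact congrFun (congrArg Subtype.val h) ⟨F, hF.2, hF.1⟩
    · exact hu.1 F fun h => hF ((hmem F).1 h)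
  · rintro ⟨v, hv⟩
    have hu : ∀ F : Face T, (fun F => if h : F.Nonempty ∧ F ⊆ T then v ⟨F, h⟩ else 0 : Family E k) F.1
      = v F := fun F => dif_pos F.2
    refine ⟨⟨fun F => if h : F.Nonempty ∧ F ⊆ T then v ⟨F, h⟩ else 0, fun F hF => ?_,
      fun F hF => ?_⟩, Subtype.ext (funext hu)⟩
    · exact dif_neg fun h => hF ((hmem F).2 h.symm)
    · obtain ⟨hFT, hFne⟩ := (hmem F).1 hF
      convert hB.pull_mem T hT F (K.down_closed hT hFT hFne) hFT k v hv using 1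
      exact funext fun G => hu ⟨G.1, G.2.1, G.2.2.trans hFT⟩

lemma IsCompatibleFES.finrank_globalSpace (hB : IsCompatibleFES K B) (hK : K.faces.Finite) (k : ℕ) :
    Module.finrank ℝ (globalSpace K B k) =
      ∑ F ∈ hK.toFinset, Module.finrank ℝ (bdryZero B F k) := by
  classical
  have hmem : ∀ F, F ∈ hK.toFinset ↔ F ∈ K.faces := fun F => by simp
  rw [← hB.finrank_families k _ (fun F hF => (hmem F).1 hF)
    fun F hF G hG hGne => (hmem G).2 (K.down_closed ((hmem F).1 hF) hG hGne)]
  refine (LinearEquiv.finrank_eq (LinearEquiv.ofBijective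
    (((LinearMap.pi fun T : K.faces => Family.toForm T.1 k).comp
      (families B k _).subtype).codRestrict (globalSpace K B k) fun u =>
        ⟨fun T => u.2.2 T.1 ((hmem _).2 T.2), fun _ _ _ => rfl⟩) ⟨?_, ?_⟩)).symm
  · refine (injective_iff_map_eq_zero _).2 ?_
    rintro ⟨u, hu⟩ h
    ext1
    funext F
    by_cases hF : F ∈ K.faces
    · exact congrFun (congrFun (congrArg Subtype.val h) ⟨F, hF⟩)
        ⟨F, K.nonempty_of_mem_faces hF, subset_rfl⟩
    · exact hu.1 F fun h => hF ((hmem F).1 h)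
  · rintro ⟨v, hv, hv'⟩
    set u : Family E k := fun F => if h : F ∈ K.faces then
      v ⟨F, h⟩ ⟨F, K.nonempty_of_mem_faces h, subset_rfl⟩ else 0
    have hu : ∀ T : K.faces, Family.toForm T.1 k u = v T := fun T => funext fun F => by
      refine (dif_pos (face_mem T.2 F)).trans ?_
      exact (congrFun (hv' T ⟨F.1, face_mem T.2 F⟩ F.2.2) ⟨F.1, F.2.1, subset_rfl⟩).symm
    refine ⟨⟨u, fun F hF => dif_neg fun h => hF ((hmem F).2 h), fun F hF => ?_⟩,
      Subtype.ext (funext hu)⟩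
    rw [hu ⟨F, (hmem F).1 hF⟩]
    exact hv ⟨F, (hmem F).1 hF⟩

end

/-! ### Dimensions and cohomology -/

section

variable {V W : Type*} [AddCommGroup V] [Module ℝ V] [AddCommGroup W] [Module ℝ W]
  {Γ : Submodule ℝ (V × W)}

lemma finiteDimensional_of_le_prod {D : Submodule ℝ V} {D' : Submodule ℝ W}
    [FiniteDimensional ℝ D] [FiniteDimensional ℝ D'] (h : ∀ p ∈ Γ, p.1 ∈ D)
    (h' : ∀ p ∈ Γ, p.2 ∈ D') : FiniteDimensional ℝ Γ := by
  have : FiniteDimensional ℝ (D.prod D') :=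
    Module.Finite.iff_fg.2 ((Module.Finite.iff_fg.1 inferInstance).prod
      (Module.Finite.iff_fg.1 inferInstance))
  exact Submodule.finiteDimensional_of_le (S₂ := D.prod D') fun p hp => ⟨h p hp, h' p hp⟩

/-- Rank-nullity for a linear relation that is the graph of a map. -/
lemma finrank_map_fst_eq [FiniteDimensional ℝ Γ] {D : Submodule ℝ V}
    (h : ∀ v, (0, v) ∈ Γ → v = 0) (h' : ∀ u, (u, 0) ∈ Γ ↔ u ∈ D) :
    Module.finrank ℝ (Γ.map (LinearMap.fst ℝ V W)) =
      Module.finrank ℝ (Γ.map (LinearMap.snd ℝ V W)) + Module.finrank ℝ D := by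
  have h1 := finrank_map_add_finrank_inf_ker (LinearMap.fst ℝ V W) Γ
  have h2 := finrank_map_add_finrank_inf_ker (LinearMap.snd ℝ V W) Γ
  have e1 : Γ ⊓ LinearMap.ker (LinearMap.fst ℝ V W) = ⊥ := by
    rw [eq_bot_iff]
    rintro ⟨u, v⟩ ⟨huv, hu⟩
    obtain rfl : u = 0 := hu
    exact Prod.ext rfl (h v huv)
  have e2 : Γ ⊓ LinearMap.ker (LinearMap.snd ℝ V W) = D.map (LinearMap.inl ℝ V W) := by
    ext ⟨u, v⟩
    constructor
    · rintro ⟨huv, hv⟩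
      obtain rfl : v = 0 := hv
      exact ⟨u, (h' u).1 huv, rfl⟩
    · rintro ⟨u, hu, ⟨⟩⟩
      exact ⟨(h' u).2 hu, rfl⟩
  have h3 : Module.finrank ℝ (D.map (LinearMap.inl ℝ V W)) = Module.finrank ℝ D :=
    LinearEquiv.finrank_eq (Submodule.equivMapOfInjective _ LinearMap.inl_injective D).symm
  rw [e1, finrank_bot, add_zero] at h1
  rw [e2, h3] at h2
  omega

end

/-- The graph of the exterior derivative, between `D` and `D'`. -/
def derivGraph {T : Finset E} {k : ℕ} (D : Submodule ℝ (Form T k))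
    (D' : Submodule ℝ (Form T (k + 1))) : Submodule ℝ (Form T k × Form T (k + 1)) where
  carrier := {p | p.1 ∈ D ∧ p.2 ∈ D' ∧ IsExtDeriv p.1 p.2}
  add_mem' := fun h h' => ⟨add_mem h.1 h'.1, add_mem h.2.1 h'.2.1, h.2.2.add h'.2.2⟩
  zero_mem' := ⟨zero_mem _, zero_mem _, IsExtDeriv.zero⟩
  smul_mem' := fun a _ h =>
    ⟨Submodule.smul_mem _ a h.1, Submodule.smul_mem _ a h.2.1, h.2.2.smul a⟩

/-- The closed forms in `D`. -/
def closedForms {T : Finset E} {k : ℕ} (D : Submodule ℝ (Form T k)) : Submodule ℝ (Form T k) where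
  carrier := {u | u ∈ D ∧ IsExtDeriv u 0}
  add_mem' := fun h h' => ⟨add_mem h.1 h'.1, by simpa using h.2.add h'.2⟩
  zero_mem' := ⟨zero_mem _, IsExtDeriv.zero⟩
  smul_mem' := fun a _ h => ⟨Submodule.smul_mem _ a h.1, by simpa using h.2.smul a⟩

/-- The weak derivative is a relation, not a linear map. Its uniqueness makes the relation a graph,
so rank-nullity applies with the closed forms as kernel. -/
lemma finrank_map_fst_derivGraph {T : Finset E} (hT : AffineIndependent ℝ ((↑) : T → E)) {k : ℕ}
    (D : Submodule ℝ (Form T k)) (D' : Submodule ℝ (Form T (k + 1))) [FiniteDimensional ℝ D]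
    [FiniteDimensional ℝ D'] :
    Module.finrank ℝ ((derivGraph D D').map (LinearMap.fst ℝ _ _)) =
      Module.finrank ℝ ((derivGraph D D').map (LinearMap.snd ℝ _ _)) +
        Module.finrank ℝ (closedForms D) := by
  have := finiteDimensional_of_le_prod (Γ := derivGraph D D') (D := D) (D' := D')
    (fun p hp => hp.1) (fun p hp => hp.2.1)
  exact finrank_map_fst_eq (fun v hv => hv.2.2.eq_zero hT) fun u =>
    ⟨fun h => ⟨h.1, h.2.2⟩, fun h => ⟨h.1, zero_mem _, h.2⟩⟩

/-- The integral of an exact form in `B_0^n(T)` vanishes. -/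
lemma integralForm_eq_zero_of_isExtDeriv {T : Finset E} (hT : AffineIndependent ℝ ((↑) : T → E))
    (hne : T.Nonempty) {k : ℕ} {u : Form T k} {v : Form T (k + 1)} (h : IsExtDeriv u v)
    (hu : ∀ F : Face T, F.1 ≠ T → u F = 0) : integralForm T v = 0 := by
  by_cases hk : T.card = k + 1 + 1
  · rw [integralForm_eq_zero_iff hT hk hne]
    intro w
    obtain ⟨Λ, hΛ⟩ := exists_isBary hT
    have h1 := h ⟨T, hne, subset_rfl⟩ (fun _ => 1) contDiff_const w (fun j y => Λ y (0, w j))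
      (fun j => (hΛ.sum_tangent (w j).2).1) (fun j => (hΛ.sum_tangent (w j).2).2)
    have h0 : ∀ j, avg T (fun y => fderiv ℝ (fun _ : E => (1 : ℝ)) y (w j : E))
        (fun i => w (j.succAbove i)) (u ⟨T, hne, subset_rfl⟩) = 0 := fun j => by
      simp [avg]
    classical
    simp only [h0, mul_zero, Finset.sum_const_zero, add_zero] at h1
    rw [h1, Finset.sum_eq_zero, mul_zero]
    intro x hx
    rw [facetTerm]
    split_ifs with hx'
    · refine Finset.sum_eq_zero fun j _ => ?_
      rw [hu _ fun h' => ?_, avg_zero, mul_zero]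
      exact hx'.ne_empty (absurd hx (Finset.erase_eq_self.1 h'))
    · rfl
  · rw [integralForm, dif_neg hk]

lemma bdryZero_of_isExtDeriv {T : Finset E} (hT : AffineIndependent ℝ ((↑) : T → E)) {k : ℕ}
    {u : Form T k} {v : Form T (k + 1)} (h : IsExtDeriv u v)
    (hu : ∀ F : Face T, F.1 ≠ T → u F = 0) (F : Face T) (hF : F.1 ≠ T) : v F = 0 :=
  VanishesOff.extDeriv hT (S := T) (fun G hG => hu G fun h' => hG h'.ge) h F
    fun h' => hF (F.2.2.antisymm h')

section

variable {K : Geometry.SimplicialComplex ℝ E} {A B : FormSystem E}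

lemma IsCompatibleFES.map_integralLin (hB : IsCompatibleFES K B) {T : Finset E} (hT : T ∈ K.faces)
    {n : ℕ} (hn : T.card = n + 1) : (bdryZero B T n).map (integralLin T n) = ⊤ := by
  obtain ⟨u, hu, h⟩ := hB.exists_integralForm_ne_zero hT hn
  rw [eq_top_iff]
  intro a _
  refine ⟨(a / integralForm T u) • u, Submodule.smul_mem _ _ hu, ?_⟩
  rw [map_smul]
  exact div_mul_cancel₀ a h

/-- Rank-nullity for `d` on `A_0^k(T)`, combined with cocycles modulo coboundaries. The assumption
on `k` excludes the degree occupied by `ℝ`. -/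
lemma dimCohomology_add_finrank {T : Finset E} {k : ℕ} (hk : k + 1 ≠ T.card)
    (hT : AffineIndependent ℝ ((↑) : T → E)) (hne : T.Nonempty)
    [FiniteDimensional ℝ (A T k)] [FiniteDimensional ℝ (A T (k + 1))]
    (hA : ∀ u ∈ A T k, ∃ v ∈ A T (k + 1), IsExtDeriv u v ∧ IsExtDeriv v 0) :
    dimCohomology A T (k + 1) + Module.finrank ℝ (bdryZero A T k) =
      Module.finrank ℝ (cocycles A T (k + 1)) +
        Module.finrank ℝ (closedForms (bdryZero A T k)) := by
  have := finiteDimensional_bdryZero (T := T) (k := k) (A := A) inferInstance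
  have : FiniteDimensional ℝ (cocycles A T (k + 1)) :=
    Submodule.finiteDimensional_of_le (S₂ := A T (k + 1)) fun u hu => hu.1.1
  have hle : coboundaries A T (k + 1) ≤ cocycles A T (k + 1) := by
    rintro v ⟨u, hu, h⟩
    obtain ⟨v', hv', h', hd⟩ := hA u hu.1
    obtain rfl := h.unique hT h'
    exact ⟨⟨hv', bdryZero_of_isExtDeriv hT h hu.2⟩, hd,
      integralForm_eq_zero_of_isExtDeriv hT hne h hu.2⟩
  have h1 := finrank_map_fst_derivGraph hT (bdryZero A T k) (A T (k + 1))
  have e1 : (derivGraph (bdryZero A T k) (A T (k + 1))).map (LinearMap.fst ℝ _ _) =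
      bdryZero A T k := by
    ext u
    constructor
    · rintro ⟨⟨u, v⟩, ⟨hu, -⟩, rfl⟩
      exact hu
    · intro hu
      obtain ⟨v, hv, h, -⟩ := hA u hu.1
      exact ⟨(u, v), ⟨hu, hv, h⟩, rfl⟩
  have e2 : (derivGraph (bdryZero A T k) (A T (k + 1))).map (LinearMap.snd ℝ _ _) =
      coboundaries A T (k + 1) := by
    ext v
    constructor
    · rintro ⟨⟨u, v⟩, ⟨hu, -, h⟩, rfl⟩
      exact ⟨u, hu, h⟩
    · rintro ⟨u, hu, h⟩
      exact ⟨(u, v), ⟨hu, (hle ⟨u, hu, h⟩).1.1, h⟩, rfl⟩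
  rw [e1, e2] at h1
  have h2 := Submodule.finrank_quotient_add_finrank
    ((coboundaries A T (k + 1)).comap (cocycles A T (k + 1)).subtype)
  rw [(Submodule.comapSubtypeEquivOfLe hle).finrank_eq] at h2
  rw [dimCohomology, if_neg hk]
  omega

/-- The system `A` is stable under the exterior derivative on the simplex `T`. -/
def StableOn (A : FormSystem E) (T : Finset E) : Prop :=
  ∀ k, ∀ u ∈ A T k, ∃ v ∈ A T (k + 1), IsExtDeriv u v ∧ IsExtDeriv v 0

lemma IsCompatibleFES.map_snd_derivGraph (hB : IsCompatibleFES K B) {T : Finset E}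
    (hT : T ∈ K.faces) (hAB : ∀ k, A T k ≤ B T k) {k : ℕ} :
    (derivGraph (bdryZero B T k) (cocycles A T (k + 1))).map (LinearMap.snd ℝ _ _) =
      cocycles A T (k + 1) := by
  ext v
  constructor
  · rintro ⟨⟨u, v⟩, ⟨-, hv, -⟩, rfl⟩
    exact hv
  · intro hv
    obtain ⟨u, hu, h⟩ := hB.exact_bdryZero hT ⟨hAB _ hv.1.1, hv.1.2⟩ hv.2.1 hv.2.2
    exact ⟨(u, v), ⟨hu, hv, h⟩, rfl⟩

/-- The lower bound for the dimension of a compatible system containing `A`. -/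
lemma IsCompatibleFES.finrank_add_dimCohomology_le (hB : IsCompatibleFES K B) {T : Finset E}
    (hT : T ∈ K.faces) (hAB : ∀ k, A T k ≤ B T k) (hA : StableOn A T) (k : ℕ) :
    Module.finrank ℝ (bdryZero A T k) + dimCohomology A T (k + 1) ≤
      Module.finrank ℝ (bdryZero B T k) := by
  have hTi := K.indep hT
  have hne := K.nonempty_of_mem_faces hT
  have hfB : ∀ k, FiniteDimensional ℝ (B T k) := hB.finite T hT
  have hfA : ∀ k, FiniteDimensional ℝ (A T k) := fun k =>
    Submodule.finiteDimensional_of_le (hAB k)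
  have hfB0 := finiteDimensional_bdryZero (hfB k)
  have hfA0 := finiteDimensional_bdryZero (hfA k)
  have hAB0 : bdryZero A T k ≤ bdryZero B T k := fun u hu => ⟨hAB k hu.1, hu.2⟩
  -- In top degree the integral replaces `d`: it is onto `ℝ` on `B_0^n(T)`, and the cokernel of its
  -- restriction to `A_0^n(T)` is the cohomology.
  by_cases hk : k + 1 = T.card
  · rw [dimCohomology, if_pos hk]
    obtain rfl : T.card - 1 = k := by omega
    have h1 := finrank_map_add_finrank_inf_ker (integralLin T (T.card - 1))
      (bdryZero A T (T.card - 1))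
    have h2 := finrank_map_add_finrank_inf_ker (integralLin T (T.card - 1))
      (bdryZero B T (T.card - 1))
    rw [hB.map_integralLin hT hk.symm, finrank_top] at h2
    have h3 := Submodule.finrank_quotient_add_finrank
      ((bdryZero A T (T.card - 1)).map (integralLin T (T.card - 1)))
    have : FiniteDimensional ℝ (bdryZero B T (T.card - 1) ⊓
        LinearMap.ker (integralLin T (T.card - 1)) : Submodule ℝ _) :=
      Submodule.finiteDimensional_of_le inf_le_left
    have h4 : Module.finrank ℝ (bdryZero A T (T.card - 1) ⊓
        LinearMap.ker (integralLin T (T.card - 1)) : Submodule ℝ _) ≤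
        Module.finrank ℝ (bdryZero B T (T.card - 1) ⊓
        LinearMap.ker (integralLin T (T.card - 1)) : Submodule ℝ _) :=
      Submodule.finrank_mono (inf_le_inf_right _ hAB0)
    omega
  · have h1 := dimCohomology_add_finrank hk hTi hne (hA k)
    have : FiniteDimensional ℝ (cocycles A T (k + 1)) :=
      Submodule.finiteDimensional_of_le (S₂ := A T (k + 1)) fun u hu => hu.1.1
    -- Only the forms of `B_0^k(T)` whose derivative is a cocycle of `A_0` are counted; by exactness
    -- of `B_0` they reach every such cocycle.
    have h2 := finrank_map_fst_derivGraph hTi (bdryZero B T k) (cocycles A T (k + 1))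
    rw [hB.map_snd_derivGraph hT hAB] at h2
    have : FiniteDimensional ℝ (closedForms (bdryZero B T k)) :=
      Submodule.finiteDimensional_of_le (S₂ := bdryZero B T k) fun u hu => hu.1
    have h3 : Module.finrank ℝ (closedForms (bdryZero A T k)) ≤
        Module.finrank ℝ (closedForms (bdryZero B T k)) :=
      Submodule.finrank_mono fun u hu => ⟨hAB0 hu.1, hu.2⟩
    have h4 : Module.finrank ℝ ((derivGraph (bdryZero B T k) (cocycles A T (k + 1))).map
        (LinearMap.fst ℝ _ _)) ≤ Module.finrank ℝ (bdryZero B T k) := by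
      refine Submodule.finrank_mono ?_
      rintro _ ⟨⟨u, v⟩, ⟨hu, -⟩, rfl⟩
      exact hu
    omega

/-- The lower bound is attained if the closed forms of the system belong to `A`. -/
lemma IsCompatibleFES.finrank_bdryZero_eq (hB : IsCompatibleFES K B) {T : Finset E}
    (hT : T ∈ K.faces) (hAB : ∀ k, A T k ≤ B T k) (hA : StableOn A T)
    (hBA : ∀ k, ∀ u ∈ B T k, IsExtDeriv u 0 → u ∈ A T k) (k : ℕ) :
    Module.finrank ℝ (bdryZero B T k) =
      Module.finrank ℝ (bdryZero A T k) + dimCohomology A T (k + 1) := by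
  have hTi := K.indep hT
  have hne := K.nonempty_of_mem_faces hT
  have hfB : ∀ k, FiniteDimensional ℝ (B T k) := hB.finite T hT
  have hfA : ∀ k, FiniteDimensional ℝ (A T k) := fun k =>
    Submodule.finiteDimensional_of_le (hAB k)
  have hfB0 := finiteDimensional_bdryZero (hfB k)
  by_cases hk : k + 1 = T.card
  · have h1 : bdryZero B T k = bdryZero A T k := by
      ext u
      refine ⟨fun hu => ⟨hBA k u hu.1 ?_, hu.2⟩, fun hu => ⟨hAB k hu.1, hu.2⟩⟩
      obtain ⟨v, -, h, -⟩ := hB.extDeriv_closed hT hu.1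
      rwa [form_eq_zero hTi hk.ge v] at h
    obtain rfl : T.card - 1 = k := by omega
    have h2 := Submodule.finrank_quotient_add_finrank
      ((bdryZero B T (T.card - 1)).map (integralLin T (T.card - 1)))
    rw [hB.map_integralLin hT hk.symm, finrank_top] at h2
    rw [dimCohomology, if_pos hk, ← h1, hB.map_integralLin hT hk.symm]
    omega
  · have h1 := dimCohomology_add_finrank hk hTi hne (hA k)
    have : FiniteDimensional ℝ (cocycles A T (k + 1)) :=
      Submodule.finiteDimensional_of_le (S₂ := A T (k + 1)) fun u hu => hu.1.1
    have h2 := finrank_map_fst_derivGraph hTi (bdryZero B T k) (cocycles A T (k + 1))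
    have h3 : closedForms (bdryZero B T k) = closedForms (bdryZero A T k) := by
      ext u
      exact ⟨fun hu => ⟨⟨hBA k u hu.1.1 hu.2, hu.1.2⟩, hu.2⟩,
        fun hu => ⟨⟨hAB k hu.1.1, hu.1.2⟩, hu.2⟩⟩
    -- Derivatives of forms in `B_0` are closed, hence in `A`, so the subspace counted in the lower
    -- bound is all of `B_0^k(T)`.
    have h4 : (derivGraph (bdryZero B T k) (cocycles A T (k + 1))).map (LinearMap.fst ℝ _ _) =
        bdryZero B T k := by
      ext u
      constructor
      · rintro ⟨⟨u, v⟩, ⟨hu, -⟩, rfl⟩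
        exact hu
      · intro hu
        obtain ⟨v, hv, h, hd⟩ := hB.extDeriv_closed hT hu.1
        exact ⟨(u, v), ⟨hu, ⟨⟨hBA _ v hv hd, bdryZero_of_isExtDeriv hTi h hu.2⟩, hd,
          integralForm_eq_zero_of_isExtDeriv hTi hne h hu.2⟩, h⟩, rfl⟩
    rw [hB.map_snd_derivGraph hT hAB, h4, h3] at h2
    omega

end

/-! ### Polynomial forms and trimmed forms -/

lemma stableOn_polyForms {T : Finset E} (hT : AffineIndependent ℝ ((↑) : T → E))
    (hne : T.Nonempty) {r : ℕ} (hr : 1 ≤ r) : StableOn (polyForms (r - 1)) T := fun _ _ hu =>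
  exists_isExtDeriv_of_mem_trimmed hT hne (polyForms_le_trimmed hr hu)

lemma finrank_bdryZero_trimmed (K : Geometry.SimplicialComplex ℝ E) {T : Finset E}
    (hT : T ∈ K.faces) {r : ℕ} (hr : 1 ≤ r) (k : ℕ) :
    Module.finrank ℝ (bdryZero (trimmed r) T k) =
      Module.finrank ℝ (bdryZero (polyForms (r - 1)) T k) +
        dimCohomology (polyForms (r - 1)) T (k + 1) :=
  (isCompatibleFES_trimmed K hr).finrank_bdryZero_eq hT (fun _ => polyForms_le_trimmed hr)
    (stableOn_polyForms (K.indep hT) (K.nonempty_of_mem_faces hT) hr)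
    (fun _ _ hu hd => mem_polyForms_of_closed (K.indep hT) (K.nonempty_of_mem_faces hT) hr hu hd) k

/-- The simplicial complex of the faces of a simplex. -/
def faceComplex (T : Finset E) (hT : AffineIndependent ℝ ((↑) : T → E)) :
    Geometry.SimplicialComplex ℝ E where
  faces := {F | F.Nonempty ∧ F ⊆ T}
  isRelLowerSet_faces := by
    intro F hF
    exact ⟨hF.1, fun G hG hGne => ⟨hGne, hG.trans hF.2⟩⟩
  indep hF := hT.mono (Finset.coe_subset.2 hF.2)
  inter_subset_convexHull := by
    intro F G hF hG
    rw [← hT.convexHull_inter hF.2 hG.2]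

/-- All three minimality statements reduce to forms vanishing on the boundary, since the other
dimensions are sums of these over the same sets of faces. -/
theorem isMinimalCompatibleFES_trimmed (K : Geometry.SimplicialComplex ℝ E) {r : ℕ} (hr : 1 ≤ r) :
    IsMinimalCompatibleFES K (polyForms (r - 1)) (trimmed r) := by
  have key : ∀ B, IsCompatibleFES K B → ContainedIn K (polyForms (r - 1)) B → ∀ T ∈ K.faces, ∀ k,
      Module.finrank ℝ (bdryZero (trimmed r) T k) ≤ Module.finrank ℝ (bdryZero B T k) :=
    fun B hB hAB T hT k => (finrank_bdryZero_trimmed K hT hr k).trans_le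
      (hB.finrank_add_dimCohomology_le hT (hAB T hT)
        (stableOn_polyForms (K.indep hT) (K.nonempty_of_mem_faces hT) hr) k)
  have hM := isCompatibleFES_trimmed K hr
  refine ⟨hM, fun T _ k => polyForms_le_trimmed hr, key, fun B hB hAB T hT k => ?_,
    fun hK B hB hAB k => ?_⟩
  · rw [hM.finrank_cell hT, hB.finrank_cell hT]
    refine Finset.sum_le_sum fun F hF => key B hB hAB F ?_ k
    simp only [Finset.mem_filter, Finset.mem_powerset] at hF
    exact K.down_closed hT hF.1 hF.2
  · rw [hM.finrank_globalSpace hK, hB.finrank_globalSpace hK]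
    exact Finset.sum_le_sum fun F hF => key B hB hAB F (hK.mem_toFinset.1 hF) k

end FES

end

/-! ### The main theorem -/

theorem mainTheorem4 {E : Type*} [NormedAddCommGroup E] [InnerProductSpace ℝ E]
    [FiniteDimensional ℝ E] [MeasurableSpace E] [BorelSpace E] (r : ℕ) (hr : 1 ≤ r) :
    (∀ T : Finset E, T.Nonempty → AffineIndependent ℝ ((↑) : T → E) →
      ∀ k : ℕ,
        Module.finrank ℝ (FES.bdryZero (FES.trimmed r) T k) =
          Module.finrank ℝ (FES.bdryZero (FES.polyForms (r - 1)) T k) +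
            FES.dimCohomology (FES.polyForms (r - 1)) T (k + 1)) ∧
    (∀ K : Geometry.SimplicialComplex ℝ E,
      FES.IsMinimalCompatibleFES K (FES.polyForms (r - 1)) (FES.trimmed r)) := by
  refine ⟨fun T hne hT k => ?_, fun K => FES.isMinimalCompatibleFES_trimmed K hr⟩
  -- A single simplex is treated as a cell of the complex of its own faces.
  exact FES.finrank_bdryZero_trimmed (FES.faceComplex T hT) ⟨hne, subset_rfl⟩ hr k
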